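/- All operads are symmetric operads in $\mathbb{Z}$-graded $\mathbb{Q}$-vector spaces with Koszul signs, seen as functors on the groupoid of finite sets $I$ with partial compositions $\circ_\star : P(I\sqcup\{\star\})\otimes P(J)\to P(I\sqcup J)$. A tree is a leaf-labelled rooted binary tree (not planar); a forest on $I$ is a non-empty set of trees whose leaves are, altogether, bijectively labelled by $I$. Let $\operatorname{Det}(I)=\Lambda^{|I|}\mathbb{Q}I$, in degree $|I|-1$, with composition $(x\wedge\star)\circ_\star y=x\wedge y$. Let $B(I)$ be spanned by root-oriented forests $o\otimes F$, where $F$ is a forest on $I$ and $o$ is an orientation of the set of its roots; equivalently by exterior products $T_1\wedge\dots\wedge T_r$ of the trees of a forest. The degree is the number of roots minus one. With $e_{i,j}=i\wedge j$ (two trees, each a single leaf) and $\omega_{i,j}$ the tree with two leaves, the composition of $B$ is the one defined on $\operatorname{Det}\circ\operatorname{Gri}$ ($\operatorname{Gri}$ being the operad of trees under grafting) by the distributive law $$\omega_{i,\star}\circ_\star e_{j,k}=e_{j,\star}\circ_\star\omega_{i,k}-e_{k,\star}\circ_\star\omega_{i,j}.$$ Explicitly, $(T_1\wedge\dots\wedge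 T_r\wedge T)\circ_\star y=T_1\wedge\dots\wedge T_r\wedge(T\circ_\star y)$ if $\star$ is a leaf of $T$, where $\star\circ_\star y=y$ and $(S\vee T')\circ_\star y=D_S(T'\circ_\star y)$ if $\star$ is a leaf of $T'$; here $\vee$ is grafting and $D_S$ is the derivation of the exterior product with $D_S(T)=S\vee T$ on trees $T$. Let $\operatorname{Bess}=\operatorname{Det}\otimes B$, with composition $(o\otimes x)\circ_\star(o'\otimes y)=(-1)^{\deg x\,\deg o'}(o\circ_\star o')\otimes(x\circ_\star y)$, graded by the number of inner vertices of forests (this has the same parity as the tensor product degree). In $\operatorname{Bess}(\{i,j\})$ put $E_{i,j}=(j\wedge i)\otimes e_{i,j}$ and $\Omega_{i,j}=(i\wedge j)\otimes\omega_{i,j}$. **Proposition.** $\operatorname{Bess}$ is a graded operad. There is an isomorphism of graded operads onto $\operatorname{Bess}$ from the quotient of the free operad on generators $E_{i,j}$ (symmetric, degree $0$) and $\Omega_{i,j}$ (antisymmetric, degree $1$) by the operadic ideal generated by the relations $$E_{i,\star}\circ_\star E_{j,k}=E_{k,\star}\circ_\star E_{i,j},\qquad \Omega_{i,\star}\circ_\star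 E_{j,k}=E_{j,\star}\circ_\star\Omega_{i,k}+E_{k,\star}\circ_\star\Omega_{i,j},$$ and this isomorphism sends the generators to the elements $E_{i,j}$ and $\Omega_{i,j}$ of $\operatorname{Bess}$. Moreover, for every finite set $I$, each forest $F$ on $I$ has an oriented forest $o_1\otimes o_2\otimes F$ in $\operatorname{Bess}(I)$, with $o_1$ an orientation of $I$ and $o_2$ an orientation of the roots of $F$, and any choice of one such oriented forest for each $F$ is a basis of $\operatorname{Bess}(I)$. -/

import Mathlib

open scoped TensorProduct

noncomputable section

namespace Bessel

universe u v

/-! ### Graded operads over finite sets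

Operads in `ℤ`-graded `ℚ`-vector spaces with Koszul signs, seen as functors on the groupoid of
finite sets. The set `I ⊔ {⋆}` is `Option I` (with `⋆ = none`), and `I ⊔ J` is `I ⊕ J`. -/

/-- The data of a graded operad: spaces `P(I)` with homogeneous components, relabelling maps,
partial compositions `x ∘_⋆ y ∈ P(I ⊔ J)` for `x ∈ P(I ⊔ {⋆})`, `y ∈ P(J)`, and a unit. -/
structure OperadData where
  obj : (I : Type) → [Finite I] → Type u
  [acg : ∀ (I : Type) [Finite I], AddCommGroup (obj I)]
  [mod : ∀ (I : Type) [Finite I], Module ℚ (obj I)]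
  deg : ∀ (I : Type) [Finite I], ℤ → Submodule ℚ (obj I)
  map : ∀ {I J : Type} [Finite I] [Finite J], (I ≃ J) → (obj I →ₗ[ℚ] obj J)
  comp : ∀ {I J : Type} [Finite I] [Finite J], obj (Option I) →ₗ[ℚ] obj J →ₗ[ℚ] obj (I ⊕ J)
  one : obj PUnit.{1}

attribute [instance] OperadData.acg OperadData.mod

/-- `I ⊔ (J ⊔ {⋆}) ≃ (I ⊔ J) ⊔ {⋆}`. -/
def starRight (I J : Type) : I ⊕ Option J ≃ Option (I ⊕ J) where
  toFun
    | .inl i => some (.inl i)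
    | .inr none => none
    | .inr (some j) => some (.inr j)
  invFun
    | none => .inr none
    | some (.inl i) => .inl i
    | some (.inr j) => .inr (some j)
  left_inv := by rintro (i | _ | j) <;> rfl
  right_inv := by rintro (_ | i | j) <;> rfl

/-- `(I ⊔ {⋆}) ⊔ J ≃ (I ⊔ J) ⊔ {⋆}`. -/
def starLeft (I J : Type) : Option I ⊕ J ≃ Option (I ⊕ J) where
  toFun
    | .inl none => none
    | .inl (some i) => some (.inl i)
    | .inr j => some (.inr j)
  invFun
    | none => .inl none
    | some (.inl i) => .inl (some i)
    | some (.inr j) => .inr j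
  left_inv := by rintro ((_ | i) | j) <;> rfl
  right_inv := by rintro (_ | i | j) <;> rfl

/-- The exchange of the two extra points of `(I ⊔ {#}) ⊔ {⋆}`. -/
def swapStars (I : Type) : Option (Option I) ≃ Option (Option I) where
  toFun
    | none => some none
    | some none => none
    | some (some i) => some (some i)
  invFun
    | none => some none
    | some none => none
    | some (some i) => some (some i)
  left_inv := by rintro (_ | _ | i) <;> rfl
  right_inv := by rintro (_ | _ | i) <;> rfl

/-- `(I ⊔ K) ⊔ J ≃ (I ⊔ J) ⊔ K`. -/
def swapRight (I J K : Type) : (I ⊕ K) ⊕ J ≃ (I ⊕ J) ⊕ K where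
  toFun
    | .inl (.inl i) => .inl (.inl i)
    | .inl (.inr k) => .inr k
    | .inr j => .inl (.inr j)
  invFun
    | .inl (.inl i) => .inl (.inl i)
    | .inl (.inr j) => .inr j
    | .inr k => .inl (.inr k)
  left_inv := by rintro ((i | k) | j) <;> rfl
  right_inv := by rintro ((i | j) | k) <;> rfl

/-- `LawDefect P I x` says that `x ∈ P(I)` is the difference of the two sides of an instance of
one of the laws of operads: functoriality, naturality of the composition, the unit laws, and
the associativity laws for nested and for parallel compositions (the last one with the Koszul
sign). -/
inductive LawDefect (P : OperadData.{u}) : ∀ (I : Type) [Finite I], P.obj I → Prop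
  | map_refl {I : Type} [Finite I] (x : P.obj I) :
      LawDefect P I (P.map (Equiv.refl I) x - x)
  | map_trans {I J K : Type} [Finite I] [Finite J] [Finite K] (e : I ≃ J) (f : J ≃ K)
      (x : P.obj I) :
      LawDefect P K (P.map f (P.map e x) - P.map (e.trans f) x)
  | comp_map {I I' J J' : Type} [Finite I] [Finite I'] [Finite J] [Finite J']
      (e : I ≃ I') (f : J ≃ J') (x : P.obj (Option I)) (y : P.obj J) :
      LawDefect P (I' ⊕ J') (P.comp (P.map (Equiv.optionCongr e) x) (P.map f y)
        - P.map (Equiv.sumCongr e f) (P.comp x y))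
  | comp_one {I : Type} [Finite I] (x : P.obj (Option I)) :
      LawDefect P (I ⊕ PUnit.{1}) (P.comp x P.one - P.map (Equiv.optionEquivSumPUnit I) x)
  | one_comp {J : Type} [Finite J] (y : P.obj J) :
      LawDefect P J (P.map (Equiv.emptySum Empty J)
        (P.comp (P.map (Equiv.ofUnique PUnit.{1} (Option Empty)) P.one) y) - y)
  | nested {I J K : Type} [Finite I] [Finite J] [Finite K]
      (x : P.obj (Option I)) (y : P.obj (Option J)) (z : P.obj K) :
      LawDefect P (I ⊕ (J ⊕ K)) (P.comp x (P.comp y z)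
        - P.map (Equiv.sumAssoc I J K) (P.comp (P.map (starRight I J) (P.comp x y)) z))
  | parallel {I J K : Type} [Finite I] [Finite J] [Finite K] (p q : ℤ)
      (x : P.obj (Option (Option I))) (y : P.obj J) (z : P.obj K)
      (hy : y ∈ P.deg J p) (hz : z ∈ P.deg K q) :
      LawDefect P ((I ⊕ J) ⊕ K)
        (P.comp (P.map (starLeft I J) (P.comp x y)) z
          - (p * q).negOnePow • P.map (swapRight I J K)
              (P.comp (P.map (starLeft I K) (P.comp (P.map (swapStars I) x) z)) y))

/-- The data `P` form a graded operad. -/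
structure IsOperad (P : OperadData.{u}) : Prop where
  isInternal : ∀ (I : Type) [Finite I], DirectSum.IsInternal (P.deg I)
  map_mem : ∀ {I J : Type} [Finite I] [Finite J] (e : I ≃ J) (n : ℤ) (x : P.obj I),
    x ∈ P.deg I n → P.map e x ∈ P.deg J n
  comp_mem : ∀ {I J : Type} [Finite I] [Finite J] (m n : ℤ) (x : P.obj (Option I)) (y : P.obj J),
    x ∈ P.deg (Option I) m → y ∈ P.deg J n → P.comp x y ∈ P.deg (I ⊕ J) (m + n)
  one_mem : P.one ∈ P.deg PUnit 0
  laws : ∀ (I : Type) [Finite I] (x : P.obj I), LawDefect P I x → x = 0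

/-- Isomorphisms of graded operads. -/
structure OperadIso (P : OperadData.{u}) (Q : OperadData.{v}) where
  equiv : ∀ (I : Type) [Finite I], P.obj I ≃ₗ[ℚ] Q.obj I
  mem_deg_iff : ∀ (I : Type) [Finite I] (n : ℤ) (x : P.obj I),
    equiv I x ∈ Q.deg I n ↔ x ∈ P.deg I n
  map_map : ∀ {I J : Type} [Finite I] [Finite J] (e : I ≃ J) (x : P.obj I),
    equiv J (P.map e x) = Q.map e (equiv I x)
  map_comp : ∀ {I J : Type} [Finite I] [Finite J] (x : P.obj (Option I)) (y : P.obj J),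
    equiv (I ⊕ J) (P.comp x y) = Q.comp (equiv (Option I) x) (equiv J y)
  map_one : equiv PUnit P.one = Q.one

/-- Membership in the operadic ideal generated by the elements satisfying `R`: the smallest family
of subspaces which contains these elements and is stable under relabelling and under composition
with arbitrary elements on either side. -/
inductive IdealMem (P : OperadData.{u}) (R : ∀ (I : Type) [Finite I], P.obj I → Prop) :
    ∀ (I : Type) [Finite I], P.obj I → Prop
  | of {I : Type} [Finite I] (x : P.obj I) (hx : R I x) : IdealMem P R I x
  | zero {I : Type} [Finite I] : IdealMem P R I 0
  | sum {I : Type} [Finite I] (x y : P.obj I) (hx : IdealMem P R I x) (hy : IdealMem P R I y) :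
      IdealMem P R I (x + y)
  | smul {I : Type} [Finite I] (c : ℚ) (x : P.obj I) (hx : IdealMem P R I x) :
      IdealMem P R I (c • x)
  | map {I J : Type} [Finite I] [Finite J] (e : I ≃ J) (x : P.obj I) (hx : IdealMem P R I x) :
      IdealMem P R J (P.map e x)
  | comp_left {I J : Type} [Finite I] [Finite J] (x : P.obj (Option I)) (y : P.obj J)
      (hx : IdealMem P R (Option I) x) : IdealMem P R (I ⊕ J) (P.comp x y)
  | comp_right {I J : Type} [Finite I] [Finite J] (x : P.obj (Option I)) (y : P.obj J)
      (hy : IdealMem P R J y) : IdealMem P R (I ⊕ J) (P.comp x y)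

/-- The operadic ideal generated by `R`. -/
def ideal (P : OperadData.{u}) (R : ∀ (I : Type) [Finite I], P.obj I → Prop)
    (I : Type) [Finite I] : Submodule ℚ (P.obj I) where
  carrier := {x | IdealMem P R I x}
  add_mem' hx hy := .sum _ _ hx hy
  zero_mem' := .zero
  smul_mem' c x hx := .smul c x hx

/-- The quotient of `P` by the operadic ideal generated by `R`. -/
def quotient (P : OperadData.{u}) (R : ∀ (I : Type) [Finite I], P.obj I → Prop) :
    OperadData.{u} where
  obj I _ := P.obj I ⧸ ideal P R I
  deg I _ n := (P.deg I n).map (ideal P R I).mkQ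
  map {I J} _ _ e := (ideal P R I).mapQ (ideal P R J) (P.map e) fun x hx => IdealMem.map e x hx
  comp {I J} _ _ := (ideal P R (Option I)).liftQ
    { toFun := fun x => (ideal P R J).mapQ (ideal P R (I ⊕ J)) (P.comp x)
        fun y hy => IdealMem.comp_right x y hy
      map_add' := fun x x' => by
        ext y
        simp
        rfl
      map_smul' := fun c x => by
        ext y
        simp
        rfl }
    (fun x hx => by
      ext y
      exact (Submodule.Quotient.mk_eq_zero _).2 (IdealMem.comp_left x y hx))
  one := (ideal P R PUnit).mkQ P.one

/-! ### The free operad on `E` and `Ω`, and the presented operad -/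

/-- The two binary generators. -/
inductive Gen
  | E
  | Om

/-- `E` has degree `0`, `Ω` has degree `1`. -/
def Gen.degree : Gen → ℤ
  | .E => 0
  | .Om => 1

/-- `E` is symmetric, `Ω` is antisymmetric. -/
def Gen.symm : Gen → ℚ
  | .E => 1
  | .Om => -1

/-- Formal operadic monomials in the generators. The binary generators have the inputs
`0, 1 : Fin 2`. -/
inductive Monom : Type → Type 1
  | one : Monom PUnit.{1}
  | gen (g : Gen) : Monom (Fin 2)
  | map {I J : Type} (e : I ≃ J) (t : Monom I) : Monom J
  | comp {I J : Type} (s : Monom (Option I)) (t : Monom J) : Monom (I ⊕ J)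

/-- The degree of a monomial, the number of `Ω` in it. -/
def Monom.degree : {I : Type} → Monom I → ℤ
  | _, .one => 0
  | _, .gen g => g.degree
  | _, .map _ t => t.degree
  | _, .comp s t => s.degree + t.degree

/-- Linear combinations of formal monomials, with no law imposed. -/
def formalData : OperadData.{1} where
  obj I _ := Monom I →₀ ℚ
  deg I _ n := Submodule.span ℚ {x | ∃ t : Monom I, t.degree = n ∧ x = Finsupp.single t 1}
  map e := Finsupp.lmapDomain ℚ ℚ (Monom.map e)
  comp {I J} _ _ := Finsupp.linearCombination ℚ fun s : Monom (Option I) =>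
    Finsupp.lmapDomain ℚ ℚ fun t : Monom J => Monom.comp s t
  one := Finsupp.single .one 1

/-- What has to vanish in the free operad: the defects of the laws of operads, and the
differences `g_{1,0} - (± g_{0,1})` expressing the symmetry of the generators. -/
inductive FreeRel : ∀ (I : Type) [Finite I], formalData.obj I → Prop
  | ax {I : Type} [Finite I] (x : formalData.obj I) (hx : LawDefect formalData I x) :
      FreeRel I x
  | symm (g : Gen) : FreeRel (Fin 2)
      (Finsupp.single (.map (Equiv.swap 0 1) (.gen g)) 1 - Finsupp.single (.gen g) g.symm)

/-- The free operad on `E` (symmetric, degree `0`) and `Ω` (antisymmetric, degree `1`). -/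
def freeOperad : OperadData.{1} := quotient formalData FreeRel

/-- The generators `E_{0,1}` and `Ω_{0,1}` of the free operad. -/
def freeGen (g : Gen) : freeOperad.obj (Fin 2) :=
  (ideal formalData FreeRel (Fin 2)).mkQ (Finsupp.single (.gen g) 1)

/-- For `g, h ∈ P({0, 1})`, the element `g_{i,⋆} ∘_⋆ h_{j,k}` of `P({0, 1, 2})`, where
`(i, j, k) = (σ 0, σ 1, σ 2)`. Here `finSuccEquivLast` sends `0` to `some 0` and `1` to `⋆ = none`,
and `finSumFinEquiv` sends `inl 0` to `0`, `inr 0` to `1` and `inr 1` to `2`. -/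
def graft3 (P : OperadData.{u}) (σ : Equiv.Perm (Fin 3)) (g h : P.obj (Fin 2)) : P.obj (Fin 3) :=
  P.map σ (P.map (finSumFinEquiv (m := 1) (n := 2)) (P.comp (P.map finSuccEquivLast g) h))

/-- The permutation `(i, j, k) = (2, 0, 1)` of `(0, 1, 2)`. -/
def perm201 : Equiv.Perm (Fin 3) where
  toFun := ![2, 0, 1]
  invFun := ![1, 2, 0]
  left_inv := by decide
  right_inv := by decide

/-- The permutation `(i, j, k) = (1, 0, 2)` of `(0, 1, 2)`. -/
def perm102 : Equiv.Perm (Fin 3) where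
  toFun := ![1, 0, 2]
  invFun := ![1, 0, 2]
  left_inv := by decide
  right_inv := by decide

/-- The relations, with `(i, j, k) = (0, 1, 2)`:
`E_{i,⋆} ∘ E_{j,k} = E_{k,⋆} ∘ E_{i,j}` and
`Ω_{i,⋆} ∘ E_{j,k} = E_{j,⋆} ∘ Ω_{i,k} + E_{k,⋆} ∘ Ω_{i,j}`. -/
inductive BessRel : ∀ (I : Type) [Finite I], freeOperad.obj I → Prop
  | rel₁ : BessRel (Fin 3)
      (graft3 freeOperad (Equiv.refl _) (freeGen .E) (freeGen .E)
        - graft3 freeOperad perm201 (freeGen .E) (freeGen .E))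
  | rel₂ : BessRel (Fin 3)
      (graft3 freeOperad (Equiv.refl _) (freeGen .Om) (freeGen .E)
        - (graft3 freeOperad perm102 (freeGen .E) (freeGen .Om)
          + graft3 freeOperad perm201 (freeGen .E) (freeGen .Om)))

/-- The quotient of the free operad by the operadic ideal of the relations. -/
def presentedOperad : OperadData.{1} := quotient freeOperad BessRel

/-- The classes of the generators in the presented operad. -/
def presentedGen (g : Gen) : presentedOperad.obj (Fin 2) :=
  (ideal freeOperad BessRel (Fin 2)).mkQ (freeGen g)

/-! ### Exterior algebra -/

section Exterior

variable {M M' : Type*} [AddCommGroup M] [Module ℚ M] [AddCommGroup M'] [Module ℚ M']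

/-- One step of the recursion `κ (a ∧ m) = a ⊗ m - κ a ∧ m`. -/
def extractStep (M : Type*) [AddCommGroup M] [Module ℚ M] :
    M →ₗ[ℚ] (ExteriorAlgebra ℚ M × (ExteriorAlgebra ℚ M ⊗[ℚ] M)) →ₗ[ℚ]
      (ExteriorAlgebra ℚ M × (ExteriorAlgebra ℚ M ⊗[ℚ] M)) :=
  LinearMap.mk₂ ℚ
    (fun m p => (p.1 * ExteriorAlgebra.ι ℚ m,
      p.1 ⊗ₜ[ℚ] m - (LinearMap.mulRight ℚ (ExteriorAlgebra.ι ℚ m)).rTensor M p.2))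
    (fun m m' p => by
      have h : LinearMap.mulRight ℚ (ExteriorAlgebra.ι ℚ m + ExteriorAlgebra.ι ℚ m')
          = LinearMap.mulRight ℚ (ExteriorAlgebra.ι ℚ m)
            + LinearMap.mulRight ℚ (ExteriorAlgebra.ι ℚ m') := by
        ext x
        simp [mul_add]
      ext1
      · simp [mul_add]
      · simp only [map_add, h, LinearMap.rTensor_add, TensorProduct.tmul_add, LinearMap.add_apply,
          Prod.snd_add]
        abel)
    (fun c m p => by
      have h : LinearMap.mulRight ℚ (c • ExteriorAlgebra.ι ℚ m)
          = c • LinearMap.mulRight ℚ (ExteriorAlgebra.ι ℚ m) := by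
        ext x
        simp
      ext1
      · simp
      · simp only [map_smul, h, LinearMap.rTensor_smul, TensorProduct.tmul_smul,
          LinearMap.smul_apply, Prod.smul_snd, smul_sub])
    (fun m p p' => by
      ext1
      · simp [add_mul]
      · simp only [Prod.fst_add, Prod.snd_add, map_add, TensorProduct.add_tmul]
        abel)
    (fun c m p => by
      ext1
      · simp
      · simp only [Prod.smul_fst, Prod.smul_snd, map_smul, TensorProduct.smul_tmul', smul_sub])

theorem extractStep_sq (m : M) (p : ExteriorAlgebra ℚ M × (ExteriorAlgebra ℚ M ⊗[ℚ] M)) :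
    extractStep M m (extractStep M m p) = (0 : QuadraticForm ℚ M) m • p := by
  have h : (LinearMap.mulRight ℚ (ExteriorAlgebra.ι ℚ m)).rTensor M
      ((LinearMap.mulRight ℚ (ExteriorAlgebra.ι ℚ m)).rTensor M p.2) = 0 := by
    rw [← LinearMap.comp_apply, ← LinearMap.rTensor_comp]
    have : LinearMap.mulRight ℚ (ExteriorAlgebra.ι ℚ m)
        ∘ₗ LinearMap.mulRight ℚ (ExteriorAlgebra.ι ℚ m) = 0 := by
      ext x
      simp [mul_assoc]
    simp [this]
  ext1
  · simp [extractStep, mul_assoc]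
  · simp [extractStep, h]

/-- The map `Λ M → Λ M ⊗ M` which moves each factor in turn to the right end:
`x₁ ∧ ⋯ ∧ xᵣ ↦ ∑ᵢ (-1)^(r-i) (x₁ ∧ ⋯ x̂ᵢ ⋯ ∧ xᵣ) ⊗ xᵢ`. -/
def extract (M : Type*) [AddCommGroup M] [Module ℚ M] :
    ExteriorAlgebra ℚ M →ₗ[ℚ] ExteriorAlgebra ℚ M ⊗[ℚ] M :=
  LinearMap.snd ℚ _ _ ∘ₗ CliffordAlgebra.foldl 0 (extractStep M) extractStep_sq (1, 0)

/-- `x₁ ∧ ⋯ ∧ xᵣ ↦ ∑ᵢ (-1)^(r-i) (F x₁ ∧ ⋯ (F xᵢ omitted) ⋯ ∧ F xᵣ) ∧ φ xᵢ`. -/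
def expand (F : M →ₗ[ℚ] M') (φ : M →ₗ[ℚ] ExteriorAlgebra ℚ M') :
    ExteriorAlgebra ℚ M →ₗ[ℚ] ExteriorAlgebra ℚ M' :=
  TensorProduct.lift ((LinearMap.mul ℚ (ExteriorAlgebra ℚ M')).compl₁₂
    (ExteriorAlgebra.map F).toLinearMap φ) ∘ₗ extract M

/-- The even derivation of `Λ M` extending an endomorphism `f` of `M`:
`x₁ ∧ ⋯ ∧ xᵣ ↦ ∑ᵢ x₁ ∧ ⋯ ∧ f xᵢ ∧ ⋯ ∧ xᵣ`. -/
def derivation (f : M →ₗ[ℚ] M) : ExteriorAlgebra ℚ M →ₗ[ℚ] ExteriorAlgebra ℚ M :=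
  expand LinearMap.id (ExteriorAlgebra.ι ℚ ∘ₗ f)

/-- The exterior product of a list of vectors. -/
def wedgeVec (l : List M) : ExteriorAlgebra ℚ M := (l.map (ExteriorAlgebra.ι ℚ)).prod

end Exterior


/-! ### Helper facts on exterior products of lists -/

section ExteriorFacts

variable {M M' : Type*} [AddCommGroup M] [Module ℚ M] [AddCommGroup M'] [Module ℚ M']

theorem wedgeVec_append (l l' : List M) : wedgeVec (l ++ l') = wedgeVec l * wedgeVec l' := by
  simp [wedgeVec]

theorem foldl_fst (a : ExteriorAlgebra ℚ M) (p) :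
    (CliffordAlgebra.foldl 0 (extractStep M) extractStep_sq p a).1 = p.1 * a := by
  induction a using CliffordAlgebra.induction generalizing p with
  | algebraMap r => simp [CliffordAlgebra.foldl_algebraMap, Algebra.smul_def, Algebra.commutes]
  | ι m =>
    rw [CliffordAlgebra.foldl_ι]
    rfl
  | mul a b ha hb => rw [CliffordAlgebra.foldl_mul, hb, ha, mul_assoc]
  | add a b ha hb => simp [ha, hb, mul_add]

theorem extract_mul_ι (a : ExteriorAlgebra ℚ M) (m : M) :
    extract M (a * ExteriorAlgebra.ι ℚ m) = a ⊗ₜ[ℚ] m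
      - (LinearMap.mulRight ℚ (ExteriorAlgebra.ι ℚ m)).rTensor M (extract M a) := by
  have h := foldl_fst a (1, 0)
  have h' : CliffordAlgebra.foldl 0 (extractStep M) extractStep_sq (1, 0)
      (a * ExteriorAlgebra.ι ℚ m) = extractStep M m
        (CliffordAlgebra.foldl 0 (extractStep M) extractStep_sq (1, 0) a) := by
    rw [CliffordAlgebra.foldl_mul]
    exact CliffordAlgebra.foldl_ι _ _ _ _ _
  simp only [extract, LinearMap.comp_apply]
  rw [h']
  rw [one_mul] at h
  change (_ : ExteriorAlgebra ℚ M × _).1 ⊗ₜ[ℚ] m - _ = _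
  rw [h]
  rfl

theorem extract_one : extract M (1 : ExteriorAlgebra ℚ M) = 0 := by
  simp only [extract, LinearMap.comp_apply]
  rw [CliffordAlgebra.foldl_one]
  rfl

theorem extract_wedgeVec (l : List M) :
    extract M (wedgeVec l) ∈ Submodule.span ℚ
      {x | ∃ l₁ m l₂, l = l₁ ++ m :: l₂ ∧ x = wedgeVec (l₁ ++ l₂) ⊗ₜ[ℚ] m} := by
  induction l using List.reverseRecOn with
  | nil => simp [wedgeVec, extract_one]
  | append_singleton l m ih =>
    have h : wedgeVec (l ++ [m]) = wedgeVec l * ExteriorAlgebra.ι ℚ m := by simp [wedgeVec]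
    rw [h, extract_mul_ι]
    refine Submodule.sub_mem _ (Submodule.subset_span ⟨l, m, [], by simp, by simp⟩) ?_
    generalize extract M (wedgeVec l) = t at ih
    induction ih using Submodule.span_induction with
    | mem x hx =>
      obtain ⟨l₁, m', l₂, rfl, rfl⟩ := hx
      refine Submodule.subset_span ⟨l₁, m', l₂ ++ [m], by simp, ?_⟩
      simp [wedgeVec, mul_assoc]
    | zero => simp
    | add x y _ _ hx hy => simpa using Submodule.add_mem _ hx hy
    | smul c x _ hx => simpa using Submodule.smul_mem _ c hx

theorem expand_wedgeVec (F : M →ₗ[ℚ] M') (φ : M →ₗ[ℚ] ExteriorAlgebra ℚ M') (l : List M)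
    (S : Submodule ℚ (ExteriorAlgebra ℚ M'))
    (h : ∀ l₁ m l₂, l = l₁ ++ m :: l₂ → wedgeVec ((l₁ ++ l₂).map F) * φ m ∈ S) :
    expand F φ (wedgeVec l) ∈ S := by
  have := extract_wedgeVec l
  simp only [expand, LinearMap.comp_apply]
  generalize extract M (wedgeVec l) = t at this
  induction this using Submodule.span_induction with
  | mem x hx =>
    obtain ⟨l₁, m, l₂, hl, rfl⟩ := hx
    have := h l₁ m l₂ hl
    simpa [wedgeVec, map_list_prod, Function.comp_def] using this
  | zero => simp
  | add x y _ _ hx hy => simpa using Submodule.add_mem _ hx hy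
  | smul c x _ hx => simpa using Submodule.smul_mem _ c hx

theorem expand_right (F : M →ₗ[ℚ] M') (φ φ' : M →ₗ[ℚ] ExteriorAlgebra ℚ M') (c : ℚ)
    (x : ExteriorAlgebra ℚ M) :
    expand F (φ + φ') x = expand F φ x + expand F φ' x
      ∧ expand F (c • φ) x = c • expand F φ x := by
  simp only [expand, LinearMap.comp_apply]
  induction extract M x using TensorProduct.induction_on with
  | zero => simp
  | tmul a m => simp [mul_add]
  | add a b ha hb =>
    simp only [map_add, ha.1, ha.2, hb.1, hb.2, smul_add]
    exact ⟨by abel, trivial⟩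

/-- `expand` as a bilinear map, when `φ` depends linearly on a further argument. -/
def expandBilin {N : Type*} [AddCommGroup N] [Module ℚ N] (F : M →ₗ[ℚ] M')
    (φ : N →ₗ[ℚ] M →ₗ[ℚ] ExteriorAlgebra ℚ M') :
    ExteriorAlgebra ℚ M →ₗ[ℚ] N →ₗ[ℚ] ExteriorAlgebra ℚ M' :=
  LinearMap.mk₂ ℚ (fun x y => expand F (φ y) x) (fun x x' y => map_add _ x x')
    (fun c x y => map_smul _ c x)
    (fun x y y' => by rw [map_add]; exact (expand_right F _ _ 0 x).1)
    (fun c x y => by rw [map_smul]; exact (expand_right F _ 0 c x).2)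

/-- Restriction of a bilinear map to subspaces. -/
def restrictBilin {N : Type*} [AddCommGroup N] [Module ℚ N] (f : M →ₗ[ℚ] N →ₗ[ℚ] M')
    (A : Submodule ℚ M) (B : Submodule ℚ N) (C : Submodule ℚ M')
    (h : ∀ x ∈ A, ∀ y ∈ B, f x y ∈ C) : A →ₗ[ℚ] B →ₗ[ℚ] C :=
  LinearMap.mk₂ ℚ (fun x y => ⟨f x y, h x x.2 y y.2⟩)
    (fun x x' y => by ext; simp) (fun c x y => by ext; simp)
    (fun x y y' => by ext; simp) (fun c x y => by ext; simp)

theorem exteriorPower_eq_span (n : ℕ) :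
    (⋀[ℚ]^n M : Submodule ℚ (ExteriorAlgebra ℚ M))
      = Submodule.span ℚ {x | ∃ l : List M, l.length = n ∧ x = wedgeVec l} := by
  rw [← ExteriorAlgebra.ιMulti_span_fixedDegree]
  congr 1
  ext x
  constructor
  · rintro ⟨v, rfl⟩
    refine ⟨List.ofFn v, by simp, ?_⟩
    simp [ExteriorAlgebra.ιMulti_apply, wedgeVec, List.map_ofFn, Function.comp_def]
  · rintro ⟨l, rfl, rfl⟩
    refine ⟨l.get, ?_⟩
    have h : (List.ofFn fun i => ExteriorAlgebra.ι ℚ (l.get i))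
        = (List.ofFn l.get).map (ExteriorAlgebra.ι ℚ) := by
      rw [List.map_ofFn]
      rfl
    rw [ExteriorAlgebra.ιMulti_apply, h, List.ofFn_get]
    rfl

theorem wedgeVec_mem (l : List M) {n : ℕ} (h : l.length = n) :
    wedgeVec l ∈ (⋀[ℚ]^n M : Submodule ℚ (ExteriorAlgebra ℚ M)) := by
  rw [exteriorPower_eq_span]
  exact Submodule.subset_span ⟨l, h, rfl⟩

theorem map_mem_exteriorPower (F : M →ₗ[ℚ] M') {n : ℕ} (x : ExteriorAlgebra ℚ M)
    (hx : x ∈ (⋀[ℚ]^n M : Submodule ℚ (ExteriorAlgebra ℚ M))) :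
    ExteriorAlgebra.map F x ∈ (⋀[ℚ]^n M' : Submodule ℚ (ExteriorAlgebra ℚ M')) := by
  rw [exteriorPower_eq_span] at hx
  induction hx using Submodule.span_induction with
  | mem x hx =>
    obtain ⟨l, hl, rfl⟩ := hx
    have : ExteriorAlgebra.map F (wedgeVec l) = wedgeVec (l.map F) := by
      simp [wedgeVec, map_list_prod, Function.comp_def]
    rw [this]
    exact wedgeVec_mem _ (by simpa using hl)
  | zero => simp
  | add x y _ _ hx hy => simpa using Submodule.add_mem _ hx hy
  | smul c x _ hx => simpa using Submodule.smul_mem _ c hx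

end ExteriorFacts

/-! ### The determinant operad -/

section Determinant

/-- The vector space `ℚ I`. -/
abbrev Vec (I : Type) : Type := I →₀ ℚ

/-- `Det(I)`, the top exterior power of `ℚ I`. -/
abbrev DetSpace (I : Type) [Finite I] : Submodule ℚ (ExteriorAlgebra ℚ (Vec I)) :=
  ⋀[ℚ]^(Nat.card I) (Vec I)

/-- The orientation `i₁ ∧ ⋯ ∧ iₙ` (an element of `Det(I)`, with `n = |I|`). -/
def orient {I : Type} [Finite I] (l : List I) (h : l.length = Nat.card I) : DetSpace I :=
  ⟨wedgeVec (l.map fun i => Finsupp.single i 1), wedgeVec_mem _ (by simpa using h)⟩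

/-- Relabelling in `Det`. -/
def detMap {I J : Type} [Finite I] [Finite J] (e : I ≃ J) : DetSpace I →ₗ[ℚ] DetSpace J :=
  (ExteriorAlgebra.map (Finsupp.lmapDomain ℚ ℚ e)).toLinearMap.restrict fun x hx => by
    rw [DetSpace, ← Nat.card_congr e]
    exact map_mem_exteriorPower _ x hx

/-- The linear map `ℚ (I ⊔ {⋆}) → ℚ (I ⊔ J)` with `i ↦ i` and `⋆ ↦ 0`. -/
def detForget (I J : Type) : Vec (Option I) →ₗ[ℚ] Vec (I ⊕ J) :=
  Finsupp.linearCombination ℚ fun o : Option I => o.elim 0 fun i => Finsupp.single (Sum.inl i) 1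

/-- For `y ∈ Λ(ℚ J)`, the linear map `ℚ (I ⊔ {⋆}) → Λ(ℚ (I ⊔ J))` with `i ↦ 0` and `⋆ ↦ y`. -/
def detInsert (I J : Type) :
    ExteriorAlgebra ℚ (Vec J) →ₗ[ℚ] Vec (Option I) →ₗ[ℚ] ExteriorAlgebra ℚ (Vec (I ⊕ J)) :=
  (LinearMap.lsmul ℚ (ExteriorAlgebra ℚ (Vec (I ⊕ J)))).flip.compl₁₂
    (ExteriorAlgebra.map (Finsupp.lmapDomain ℚ ℚ Sum.inr)).toLinearMap (Finsupp.lapply none)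

theorem detComp_mem (I J : Type) [Finite I] [Finite J] :
    ∀ x ∈ DetSpace (Option I), ∀ y ∈ DetSpace J,
      expandBilin (detForget I J) (detInsert I J) x y ∈ DetSpace (I ⊕ J) := by
  intro x hx y hy
  rw [DetSpace, exteriorPower_eq_span] at hx
  induction hx using Submodule.span_induction with
  | mem x hx =>
    obtain ⟨l, hl, rfl⟩ := hx
    refine expand_wedgeVec _ _ _ _ fun l₁ m l₂ h => ?_
    have h₁ : wedgeVec ((l₁ ++ l₂).map (detForget I J)) ∈
        (⋀[ℚ]^(Nat.card I) (Vec (I ⊕ J)) : Submodule ℚ (ExteriorAlgebra ℚ (Vec (I ⊕ J)))) := by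
      refine wedgeVec_mem _ ?_
      have : l.length = l₁.length + l₂.length + 1 := by simp [h, add_assoc]
      have h' : Nat.card (Option I) = Nat.card I + 1 := Finite.card_option
      simp only [List.length_map, List.length_append]
      omega
    have h₂ : detInsert I J y m ∈
        (⋀[ℚ]^(Nat.card J) (Vec (I ⊕ J)) : Submodule ℚ (ExteriorAlgebra ℚ (Vec (I ⊕ J)))) :=
      Submodule.smul_mem _ _ (map_mem_exteriorPower _ y hy)
    rw [DetSpace, Nat.card_sum]
    change _ ∈ LinearMap.range (ExteriorAlgebra.ι ℚ) ^ (Nat.card I + Nat.card J)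
    rw [pow_add]
    exact Submodule.mul_mem_mul h₁ h₂
  | zero => simp
  | add x x' _ _ hx hx' => simpa using Submodule.add_mem _ hx hx'
  | smul c x _ hx => simpa using Submodule.smul_mem _ c hx

/-- The composition of `Det`: `(x ∧ ⋆) ∘_⋆ y = x ∧ y`. -/
def detComp (I J : Type) [Finite I] [Finite J] :
    DetSpace (Option I) →ₗ[ℚ] DetSpace J →ₗ[ℚ] DetSpace (I ⊕ J) :=
  restrictBilin (expandBilin (detForget I J) (detInsert I J)) _ _ _ (detComp_mem I J)

/-- The operad `Det`, with `Det(I)` in degree `|I| - 1`. -/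
def Det : OperadData.{0} where
  obj I _ := DetSpace I
  deg I _ n := if n = (Nat.card I : ℤ) - 1 then ⊤ else ⊥
  map e := detMap e
  comp {I J} _ _ := detComp I J
  one := orient [PUnit.unit] (by simp)

end Determinant

/-! ### Trees and forests -/

section Trees

variable {I J : Type}

/-- Rooted binary trees with leaves labelled by elements of `I`, not considered as planar: the free
commutative magma on `I`, i.e. planar binary trees up to exchanging the two sides at any vertex.
The product `S * T` is the tree `S ∨ T` obtained by grafting. -/
def TreeCon (I : Type) : Con (FreeMagma I) :=
  conGen fun s t => ∃ a b, s = a * b ∧ t = b * a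

/-- See `TreeCon`. -/
abbrev Tree (I : Type) : Type := (TreeCon I).Quotient

theorem Tree.mul_comm' (s t : Tree I) : s * t = t * s := by
  induction s, t using Con.induction_on₂ with
  | H a b => exact (Con.eq _).2 (ConGen.Rel.of _ _ ⟨a, b, rfl, rfl⟩)

/-- The tree without inner vertex. -/
def Tree.leaf (i : I) : Tree I := (FreeMagma.of i : FreeMagma I)

/-- The multiset of labels of the leaves of a planar tree. -/
def planarLeaves : FreeMagma I → Multiset I
  | .of i => {i}
  | .mul a b => planarLeaves a + planarLeaves b

/-- The number of inner vertices of a planar tree. -/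
def planarVertices : FreeMagma I → ℕ
  | .of _ => 0
  | .mul a b => planarVertices a + planarVertices b + 1

/-- The multiset of labels of the leaves of a tree. -/
def Tree.leaves (t : Tree I) : Multiset I :=
  Con.liftOn t planarLeaves fun a b h => by
    induction h with
    | of s t h =>
      obtain ⟨a, b, rfl, rfl⟩ := h
      exact add_comm _ _
    | refl => rfl
    | symm _ ih => exact ih.symm
    | trans _ _ ih ih' => exact ih.trans ih'
    | mul _ _ ih ih' => exact congrArg₂ _ ih ih'

/-- The number of inner vertices of a tree. -/
def Tree.vertices (t : Tree I) : ℕ :=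
  Con.liftOn t planarVertices fun a b h => by
    induction h with
    | of s t h =>
      obtain ⟨a, b, rfl, rfl⟩ := h
      exact congrArg (· + 1) (add_comm _ _)
    | refl => rfl
    | symm _ ih => exact ih.symm
    | trans _ _ ih ih' => exact ih.trans ih'
    | mul _ _ ih ih' => exact congrArg (· + 1) (congrArg₂ _ ih ih')

/-- Relabelling of trees. -/
def Tree.map (f : I → J) (t : Tree I) : Tree J :=
  Con.liftOn t (fun a => ((FreeMagma.map f a : FreeMagma J) : Tree J)) fun a b h => by
    induction h with
    | of s t h =>
      obtain ⟨a, b, rfl, rfl⟩ := h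
      simp only [map_mul, Con.coe_mul]
      exact Tree.mul_comm' _ _
    | refl => rfl
    | symm _ ih => exact ih.symm
    | trans _ _ ih ih' => exact ih.trans ih'
    | mul _ _ ih ih' => simp only [map_mul, Con.coe_mul, ih, ih']

/-- A collection of trees is a forest on `I` if it is non-empty and each element of `I` labels
exactly one leaf of exactly one of the trees. (In particular the trees are distinct.) -/
def IsForest (s : Multiset (Tree I)) : Prop :=
  s ≠ 0 ∧ (s.bind Tree.leaves).Nodup ∧ ∀ i, i ∈ s.bind Tree.leaves

/-- Forests on `I`: sets of trees whose leaves are bijectively labelled by `I`. -/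
def Forest (I : Type) : Type := {s : Finset (Tree I) // IsForest s.val}

/-- The number of inner vertices of a collection of trees. -/
def forestVertices (s : Multiset (Tree I)) : ℕ := (s.map Tree.vertices).sum

/-- The vector space spanned by trees: the free commutative non-associative algebra on `I`. -/
abbrev TreeVec (I : Type) : Type := Tree I →₀ ℚ

/-- The grafting product `s ∨ t`, extended bilinearly. -/
def graft (I : Type) : TreeVec I →ₗ[ℚ] TreeVec I →ₗ[ℚ] TreeVec I :=
  Finsupp.linearCombination ℚ fun s : Tree I => Finsupp.lmapDomain ℚ ℚ fun t : Tree I => s * t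

theorem graft_single (s t : Tree I) :
    graft I (Finsupp.single s 1) (Finsupp.single t 1) = Finsupp.single (s * t) 1 := by
  simp [graft]

theorem graft_comm (x y : TreeVec I) : graft I x y = graft I y x := by
  have h : graft I = (graft I).flip := by
    ext s t : 4
    simp [graft, Tree.mul_comm' s t]
  exact congrArg (fun f => f x y) h

/-- The exterior product of a list of trees. -/
def wedgeTrees (l : List (Tree I)) : ExteriorAlgebra ℚ (TreeVec I) :=
  wedgeVec (l.map fun t => Finsupp.single t 1)

/-- The space `B(I)` of root-oriented forests on `I`, spanned by the products `T₁ ∧ ⋯ ∧ Tᵣ` where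
`T₁, …, Tᵣ` are the trees of a forest on `I` in some order (that is, the forest `{T₁, …, Tᵣ}` with
the corresponding orientation of its set of roots). -/
def BSpace (I : Type) : Submodule ℚ (ExteriorAlgebra ℚ (TreeVec I)) :=
  Submodule.span ℚ {x | ∃ l : List (Tree I), IsForest (l : Multiset (Tree I)) ∧ x = wedgeTrees l}

/-- The root-oriented forest `T₁ ∧ ⋯ ∧ Tᵣ`. -/
def orientedForest (l : List (Tree I)) (h : IsForest (l : Multiset (Tree I))) : BSpace I :=
  ⟨wedgeTrees l, Submodule.subset_span ⟨l, h, rfl⟩⟩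

/-- A planar tree with labels in `I ⊔ {⋆}`, seen as a tree with labels in `I ⊔ J` if it has no leaf
`⋆`, and replaced by `0` otherwise. -/
def planarForget (I J : Type) : FreeMagma (Option I) → TreeVec (I ⊕ J)
  | .of none => 0
  | .of (some i) => Finsupp.single (Tree.leaf (.inl i)) 1
  | .mul a b => graft (I ⊕ J) (planarForget I J a) (planarForget I J b)

/-- For a tree `T` with exactly one leaf `⋆`, the operator `T ∘_⋆ -` given by the distributive law
`ω(S, x ∧ y) = ω(S, x) ∧ y + x ∧ ω(S, y)`, i.e. `e_{j,⋆} ∘ ω_{i,k} - e_{k,⋆} ∘ ω_{i,j}` for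
`ω_{i,⋆} ∘ e_{j,k}`: insertion at `⋆` and then, at each vertex on the path from `⋆` to the root,
the derivation of the exterior product extending the grafting with the other subtree. -/
def planarInsert (I J : Type) : FreeMagma (Option I) →
    (ExteriorAlgebra ℚ (TreeVec (I ⊕ J)) →ₗ[ℚ] ExteriorAlgebra ℚ (TreeVec (I ⊕ J)))
  | .of none => LinearMap.id
  | .of (some _) => 0
  | .mul a b => derivation (graft (I ⊕ J) (planarForget I J b)) ∘ₗ planarInsert I J a
      + derivation (graft (I ⊕ J) (planarForget I J a)) ∘ₗ planarInsert I J b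

theorem planar_congr (I J : Type) {a b : FreeMagma (Option I)} (h : TreeCon (Option I) a b) :
    planarForget I J a = planarForget I J b ∧ planarInsert I J a = planarInsert I J b := by
  induction h with
  | of s t h =>
    obtain ⟨a, b, rfl, rfl⟩ := h
    exact ⟨graft_comm _ _, add_comm _ _⟩
  | refl => exact ⟨rfl, rfl⟩
  | symm _ ih => exact ⟨ih.1.symm, ih.2.symm⟩
  | trans _ _ ih ih' => exact ⟨ih.1.trans ih'.1, ih.2.trans ih'.2⟩
  | @mul w x y z _ _ ih ih' =>
    constructor
    · change graft (I ⊕ J) (planarForget I J w) (planarForget I J y)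
        = graft (I ⊕ J) (planarForget I J x) (planarForget I J z)
      rw [ih.1, ih'.1]
    · change derivation (graft (I ⊕ J) (planarForget I J y)) ∘ₗ planarInsert I J w
        + derivation (graft (I ⊕ J) (planarForget I J w)) ∘ₗ planarInsert I J y
        = derivation (graft (I ⊕ J) (planarForget I J z)) ∘ₗ planarInsert I J x
        + derivation (graft (I ⊕ J) (planarForget I J x)) ∘ₗ planarInsert I J z
      rw [ih.1, ih'.1, ih.2, ih'.2]

/-- See `planarForget`. -/
def treeForget (I J : Type) (t : Tree (Option I)) : TreeVec (I ⊕ J) :=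
  Con.liftOn t (planarForget I J) fun _ _ h => (planar_congr I J h).1

/-- See `planarInsert`. -/
def treeInsert (I J : Type) (t : Tree (Option I)) :
    ExteriorAlgebra ℚ (TreeVec (I ⊕ J)) →ₗ[ℚ] ExteriorAlgebra ℚ (TreeVec (I ⊕ J)) :=
  Con.liftOn t (planarInsert I J) fun _ _ h => (planar_congr I J h).2

/-- Linear extension of `treeForget`. -/
def forgetB (I J : Type) : TreeVec (Option I) →ₗ[ℚ] TreeVec (I ⊕ J) :=
  Finsupp.linearCombination ℚ (treeForget I J)

/-- `(y, T) ↦ T ∘_⋆ y`, by linear extension of `treeInsert`. -/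
def insertB (I J : Type) : ExteriorAlgebra ℚ (TreeVec J) →ₗ[ℚ] TreeVec (Option I) →ₗ[ℚ]
    ExteriorAlgebra ℚ (TreeVec (I ⊕ J)) :=
  (Finsupp.linearCombination ℚ (treeInsert I J)).flip ∘ₗ
    (ExteriorAlgebra.map (Finsupp.lmapDomain ℚ ℚ (Tree.map Sum.inr))).toLinearMap

/-! Stability of the spaces of root-oriented forests. -/

theorem planarLeaves_ne_zero (a : FreeMagma I) : planarLeaves a ≠ 0 := by
  induction a with
  | ih1 i => simp [planarLeaves]
  | ih2 a b ha hb => simp [planarLeaves, ha]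

theorem Tree.leaves_ne_zero (t : Tree I) : t.leaves ≠ 0 := by
  induction t using Con.induction_on with
  | H a => exact planarLeaves_ne_zero a

theorem Tree.leaves_mul (s t : Tree I) : (s * t).leaves = s.leaves + t.leaves := by
  induction s, t using Con.induction_on₂ with
  | H a b => rfl

theorem planarLeaves_map (f : I → J) (a : FreeMagma I) :
    planarLeaves (FreeMagma.map f a) = (planarLeaves a).map f := by
  induction a with
  | ih1 i => simp [planarLeaves, FreeMagma.map_of]
  | ih2 a b ha hb =>
    change planarLeaves (FreeMagma.map f a) + planarLeaves (FreeMagma.map f b)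
      = (planarLeaves a + planarLeaves b).map f
    rw [ha, hb, Multiset.map_add]

theorem Tree.leaves_map (f : I → J) (t : Tree I) : (t.map f).leaves = t.leaves.map f := by
  induction t using Con.induction_on with
  | H a => exact planarLeaves_map f a

theorem isForest_iff [Nonempty I] (s : Multiset (Tree I)) :
    IsForest s ↔ (s.bind Tree.leaves).Nodup ∧ ∀ i, i ∈ s.bind Tree.leaves := by
  refine ⟨fun h => h.2, fun h => ⟨?_, h⟩⟩
  rintro rfl
  simpa using h.2 (Classical.arbitrary I)

theorem IsForest.nonempty {s : Multiset (Tree I)} (h : IsForest s) : Nonempty I := by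
  obtain ⟨t, ht⟩ := Multiset.exists_mem_of_ne_zero h.1
  obtain ⟨i, -⟩ := Multiset.exists_mem_of_ne_zero t.leaves_ne_zero
  exact ⟨i⟩

theorem map_wedgeTrees (f : Tree I → Tree J) (l : List (Tree I)) :
    ExteriorAlgebra.map (Finsupp.lmapDomain ℚ ℚ f) (wedgeTrees l) = wedgeTrees (l.map f) := by
  simp [wedgeTrees, wedgeVec, map_list_prod, Function.comp_def]

theorem bind_map_leaves (f : I → J) (l : List (Tree I)) :
    ((l.map (Tree.map f) : List (Tree J)) : Multiset (Tree J)).bind Tree.leaves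
      = ((l : Multiset (Tree I)).bind Tree.leaves).map f := by
  rw [← Multiset.map_coe, Multiset.bind_map, Multiset.map_bind]
  simp only [Tree.leaves_map]

/-- Relabelling in `B`. -/
def bMap (e : I ≃ J) : BSpace I →ₗ[ℚ] BSpace J :=
  (ExteriorAlgebra.map (Finsupp.lmapDomain ℚ ℚ (Tree.map e))).toLinearMap.restrict fun x hx => by
    rw [BSpace] at hx
    induction hx using Submodule.span_induction with
    | mem x hx =>
      obtain ⟨l, hl, rfl⟩ := hx
      have := hl.nonempty
      have : Nonempty J := this.map e
      refine Submodule.subset_span ⟨l.map (Tree.map e), ?_, map_wedgeTrees _ l⟩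
      rw [isForest_iff, bind_map_leaves]
      refine ⟨hl.2.1.map e.injective, fun j => ?_⟩
      exact Multiset.mem_map.2 ⟨e.symm j, hl.2.2 _, e.apply_symm_apply j⟩
    | zero => simp
    | add x y _ _ hx hy => simpa using Submodule.add_mem _ hx hy
    | smul c x _ hx => simpa using Submodule.smul_mem _ c hx

/-- The span of the exterior products of trees with given multiset of leaves. -/
def leafSpan (L : Multiset I) : Submodule ℚ (ExteriorAlgebra ℚ (TreeVec I)) :=
  Submodule.span ℚ {x | ∃ l : List (Tree I),
    (l : Multiset (Tree I)).bind Tree.leaves = L ∧ x = wedgeTrees l}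

theorem derivation_mem (t : Tree I) (L : Multiset I) (x : ExteriorAlgebra ℚ (TreeVec I))
    (hx : x ∈ leafSpan L) :
    derivation (graft I (Finsupp.single t 1)) x ∈ leafSpan (L + t.leaves) := by
  rw [leafSpan] at hx
  induction hx using Submodule.span_induction with
  | mem x hx =>
    obtain ⟨l, rfl, rfl⟩ := hx
    refine expand_wedgeVec _ _ _ _ fun l₁ m l₂ h => ?_
    obtain ⟨k₁, k, rfl, rfl, hk⟩ := List.map_eq_append_iff.1 h
    obtain ⟨s, k₂, rfl, rfl, rfl⟩ := List.map_eq_cons_iff.1 hk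
    refine Submodule.subset_span ⟨k₁ ++ k₂ ++ [t * s], ?_, ?_⟩
    · simp only [← Multiset.coe_add, Multiset.add_bind, ← Multiset.cons_coe, Multiset.cons_bind,
        Multiset.coe_nil, Multiset.zero_bind, Tree.leaves_mul]
      abel
    · simp [wedgeTrees, wedgeVec, graft_single, mul_assoc]
  | zero => simp
  | add x y _ _ hx hy => simpa using Submodule.add_mem _ hx hy
  | smul c x _ hx => simpa using Submodule.smul_mem _ c hx

/-- The number of `⋆` in a multiset. -/
def stars (X : Multiset (Option I)) : ℕ := X.countP fun o => o.isNone = true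

/-- The other elements. -/
def body (X : Multiset (Option I)) : Multiset I := X.filterMap id

theorem stars_sum (X Y : Multiset (Option I)) : stars (X + Y) = stars X + stars Y :=
  Multiset.countP_add _ _ _

theorem body_sum (X Y : Multiset (Option I)) : body (X + Y) = body X + body Y :=
  Multiset.filterMap_add _ _ _

theorem planar_mem (J : Type) (a : FreeMagma (Option I)) :
    (stars (planarLeaves a) = 0 → planarInsert I J a = 0 ∧ ∃ t : Tree (I ⊕ J),
      planarForget I J a = Finsupp.single t 1 ∧ t.leaves = (body (planarLeaves a)).map Sum.inl) ∧
    (stars (planarLeaves a) = 1 → ∀ L x, x ∈ leafSpan L →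
      planarInsert I J a x ∈ leafSpan (L + (body (planarLeaves a)).map Sum.inl)) := by
  induction a with
  | ih1 o =>
    cases o with
    | none =>
      refine ⟨fun h => absurd h (by exact one_ne_zero), fun _ L x hx => ?_⟩
      have h : (body (planarLeaves (FreeMagma.of (none : Option I)))).map
          (Sum.inl : I → I ⊕ J) = 0 := rfl
      rw [h, add_zero]
      exact hx
    | some i =>
      exact ⟨fun _ => ⟨rfl, Tree.leaf (.inl i), rfl, rfl⟩,
        fun h => absurd h (by exact zero_ne_one)⟩
  | ih2 a b ha hb =>
    have hl : planarLeaves (a * b) = planarLeaves a + planarLeaves b := rfl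
    have hF : planarForget I J (a * b)
      = graft (I ⊕ J) (planarForget I J a) (planarForget I J b) := rfl
    have hI : planarInsert I J (a * b)
      = derivation (graft (I ⊕ J) (planarForget I J b)) ∘ₗ planarInsert I J a
        + derivation (graft (I ⊕ J) (planarForget I J a)) ∘ₗ planarInsert I J b := rfl
    rw [hl, stars_sum, body_sum, hF, hI, Multiset.map_add]
    constructor
    · intro h
      obtain ⟨ha₁, s, hs, hs'⟩ := ha.1 (by omega)
      obtain ⟨hb₁, t, ht, ht'⟩ := hb.1 (by omega)
      refine ⟨by simp [ha₁, hb₁], s * t, by rw [hs, ht, graft_single], ?_⟩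
      rw [Tree.leaves_mul, hs', ht']
    · intro h L x hx
      rcases (by omega : stars (planarLeaves a) = 0 ∧ stars (planarLeaves b) = 1 ∨
        stars (planarLeaves a) = 1 ∧ stars (planarLeaves b) = 0) with ⟨h₁, h₂⟩ | ⟨h₁, h₂⟩
      · obtain ⟨ha₁, s, hs, hs'⟩ := ha.1 h₁
        have := derivation_mem s _ _ (hb.2 h₂ L x hx)
        rw [hs', add_assoc, add_comm (Multiset.map _ _)] at this
        simpa [ha₁, hs] using this
      · obtain ⟨hb₁, s, hs, hs'⟩ := hb.1 h₂
        have := derivation_mem s _ _ (ha.2 h₁ L x hx)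
        rw [hs', add_assoc] at this
        simpa [hb₁, hs] using this

theorem tree_mem (J : Type) (t : Tree (Option I)) :
    (stars t.leaves = 0 → treeInsert I J t = 0 ∧ ∃ s : Tree (I ⊕ J),
      treeForget I J t = Finsupp.single s 1 ∧ s.leaves = (body t.leaves).map Sum.inl) ∧
    (stars t.leaves = 1 → ∀ L x, x ∈ leafSpan L →
      treeInsert I J t x ∈ leafSpan (L + (body t.leaves).map Sum.inl)) := by
  induction t using Con.induction_on with
  | H a => exact planar_mem J a

theorem forest_mem (J : Type) (l : List (Tree (Option I)))
    (h : stars ((l : Multiset (Tree (Option I))).bind Tree.leaves) = 0) :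
    ∃ k : List (Tree (I ⊕ J)), l.map (treeForget I J) = k.map (fun t => Finsupp.single t 1) ∧
      (k : Multiset (Tree (I ⊕ J))).bind Tree.leaves
        = (body ((l : Multiset (Tree (Option I))).bind Tree.leaves)).map Sum.inl := by
  induction l with
  | nil => exact ⟨[], rfl, rfl⟩
  | cons t l ih =>
    rw [← Multiset.cons_coe, Multiset.cons_bind, stars_sum] at h
    obtain ⟨k, hk, hk'⟩ := ih (by omega)
    obtain ⟨-, s, hs, hs'⟩ := (tree_mem J t).1 (by omega)
    refine ⟨s :: k, by simp [hk, hs], ?_⟩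
    rw [← Multiset.cons_coe, ← Multiset.cons_coe, Multiset.cons_bind, Multiset.cons_bind, body_sum,
      Multiset.map_add, hs', hk']

theorem bComp_mem (I J : Type) : ∀ x ∈ BSpace (Option I), ∀ y ∈ BSpace J,
    expandBilin (forgetB I J) (insertB I J) x y ∈ BSpace (I ⊕ J) := by
  intro x hx y hy
  rw [BSpace] at hx hy
  induction hx using Submodule.span_induction with
  | mem x hx =>
    obtain ⟨l, hl, rfl⟩ := hx
    induction hy using Submodule.span_induction with
    | mem y hy =>
      obtain ⟨k, hk, rfl⟩ := hy
      refine expand_wedgeVec _ _ _ _ fun m₁ m m₂ h => ?_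
      obtain ⟨l₁, l', rfl, rfl, hl'⟩ := List.map_eq_append_iff.1 h
      obtain ⟨t, l₂, rfl, rfl, rfl⟩ := List.map_eq_cons_iff.1 hl'
      have hX : ((l₁ ++ t :: l₂ : List (Tree (Option I))) : Multiset (Tree (Option I))).bind
          Tree.leaves = ((l₁ ++ l₂ : List (Tree (Option I))) : Multiset (Tree (Option I))).bind Tree.leaves
            + t.leaves := by
        simp only [← Multiset.coe_add, Multiset.add_bind, ← Multiset.cons_coe, Multiset.cons_bind]
        abel
      have hn := hl.2.1
      have hm := hl.2.2
      rw [hX] at hn hm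
      have hi : insertB I J (wedgeTrees k) (Finsupp.single t 1)
          = treeInsert I J t (wedgeTrees (k.map (Tree.map Sum.inr))) := by
        simp [insertB, map_wedgeTrees]
      rw [hi]
      have hs : stars (((l₁ ++ l₂ : List (Tree (Option I))) : Multiset (Tree (Option I))).bind Tree.leaves)
          + stars t.leaves = 1 := by
        classical
        rw [← stars_sum, stars, ← Multiset.count_eq_one_of_mem hn (hm none), Multiset.count]
        refine Multiset.countP_congr rfl fun o _ => ?_
        cases o <;> simp
      rcases (by omega : stars t.leaves = 0 ∨ stars t.leaves = 1) with h0 | h1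
      · rw [((tree_mem J t).1 h0).1]
        simp
      · obtain ⟨k', hk', hk''⟩ := forest_mem J (l₁ ++ l₂) (by omega)
        have h2 := (tree_mem J t).2 h1 _ _
          (Submodule.subset_span ⟨k.map (Tree.map Sum.inr), rfl, rfl⟩)
        have h3 : (l₁.map (fun t => Finsupp.single t (1 : ℚ)) ++
            l₂.map fun t => Finsupp.single t (1 : ℚ)).map (forgetB I J)
            = k'.map fun t => Finsupp.single t 1 := by
          rw [← hk', ← List.map_append, List.map_map]
          refine List.map_congr_left fun s _ => ?_
          simp [forgetB]
        rw [h3]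
        rw [leafSpan] at h2
        generalize treeInsert I J t (wedgeTrees (k.map (Tree.map Sum.inr))) = z at h2
        induction h2 using Submodule.span_induction with
        | mem z hz =>
          obtain ⟨u, hu, rfl⟩ := hz
          refine Submodule.subset_span ⟨k' ++ u, ?_, by simp [wedgeTrees, wedgeVec_append]⟩
          have := hk.nonempty
          rw [isForest_iff, ← Multiset.coe_add, Multiset.add_bind, hu, hk'', bind_map_leaves]
          have e : ∀ X Y Z : Multiset (I ⊕ J), X + (Y + Z) = (X + Z) + Y := by
            intro X Y Z
            abel
          rw [e, ← Multiset.map_add, ← body_sum]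
          constructor
          · rw [Multiset.nodup_add]
            refine ⟨Multiset.Nodup.map Sum.inl_injective ?_, hk.2.1.map Sum.inr_injective, ?_⟩
            · refine Multiset.Nodup.filterMap id ?_ hn
              intro a b c ha hb
              simp_all
            · rw [Multiset.disjoint_left]
              intro v hv hv'
              obtain ⟨i, -, rfl⟩ := Multiset.mem_map.1 hv
              obtain ⟨j, -, hj⟩ := Multiset.mem_map.1 hv'
              cases hj
          · rintro (i | j)
            · refine Multiset.mem_add.2 (.inl (Multiset.mem_map_of_mem _ ?_))
              exact (Multiset.mem_filterMap _ _).2 ⟨some i, hm _, rfl⟩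
            · exact Multiset.mem_add.2 (.inr (Multiset.mem_map_of_mem _ (hk.2.2 j)))
        | zero => simp
        | add x y _ _ hx hy => simpa [mul_add] using Submodule.add_mem _ hx hy
        | smul c x _ hx => simpa using Submodule.smul_mem _ c hx
    | zero => simp
    | add x y _ _ hx hy => simpa using Submodule.add_mem _ hx hy
    | smul c x _ hx => simpa using Submodule.smul_mem _ c hx
  | zero => simp
  | add x y _ _ hx hy => simpa using Submodule.add_mem _ hx hy
  | smul c x _ hx => simpa using Submodule.smul_mem _ c hx

/-- The composition of `B`: if `T` is the tree containing `⋆`, then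
`(T₁ ∧ ⋯ ∧ Tᵣ ∧ T) ∘_⋆ y = T₁ ∧ ⋯ ∧ Tᵣ ∧ (T ∘_⋆ y)`, with `T ∘_⋆ y` given by the distributive law
(see `planarInsert`). -/
def bComp (I J : Type) : BSpace (Option I) →ₗ[ℚ] BSpace J →ₗ[ℚ] BSpace (I ⊕ J) :=
  restrictBilin (expandBilin (forgetB I J) (insertB I J)) _ _ _ (bComp_mem I J)

/-- The operad `B` defined on `Det ∘ Gri` by the distributive law. A root-oriented forest has degree
the number of its roots minus one. -/
def B : OperadData.{0} where
  obj I _ := BSpace I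
  deg I _ n := Submodule.span ℚ {x | ∃ (l : List (Tree I)) (h : IsForest (l : Multiset (Tree I))),
    (l.length : ℤ) - 1 = n ∧ x = orientedForest l h}
  map e := bMap e
  comp {I J} _ _ := bComp I J
  one := orientedForest [Tree.leaf PUnit.unit] (by
    simp [IsForest, Tree.leaves, Tree.leaf, planarLeaves])

/-- The operator `x ↦ (-1)^(deg x) x` of `B(I)` (the involution of the exterior algebra is
`(-1)^r` on products of `r` trees, which have degree `r - 1`). -/
def bSign (I : Type) : BSpace I →ₗ[ℚ] BSpace I :=
  (-(CliffordAlgebra.involute (Q := (0 : QuadraticForm ℚ (TreeVec I)))).toLinearMap).restrict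
    fun x hx => by
      rw [BSpace] at hx
      induction hx using Submodule.span_induction with
      | mem x hx =>
        obtain ⟨l, hl, rfl⟩ := hx
        have h : CliffordAlgebra.involute (Q := (0 : QuadraticForm ℚ (TreeVec I))) (wedgeTrees l)
            = (-1 : ℚ) ^ (l.map fun t => Finsupp.single t (1 : ℚ)).length • wedgeTrees l :=
          CliffordAlgebra.involute_prod_map_ι _
        simp only [LinearMap.neg_apply, AlgHom.toLinearMap_apply]
        rw [h]
        exact Submodule.neg_mem _ (Submodule.smul_mem _ _ (Submodule.subset_span ⟨l, hl, rfl⟩))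
      | zero => simp
      | add x y _ _ hx hy => rw [map_add]; exact Submodule.add_mem _ hx hy
      | smul c x _ hx => rw [map_smul]; exact Submodule.smul_mem _ c hx

end Trees

/-! ### The Bessel operad -/

section Bess

/-- The operad `Bess = Det ⊗ B`. Its composition is
`(o ⊗ x) ∘ (o' ⊗ y) = (-1)^(deg x * deg o') (o ∘ o') ⊗ (x ∘ y)`, where `deg o' = |J| - 1` for
`o' ∈ Det(J)`. The degree is modified, without changing its parity: it is the number of inner
vertices of the forest. -/
def Bess : OperadData.{0} where
  obj I _ := Det.obj I ⊗[ℚ] B.obj I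
  deg I _ n := Submodule.span ℚ {x | ∃ (o : Det.obj I) (l : List (Tree I))
    (h : IsForest (l : Multiset (Tree I))),
    (forestVertices (l : Multiset (Tree I)) : ℤ) = n ∧ x = o ⊗ₜ[ℚ] orientedForest l h}
  map e := TensorProduct.map (Det.map e) (B.map e)
  comp {I J} _ _ := TensorProduct.map₂ Det.comp (B.comp ∘ₗ (bSign (Option I) ^ (Nat.card J + 1)))
  one := Det.one ⊗ₜ[ℚ] B.one

theorem isForest_bE :
    IsForest (([Tree.leaf 0, Tree.leaf 1] : List (Tree (Fin 2))) : Multiset (Tree (Fin 2))) := by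
  have h : (([Tree.leaf 0, Tree.leaf 1] : List (Tree (Fin 2))) : Multiset (Tree (Fin 2))).bind
      Tree.leaves = {0, 1} := by decide
  rw [isForest_iff, h]
  decide

theorem isForest_bOm :
    IsForest (([Tree.leaf 0 * Tree.leaf 1] : List (Tree (Fin 2))) : Multiset (Tree (Fin 2))) := by
  have h : (([Tree.leaf 0 * Tree.leaf 1] : List (Tree (Fin 2))) : Multiset (Tree (Fin 2))).bind
      Tree.leaves = {0, 1} := by decide
  rw [isForest_iff, h]
  decide

/-- The generator `e_{0,1} = 0 ∧ 1` of `B` (the forest of two trees without inner vertex). -/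
def bE : B.obj (Fin 2) := orientedForest [Tree.leaf 0, Tree.leaf 1] isForest_bE

/-- The generator `ω_{0,1}` of `B` (the tree with one inner vertex). -/
def bOm : B.obj (Fin 2) := orientedForest [Tree.leaf 0 * Tree.leaf 1] isForest_bOm

/-- `E_{i,j} = (j ∧ i) ⊗ e_{i,j}` and `Ω_{i,j} = (i ∧ j) ⊗ ω_{i,j}`, for `(i, j) = (0, 1)`. -/
def bessGen : Gen → Bess.obj (Fin 2)
  | .E => orient [1, 0] (by simp) ⊗ₜ[ℚ] bE
  | .Om => orient [0, 1] (by simp) ⊗ₜ[ℚ] bOm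

/-- The outer-oriented forests `o₁ ⊗ o₂ ⊗ F` with underlying forest `F`: here `o₁` is given by an
enumeration `k` of `I`, and `o₂` by an enumeration `l` of the trees (or roots) of `F`. -/
def IsOuterOriented {I : Type} [Finite I] (F : Forest I) (x : Bess.obj I) : Prop :=
  ∃ (k : List I) (hk : k.length = Nat.card I) (l : List (Tree I))
    (hl : IsForest (l : Multiset (Tree I))),
    k.Nodup ∧ (l : Multiset (Tree I)) = F.1.val ∧ x = orient k hk ⊗ₜ[ℚ] orientedForest l hl

end Bess

end Bessel

end

noncomputable section

namespace Bessel

/-! ### Calculus of `expand` -/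

section ExpandCalculus

variable {M M' M'' : Type*} [AddCommGroup M] [Module ℚ M] [AddCommGroup M'] [Module ℚ M']
  [AddCommGroup M''] [Module ℚ M'']

/-! Partial composition is an infinitesimal substitution. Take a linear map `F` on trees which
preserves grafting, and a map `φ` from trees to an exterior algebra which is a derivation along `F`
(`IsSubst`). Then `expand F φ` replaces one factor of an exterior product by its value under `φ` and
all others by their values under `F`, and sums over the choice of that factor. Composition at `⋆` is
the case where `F` kills the trees containing `⋆` and `φ` performs the insertion. Trees are
generated by leaves, so such a pair is determined by its values on leaves (`IsSubst.ext`), and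
naturality and associativity become comparisons on leaves.

For nested compositions the second `⋆` lies in what the first one inserted, so the two expansions
compose to a single one (`expand_expand_of_eq_zero`). For parallel compositions there is an extra
term whenever the two `⋆` lie on different sides of a vertex: a factor of one inserted product is
grafted with a factor of the other. This term is `pairing`. As grafting is commutative, it is
symmetric up to exactly the Koszul sign (`pairing_symm`), and `expand_expand_parallel` follows.
`Det` embeds into the exterior algebra on trees through one-leaf trees (`leafLift`) and inherits its
laws from there. For `Det ⊗ B` it remains to collect the signs (`bess_parallel_tmul`).

For the presentation, the relations say that, up to signs, `E` is commutative and associative, and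
`Ω` is commutative and a derivation of `E`. Moving `Ω` inside `E` shows that the span of the
`E`-products of `Ω`-trees is stable under composition, so in the presented operad it is everything
(`presented_normal`). Such a product depends only on its forest, up to sign (`IsC.unique`,
`IsC.perm`). Hence one element for each forest spans the presented operad (`span_forestElement`).
Its image in `Bess` is a nonzero oriented forest with the same underlying forest
(`exists_toBess_eq`), and oriented forests form a basis because `Det(I)` is a line and exterior
products of distinct trees are independent (`exists_basis_bess`). A spanning family is thus sent to
a basis, so the morphism is bijective. Independence of the normal forms is read off in `Bess`, which
is why signs may be ignored on the presented side (`PM`). -/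

/-- The grading involution of the exterior algebra. -/
abbrev inv : ExteriorAlgebra ℚ M →ₐ[ℚ] ExteriorAlgebra ℚ M :=
  CliffordAlgebra.involute (Q := (0 : QuadraticForm ℚ M))

theorem inv_ι (m : M) : inv (ExteriorAlgebra.ι ℚ m) = -ExteriorAlgebra.ι ℚ m :=
  CliffordAlgebra.involute_ι m

theorem exterior_left_induction {P : ExteriorAlgebra ℚ M → Prop} (one : P 1)
    (smul : ∀ (c : ℚ) x, P x → P (c • x)) (add : ∀ x y, P x → P y → P (x + y))
    (ι_mul : ∀ m x, P x → P (ExteriorAlgebra.ι ℚ m * x)) (x : ExteriorAlgebra ℚ M) : P x := by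
  induction x using CliffordAlgebra.left_induction with
  | algebraMap r =>
    rw [Algebra.algebraMap_eq_smul_one]
    exact smul r _ one
  | add x y hx hy => exact add x y hx hy
  | ι_mul x m hx => exact ι_mul m x hx

/-- Two linear maps out of an exterior algebra agree if they agree at `1` and satisfy the same
left recursion. -/
theorem exterior_linear_ext {N : Type*} [AddCommGroup N] [Module ℚ N]
    (f g : ExteriorAlgebra ℚ M →ₗ[ℚ] N) (one : f 1 = g 1)
    (h : ∀ m x, f x = g x → f (ExteriorAlgebra.ι ℚ m * x) = g (ExteriorAlgebra.ι ℚ m * x)) :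
    f = g := by
  refine LinearMap.ext fun x => ?_
  induction x using exterior_left_induction with
  | one => exact one
  | smul c x hx => rw [map_smul, map_smul, hx]
  | add x y hx hy => rw [map_add, map_add, hx, hy]
  | ι_mul m x hx => exact h m x hx

theorem map_inv (F : M →ₗ[ℚ] M') (x : ExteriorAlgebra ℚ M) :
    ExteriorAlgebra.map F (inv x) = inv (ExteriorAlgebra.map F x) := by
  induction x using exterior_left_induction with
  | one => simp
  | smul c x hx => simp [hx]
  | add x y hx hy => simp [hx, hy]
  | ι_mul m x hx => simp [hx]

theorem inv_inv (x : ExteriorAlgebra ℚ M) : inv (inv x) = x :=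
  CliffordAlgebra.involute_involute x

theorem ι_mul_eq (m : M) (x : ExteriorAlgebra ℚ M) :
    ExteriorAlgebra.ι ℚ m * x = inv x * ExteriorAlgebra.ι ℚ m := by
  induction x using exterior_left_induction with
  | one => simp
  | smul c x hx => simp [hx]
  | add x y hx hy => simp [hx, hy, mul_add, add_mul]
  | ι_mul n x hx =>
    have h : ExteriorAlgebra.ι ℚ m * ExteriorAlgebra.ι ℚ n
        = -(ExteriorAlgebra.ι ℚ n * ExteriorAlgebra.ι ℚ m) :=
      eq_neg_of_add_eq_zero_left (ExteriorAlgebra.ι_add_mul_swap m n)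
    rw [map_mul, inv_ι, mul_assoc, ← hx, ← mul_assoc, h]
    simp [mul_assoc]

theorem inv_of_mem {n : ℕ} {x : ExteriorAlgebra ℚ M}
    (hx : x ∈ (⋀[ℚ]^n M : Submodule ℚ (ExteriorAlgebra ℚ M))) : inv x = (-1 : ℚ) ^ n • x := by
  rw [exteriorPower_eq_span] at hx
  induction hx using Submodule.span_induction with
  | mem x hx =>
    obtain ⟨l, rfl, rfl⟩ := hx
    exact CliffordAlgebra.involute_prod_map_ι _
  | zero => simp
  | add x y _ _ hx hy => rw [map_add, hx, hy, smul_add]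
  | smul c x _ hx => rw [map_smul, hx, smul_comm]

theorem ι_mem (m : M) :
    ExteriorAlgebra.ι ℚ m ∈ (⋀[ℚ]^1 M : Submodule ℚ (ExteriorAlgebra ℚ M)) := by
  simpa only [wedgeVec, List.map_cons, List.map_nil, List.prod_singleton]
    using wedgeVec_mem [m] (n := 1) rfl

theorem mul_mem_exteriorPower {r s : ℕ} {x y : ExteriorAlgebra ℚ M}
    (hx : x ∈ (⋀[ℚ]^r M : Submodule ℚ (ExteriorAlgebra ℚ M)))
    (hy : y ∈ (⋀[ℚ]^s M : Submodule ℚ (ExteriorAlgebra ℚ M))) :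
    x * y ∈ (⋀[ℚ]^(r + s) M : Submodule ℚ (ExteriorAlgebra ℚ M)) := by
  change _ ∈ LinearMap.range (ExteriorAlgebra.ι ℚ) ^ (r + s)
  rw [pow_add]
  exact Submodule.mul_mem_mul hx hy

theorem mul_comm_of_mem {r s : ℕ} {x y : ExteriorAlgebra ℚ M}
    (hx : x ∈ (⋀[ℚ]^r M : Submodule ℚ (ExteriorAlgebra ℚ M)))
    (hy : y ∈ (⋀[ℚ]^s M : Submodule ℚ (ExteriorAlgebra ℚ M))) :
    x * y = (-1 : ℚ) ^ (r * s) • (y * x) := by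
  rw [exteriorPower_eq_span] at hx
  induction hx using Submodule.span_induction with
  | mem x hx =>
    obtain ⟨l, rfl, rfl⟩ := hx
    induction l with
    | nil => simp [wedgeVec]
    | cons m l ih =>
      have h : wedgeVec (m :: l) = ExteriorAlgebra.ι ℚ m * wedgeVec l := by simp [wedgeVec]
      rw [h, mul_assoc, ih, mul_smul_comm, ← mul_assoc, ι_mul_eq, inv_of_mem hy]
      simp only [smul_mul_assoc, smul_smul, mul_assoc, List.length_cons, ← pow_add]
      congr 2
      ring
  | zero => simp
  | add x y _ _ hx hy => rw [add_mul, hx, hy, mul_add, smul_add]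
  | smul c x _ hx => rw [smul_mul_assoc, hx, mul_smul_comm, smul_comm]

/-- The map is defined by recursion from the right. Here the leftmost vector has to cross all of `a`
to reach the right end, whence the involution. The induction peels off the last vector, on which the
definition computes. -/
theorem extract_ι_mul (m : M) (a : ExteriorAlgebra ℚ M) :
    extract M (ExteriorAlgebra.ι ℚ m * a) = inv a ⊗ₜ[ℚ] m
      + (LinearMap.mulLeft ℚ (ExteriorAlgebra.ι ℚ m)).rTensor M (extract M a) := by
  induction a using CliffordAlgebra.right_induction with
  | algebraMap r =>
    have h := extract_mul_ι (1 : ExteriorAlgebra ℚ M) m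
    rw [one_mul, extract_one] at h
    simp [Algebra.algebraMap_eq_smul_one, h, extract_one, TensorProduct.smul_tmul']
  | add x y hx hy =>
    rw [mul_add, map_add, hx, hy, map_add, map_add, map_add, TensorProduct.add_tmul]
    abel
  | mul_ι n b hb =>
    change extract M (ExteriorAlgebra.ι ℚ m * (b * ExteriorAlgebra.ι ℚ n))
      = inv (b * ExteriorAlgebra.ι ℚ n) ⊗ₜ[ℚ] m
      + (LinearMap.mulLeft ℚ (ExteriorAlgebra.ι ℚ m)).rTensor M
        (extract M (b * ExteriorAlgebra.ι ℚ n))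
    have hc : (LinearMap.mulRight ℚ (ExteriorAlgebra.ι ℚ n)).rTensor M
        ((LinearMap.mulLeft ℚ (ExteriorAlgebra.ι ℚ m)).rTensor M (extract M b))
        = (LinearMap.mulLeft ℚ (ExteriorAlgebra.ι ℚ m)).rTensor M
        ((LinearMap.mulRight ℚ (ExteriorAlgebra.ι ℚ n)).rTensor M (extract M b)) := by
      have h : LinearMap.mulRight ℚ (ExteriorAlgebra.ι ℚ n) ∘ₗ
          LinearMap.mulLeft ℚ (ExteriorAlgebra.ι ℚ m) = LinearMap.mulLeft ℚ (ExteriorAlgebra.ι ℚ m)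
            ∘ₗ LinearMap.mulRight ℚ (ExteriorAlgebra.ι ℚ n) :=
        LinearMap.ext fun x => by simp [mul_assoc]
      have h' := LinearMap.congr_fun (congrArg (LinearMap.rTensor M) h) (extract M b)
      rwa [LinearMap.rTensor_comp, LinearMap.rTensor_comp] at h'
    rw [← mul_assoc, extract_mul_ι, hb, extract_mul_ι, map_add, map_sub, hc, map_mul, inv_ι]
    simp [TensorProduct.neg_tmul]
    abel

theorem expand_one (F : M →ₗ[ℚ] M') (φ : M →ₗ[ℚ] ExteriorAlgebra ℚ M') :
    expand F φ 1 = 0 := by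
  rw [expand, LinearMap.comp_apply, extract_one, map_zero]

/-- Together with the value at `1`, this recursion characterizes `expand F φ`. Most identities below
compare two such recursions by `exterior_linear_ext`. -/
theorem expand_ι_mul (F : M →ₗ[ℚ] M') (φ : M →ₗ[ℚ] ExteriorAlgebra ℚ M') (m : M)
    (a : ExteriorAlgebra ℚ M) :
    expand F φ (ExteriorAlgebra.ι ℚ m * a) = ExteriorAlgebra.map F (inv a) * φ m
      + ExteriorAlgebra.ι ℚ (F m) * expand F φ a := by
  simp only [expand, LinearMap.comp_apply]
  rw [extract_ι_mul, map_add]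
  congr 1
  induction extract M a using TensorProduct.induction_on with
  | zero => simp
  | tmul a m => simp [mul_assoc]
  | add x y hx hy => simp only [map_add, hx, hy, mul_add]

theorem expand_ι (F : M →ₗ[ℚ] M') (φ : M →ₗ[ℚ] ExteriorAlgebra ℚ M') (m : M) :
    expand F φ (ExteriorAlgebra.ι ℚ m) = φ m := by
  have := expand_ι_mul F φ m 1
  rw [mul_one] at this
  rw [this, expand_one]
  simp

theorem expand_zero (F : M →ₗ[ℚ] M') : expand F 0 = 0 := by
  refine exterior_linear_ext _ _ (expand_one _ _) fun m x hx => ?_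
  rw [expand_ι_mul, hx]
  simp

theorem map_expand (F : M →ₗ[ℚ] M') (φ : M →ₗ[ℚ] ExteriorAlgebra ℚ M') (g : M' →ₗ[ℚ] M'')
    (x : ExteriorAlgebra ℚ M) :
    ExteriorAlgebra.map g (expand F φ x)
      = expand (g ∘ₗ F) ((ExteriorAlgebra.map g).toLinearMap ∘ₗ φ) x := by
  refine LinearMap.congr_fun (f := (ExteriorAlgebra.map g).toLinearMap ∘ₗ expand F φ)
    (exterior_linear_ext _ _ (by simp [expand_one]) fun m x hx => ?_) x
  simp only [LinearMap.comp_apply, AlgHom.toLinearMap_apply] at hx ⊢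
  rw [expand_ι_mul, expand_ι_mul, ← hx]
  simp [← ExteriorAlgebra.map_comp_map]

theorem expand_map (f : M →ₗ[ℚ] M') (F : M' →ₗ[ℚ] M'') (φ : M' →ₗ[ℚ] ExteriorAlgebra ℚ M'')
    (x : ExteriorAlgebra ℚ M) :
    expand F φ (ExteriorAlgebra.map f x) = expand (F ∘ₗ f) (φ ∘ₗ f) x := by
  refine LinearMap.congr_fun (f := expand F φ ∘ₗ (ExteriorAlgebra.map f).toLinearMap)
    (exterior_linear_ext _ _ (by simp [expand_one]) fun m x hx => ?_) x
  simp only [LinearMap.comp_apply, AlgHom.toLinearMap_apply] at hx ⊢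
  rw [map_mul, ExteriorAlgebra.map_apply_ι, expand_ι_mul, expand_ι_mul, ← hx]
  simp [← ExteriorAlgebra.map_comp_map, map_inv]

/-- A factor extracted from `b` crosses the `r` factors of `v`, and its image, of degree `s`,
crosses them back. This gives `r + r * s` transpositions. -/
theorem expand_mul_of_mem (F : M →ₗ[ℚ] M') (φ : M →ₗ[ℚ] ExteriorAlgebra ℚ M') {r s : ℕ}
    (hφ : ∀ m, φ m ∈ (⋀[ℚ]^s M' : Submodule ℚ (ExteriorAlgebra ℚ M')))
    (b v : ExteriorAlgebra ℚ M) (hv : v ∈ (⋀[ℚ]^r M : Submodule ℚ (ExteriorAlgebra ℚ M))) :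
    expand F φ (b * v) = ExteriorAlgebra.map F b * expand F φ v
      + (-1 : ℚ) ^ (r * (s + 1)) • (expand F φ b * ExteriorAlgebra.map F v) := by
  induction b using exterior_left_induction with
  | one => simp [expand_one]
  | smul c x hx =>
    rw [smul_mul_assoc, map_smul, hx, map_smul, map_smul, smul_add, smul_mul_assoc,
      smul_mul_assoc, smul_comm c]
  | add x y hx hy =>
    rw [add_mul, map_add, hx, hy, map_add, map_add, add_mul, add_mul, smul_add]
    abel
  | ι_mul m b hb =>
    rw [mul_assoc, expand_ι_mul, hb, expand_ι_mul, map_mul, map_mul, map_mul, inv_of_mem hv,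
      mul_assoc, map_smul, smul_mul_assoc,
      mul_comm_of_mem (map_mem_exteriorPower F v hv) (hφ m), smul_smul, ← pow_add,
      show r + r * s = r * (s + 1) by ring]
    generalize (-1 : ℚ) ^ (r * (s + 1)) = ε
    simp only [ExteriorAlgebra.map_apply_ι, mul_add, add_mul, mul_assoc, smul_add, mul_smul_comm]
    abel

theorem expand_mem (F : M →ₗ[ℚ] M') (φ : M →ₗ[ℚ] ExteriorAlgebra ℚ M') {r s : ℕ}
    (hφ : ∀ m, φ m ∈ (⋀[ℚ]^s M' : Submodule ℚ (ExteriorAlgebra ℚ M')))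
    (a : ExteriorAlgebra ℚ M) (ha : a ∈ (⋀[ℚ]^(r + 1) M : Submodule ℚ (ExteriorAlgebra ℚ M))) :
    expand F φ a ∈ (⋀[ℚ]^(r + s) M' : Submodule ℚ (ExteriorAlgebra ℚ M')) := by
  rw [exteriorPower_eq_span] at ha
  induction ha using Submodule.span_induction with
  | mem x hx =>
    obtain ⟨l, hl, rfl⟩ := hx
    refine expand_wedgeVec _ _ _ _ fun l₁ m l₂ h => ?_
    refine mul_mem_exteriorPower (wedgeVec_mem _ ?_) (hφ m)
    simp only [h, List.length_append, List.length_cons] at hl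
    simp only [List.length_map, List.length_append]
    omega
  | zero => simp
  | add x y _ _ hx hy => rw [map_add]; exact Submodule.add_mem _ hx hy
  | smul c x _ hx => rw [map_smul]; exact Submodule.smul_mem _ c hx

/-- One vector is replaced by an element of degree `s`, so the degree changes by `s - 1`, which has
the parity of `s + 1`. -/
theorem inv_expand (F : M →ₗ[ℚ] M') (φ : M →ₗ[ℚ] ExteriorAlgebra ℚ M') {s : ℕ}
    (hφ : ∀ m, φ m ∈ (⋀[ℚ]^s M' : Submodule ℚ (ExteriorAlgebra ℚ M')))
    (a : ExteriorAlgebra ℚ M) :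
    inv (expand F φ a) = (-1 : ℚ) ^ (s + 1) • expand F φ (inv a) := by
  induction a using exterior_left_induction with
  | one => simp [expand_one]
  | smul c x hx => rw [map_smul, map_smul, map_smul, map_smul, hx, smul_comm]
  | add x y hx hy => rw [map_add, map_add, map_add, map_add, hx, hy, smul_add]
  | ι_mul m b hb =>
    rw [expand_ι_mul, map_mul, inv_ι, neg_mul, map_neg, expand_ι_mul, map_add, map_mul, map_mul,
      hb, inv_of_mem (hφ m), ← map_inv, inv_ι]
    simp only [pow_succ, mul_smul_comm, neg_mul, smul_add, smul_neg]
    simp [add_comm]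

/-! ### Even derivations of the exterior algebra, and their commutation with expansions -/

theorem derivation_one (f : M →ₗ[ℚ] M) : derivation f 1 = 0 := expand_one _ _

theorem derivation_ι (f : M →ₗ[ℚ] M) (m : M) :
    derivation f (ExteriorAlgebra.ι ℚ m) = ExteriorAlgebra.ι ℚ (f m) := by
  rw [derivation, expand_ι]
  rfl

theorem derivation_ι_mul (f : M →ₗ[ℚ] M) (m : M) (a : ExteriorAlgebra ℚ M) :
    derivation f (ExteriorAlgebra.ι ℚ m * a) = ExteriorAlgebra.ι ℚ (f m) * a
      + ExteriorAlgebra.ι ℚ m * derivation f a := by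
  rw [derivation, expand_ι_mul, ι_mul_eq (f m)]
  simp

theorem derivation_mul (f : M →ₗ[ℚ] M) (a b : ExteriorAlgebra ℚ M) :
    derivation f (a * b) = derivation f a * b + a * derivation f b := by
  induction a using exterior_left_induction with
  | one => simp [derivation_one]
  | smul c x hx => rw [smul_mul_assoc, map_smul, map_smul, hx, smul_add, smul_mul_assoc,
      smul_mul_assoc]
  | add x y hx hy => rw [add_mul, map_add, map_add, hx, hy, add_mul, add_mul]; abel
  | ι_mul m x hx =>
    rw [mul_assoc, derivation_ι_mul, hx, derivation_ι_mul]
    simp only [mul_add, add_mul, mul_assoc, add_assoc]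

theorem derivation_mem_exteriorPower (f : M →ₗ[ℚ] M) {n : ℕ} (a : ExteriorAlgebra ℚ M)
    (ha : a ∈ (⋀[ℚ]^n M : Submodule ℚ (ExteriorAlgebra ℚ M))) :
    derivation f a ∈ (⋀[ℚ]^n M : Submodule ℚ (ExteriorAlgebra ℚ M)) := by
  cases n with
  | zero =>
    have h : a ∈ (1 : Submodule ℚ (ExteriorAlgebra ℚ M)) := by simpa using ha
    obtain ⟨c, rfl⟩ := Submodule.mem_one.1 h
    rw [Algebra.algebraMap_eq_smul_one, map_smul, derivation_one, smul_zero]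
    exact Submodule.zero_mem _
  | succ n => exact expand_mem (r := n) (s := 1) _ _ (fun m => ι_mem (f m)) a ha

theorem inv_derivation (f : M →ₗ[ℚ] M) (a : ExteriorAlgebra ℚ M) :
    inv (derivation f a) = derivation f (inv a) := by
  rw [derivation, inv_expand (s := 1) _ _ fun m => ι_mem (f m)]
  simp

theorem derivation_add (f g : M →ₗ[ℚ] M) :
    derivation (f + g) = derivation f + derivation g := by
  refine LinearMap.ext fun x => ?_
  have h := (expand_right LinearMap.id (ExteriorAlgebra.ι ℚ ∘ₗ f) (ExteriorAlgebra.ι ℚ ∘ₗ g) 0 x).1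
  rw [← LinearMap.comp_add] at h
  exact h

theorem derivation_smul (c : ℚ) (f : M →ₗ[ℚ] M) : derivation (c • f) = c • derivation f := by
  refine LinearMap.ext fun x => ?_
  have h := (expand_right LinearMap.id (ExteriorAlgebra.ι ℚ ∘ₗ f) 0 c x).2
  rw [← LinearMap.comp_smul] at h
  exact h

theorem map_derivation (F : M →ₗ[ℚ] M') (f : M →ₗ[ℚ] M) (g : M' →ₗ[ℚ] M')
    (h : F ∘ₗ f = g ∘ₗ F) (x : ExteriorAlgebra ℚ M) :
    ExteriorAlgebra.map F (derivation f x) = derivation g (ExteriorAlgebra.map F x) := by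
  rw [derivation, derivation, map_expand, expand_map]
  congr 2
  refine LinearMap.ext fun m => ?_
  simpa using congrArg (ExteriorAlgebra.ι ℚ) (LinearMap.congr_fun h m)

/-- Here `ψ` measures the failure of `φ` to intertwine the two derivations. When `f` and `φ` act on
different factors the operations commute, so only the terms where they meet contribute `ψ`. -/
theorem expand_derivation (F : M →ₗ[ℚ] M') (φ ψ : M →ₗ[ℚ] ExteriorAlgebra ℚ M')
    (f : M →ₗ[ℚ] M) (g : M' →ₗ[ℚ] M') (h : F ∘ₗ f = g ∘ₗ F)
    (hφ : φ ∘ₗ f = derivation g ∘ₗ φ + ψ) (u : ExteriorAlgebra ℚ M) :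
    expand F φ (derivation f u) = derivation g (expand F φ u) + expand F ψ u := by
  induction u using exterior_left_induction with
  | one => simp [expand_one, derivation_one]
  | smul c x hx => rw [map_smul, map_smul, map_smul, map_smul, map_smul, hx, smul_add]
  | add x y hx hy => rw [map_add, map_add, map_add, map_add, map_add, hx, hy]; abel
  | ι_mul m b hb =>
    have h₁ : F (f m) = g (F m) := LinearMap.congr_fun h m
    have h₂ : φ (f m) = derivation g (φ m) + ψ m := LinearMap.congr_fun hφ m
    rw [derivation_ι_mul, map_add, expand_ι_mul, expand_ι_mul, expand_ι_mul, expand_ι_mul, map_add,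
      derivation_mul, derivation_ι_mul, hb, inv_derivation, map_derivation F f g h, h₁, h₂]
    simp only [mul_add]
    abel

/-- `∑ ± x̂ᵢ ∧ ŷⱼ ∧ β(xᵢ, yⱼ)`, for a bilinear map `β`. -/
def pairing (β : M →ₗ[ℚ] M →ₗ[ℚ] M) (v : ExteriorAlgebra ℚ M) :
    ExteriorAlgebra ℚ M →ₗ[ℚ] ExteriorAlgebra ℚ M :=
  expand LinearMap.id
    { toFun := fun m => derivation (β m) v
      map_add' := fun m n => by rw [map_add, derivation_add]; rfl
      map_smul' := fun c m => by rw [map_smul, derivation_smul]; rfl }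

theorem pairing_ι_mul (β : M →ₗ[ℚ] M →ₗ[ℚ] M) (v u : ExteriorAlgebra ℚ M) (m : M) :
    pairing β v (ExteriorAlgebra.ι ℚ m * u) = inv u * derivation (β m) v
      + ExteriorAlgebra.ι ℚ m * pairing β v u := by
  rw [pairing, expand_ι_mul]
  simp

theorem pairing_right (β : M →ₗ[ℚ] M →ₗ[ℚ] M) (v v' : ExteriorAlgebra ℚ M) (c : ℚ)
    (x : ExteriorAlgebra ℚ M) :
    pairing β (v + v') x = pairing β v x + pairing β v' x
      ∧ pairing β (c • v) x = c • pairing β v x := by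
  constructor
  · rw [pairing, pairing, pairing, ← (expand_right _ _ _ 0 x).1]
    congr 2
    exact LinearMap.ext fun m => map_add (derivation (β m)) v v'
  · rw [pairing, pairing, ← (expand_right _ _ 0 c x).2]
    congr 2
    exact LinearMap.ext fun m => map_smul (derivation (β m)) c v

/-- This is a recursion in the argument which enters through the derivations, whereas
`pairing_ι_mul` is the recursion in the expanded one. The symmetry of `pairing` is the comparison of
the two. -/
theorem pairing_flip_ι_mul (β : M →ₗ[ℚ] M →ₗ[ℚ] M) (hβ : ∀ m n, β m n = β n m) {s : ℕ}
    (v u : ExteriorAlgebra ℚ M) (m : M)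
    (hv : v ∈ (⋀[ℚ]^s M : Submodule ℚ (ExteriorAlgebra ℚ M))) :
    pairing β (ExteriorAlgebra.ι ℚ m * u) v = derivation (β m) v * u
      - (-1 : ℚ) ^ s • (ExteriorAlgebra.ι ℚ m * pairing β u v) := by
  -- With the involution in place of the sign, no homogeneity is needed and induction on `v` is
  -- possible.
  have key : ∀ v : ExteriorAlgebra ℚ M, pairing β (ExteriorAlgebra.ι ℚ m * u) v
      = derivation (β m) v * u - ExteriorAlgebra.ι ℚ m * pairing β u (inv v) := by
    intro v
    induction v using exterior_left_induction with
    | one => simp [pairing, expand_one, derivation_one]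
    | smul c x hx =>
      rw [map_smul, hx, map_smul, map_smul, map_smul, smul_sub, smul_mul_assoc, mul_smul_comm]
    | add x y hx hy => rw [map_add, hx, hy, map_add, map_add, map_add, add_mul, mul_add]; abel
    | ι_mul n b hb =>
      rw [pairing_ι_mul, hb, derivation_ι_mul, derivation_ι_mul, map_mul, inv_ι, neg_mul, map_neg,
        pairing_ι_mul, inv_inv, hβ n m]
      have h₁ : inv b * (ExteriorAlgebra.ι ℚ (β m n) * u) = ExteriorAlgebra.ι ℚ (β m n) * b * u := by
        rw [← mul_assoc, ← ι_mul_eq]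
      have h₂ : inv b * (ExteriorAlgebra.ι ℚ m * derivation (β n) u)
          = ExteriorAlgebra.ι ℚ m * (b * derivation (β n) u) := by
        rw [← mul_assoc, ← ι_mul_eq, mul_assoc]
      have h₃ : ExteriorAlgebra.ι ℚ n * (ExteriorAlgebra.ι ℚ m * pairing β u (inv b))
          = -(ExteriorAlgebra.ι ℚ m * (ExteriorAlgebra.ι ℚ n * pairing β u (inv b))) := by
        rw [← mul_assoc, ← mul_assoc, ← neg_mul]
        congr 1
        exact eq_neg_of_add_eq_zero_left (ExteriorAlgebra.ι_add_mul_swap n m)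
      simp only [mul_add, mul_sub, add_mul, h₁, h₂, h₃, mul_neg, mul_assoc]
      abel
  rw [key v, inv_of_mem hv, map_smul, mul_smul_comm]

/-- With the factor `β xᵢ yⱼ` moved to the right end, the two sums differ by the exchange of the
remaining blocks of `r - 1` and `s - 1` factors. The exponent uses `r + 1` and `s + 1`, of the same
parity, to avoid truncated subtraction. -/
theorem pairing_symm (β : M →ₗ[ℚ] M →ₗ[ℚ] M) (hβ : ∀ m n, β m n = β n m) {r s : ℕ}
    (u v : ExteriorAlgebra ℚ M)
    (hu : u ∈ (⋀[ℚ]^r M : Submodule ℚ (ExteriorAlgebra ℚ M)))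
    (hv : v ∈ (⋀[ℚ]^s M : Submodule ℚ (ExteriorAlgebra ℚ M))) :
    pairing β v u = (-1 : ℚ) ^ ((r + 1) * (s + 1)) • pairing β u v := by
  rw [exteriorPower_eq_span] at hu
  induction hu using Submodule.span_induction with
  | mem x hx =>
    obtain ⟨l, rfl, rfl⟩ := hx
    induction l with
    | nil =>
      have : pairing β (wedgeVec []) v = 0 := by
        rw [pairing]
        have h : ∀ f : M →ₗ[ℚ] ExteriorAlgebra ℚ M, f = 0 → expand LinearMap.id f v = 0 := by
          rintro f rfl
          rw [expand_zero]
          rfl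
        apply h
        ext m
        exact derivation_one _
      rw [this, smul_zero]
      exact expand_one _ _
    | cons m l ih =>
      have h : wedgeVec (m :: l) = ExteriorAlgebra.ι ℚ m * wedgeVec l := by simp [wedgeVec]
      have hl : wedgeVec l ∈ (⋀[ℚ]^l.length M : Submodule ℚ (ExteriorAlgebra ℚ M)) :=
        wedgeVec_mem l rfl
      rw [h, pairing_ι_mul, pairing_flip_ι_mul β hβ _ _ _ hv, ih, inv_of_mem hl,
        mul_comm_of_mem (derivation_mem_exteriorPower (β m) v hv) hl, smul_sub, smul_smul,
        smul_smul, ← pow_add, ← pow_add, smul_mul_assoc, mul_smul_comm, sub_eq_add_neg, ← neg_smul]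
      congr 2
      · rw [List.length_cons]
        generalize l.length = n
        have e : (n + 1 + 1) * (s + 1) + s * n = n + 2 * (n * s + s + 1) := by ring
        rw [e, pow_add _ n, pow_mul]
        simp
      · rw [List.length_cons]
        generalize l.length = n
        have e : (n + 1 + 1) * (s + 1) + s + 1 = (n + 1) * (s + 1) + 2 * (s + 1) := by ring
        have e' : -(-1 : ℚ) ^ ((n + 1 + 1) * (s + 1) + s)
          = (-1 : ℚ) ^ ((n + 1 + 1) * (s + 1) + s + 1) := by rw [pow_succ _ (_ + s)]; ring
        rw [e', e, pow_add, pow_mul]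
        simp
  -- Vanishing in the other argument is homogeneity for the scalar `0`.
  | zero => rw [map_zero]; have := (pairing_right β 0 0 0 v).2; simp_all
  | add x y _ _ hx hy => rw [map_add, hx, hy, (pairing_right β x y 0 v).1, smul_add]
  | smul c x _ hx => rw [map_smul, hx, (pairing_right β x 0 c v).2, smul_comm]

end ExpandCalculus

end Bessel
end

noncomputable section

namespace Bessel

/-! ### Infinitesimal substitutions -/

section Subst

variable {X Y Z Z' W : Type}

/-- The basis vector of a tree. -/
abbrev treeVec (t : Tree X) : TreeVec X := Finsupp.single t 1

/-- The basis vector of a one-leaf tree. -/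
abbrev leafVec (i : X) : TreeVec X := treeVec (Tree.leaf i)

/-- Linear maps between free commutative magmatic algebras which preserve the product. -/
def IsMagmatic (F : TreeVec X →ₗ[ℚ] TreeVec Y) : Prop :=
  ∀ a b, F (graft X a b) = graft Y (F a) (F b)

/-- `F` preserves the grafting product, and `φ` is a derivation along `F`, with values in the
exterior algebra. -/
structure IsSubst (F : TreeVec X →ₗ[ℚ] TreeVec Y)
    (φ : TreeVec X →ₗ[ℚ] ExteriorAlgebra ℚ (TreeVec Y)) : Prop where
  hom : IsMagmatic F
  der : ∀ a b, φ (graft X a b)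
    = derivation (graft Y (F b)) (φ a) + derivation (graft Y (F a)) (φ b)

theorem Tree.induction {P : Tree X → Prop} (leaf : ∀ i, P (Tree.leaf i))
    (mul : ∀ s t, P s → P t → P (s * t)) (t : Tree X) : P t := by
  induction t using Con.induction_on with
  | H a =>
    induction a with
    | ih1 i => exact leaf i
    | ih2 a b ha hb => exact mul _ _ ha hb

theorem treeVec_mul (s t : Tree X) : treeVec (s * t) = graft X (treeVec s) (treeVec t) :=
  (graft_single s t).symm

theorem treeVec_ext {N : Type*} [AddCommGroup N] [Module ℚ N] {f g : TreeVec X →ₗ[ℚ] N}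
    (h : ∀ t, f (treeVec t) = g (treeVec t)) : f = g :=
  Finsupp.lhom_ext' fun t => LinearMap.ext_ring (h t)

theorem isMagmatic_of_tree {F : TreeVec X →ₗ[ℚ] TreeVec Y}
    (h : ∀ s t : Tree X, F (treeVec (s * t)) = graft Y (F (treeVec s)) (F (treeVec t))) :
    IsMagmatic F := by
  have : (graft X).compr₂ F = (graft Y).compl₁₂ F F := by
    refine treeVec_ext fun s => treeVec_ext fun t => ?_
    simp only [LinearMap.compr₂_apply, LinearMap.compl₁₂_apply, ← treeVec_mul]
    exact h s t
  exact fun a b => LinearMap.congr_fun₂ this a b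

theorem IsMagmatic.ext {F F' : TreeVec X →ₗ[ℚ] TreeVec Y} (h : IsMagmatic F) (h' : IsMagmatic F')
    (e : ∀ i, F (leafVec i) = F' (leafVec i)) : F = F' := by
  refine treeVec_ext fun t => ?_
  induction t using Tree.induction with
  | leaf i => exact e i
  | mul s t hs ht => rw [treeVec_mul, h, h', hs, ht]

/-- Leaves generate all trees under grafting, and both conditions compute the values on `s * t` from
those on `s` and `t`. This reduces operad laws to checks on leaves. -/
theorem IsSubst.ext {F F' : TreeVec X →ₗ[ℚ] TreeVec Y}
    {φ φ' : TreeVec X →ₗ[ℚ] ExteriorAlgebra ℚ (TreeVec Y)} (h : IsSubst F φ) (h' : IsSubst F' φ')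
    (e : ∀ i, F (leafVec i) = F' (leafVec i)) (e' : ∀ i, φ (leafVec i) = φ' (leafVec i)) :
    F = F' ∧ φ = φ' := by
  obtain rfl := h.hom.ext h'.hom e
  refine ⟨rfl, treeVec_ext fun t => ?_⟩
  induction t using Tree.induction with
  | leaf i => exact e' i
  | mul s t hs ht => rw [treeVec_mul, h.der, h'.der, hs, ht]

theorem IsSubst.expand_ext {F F' : TreeVec X →ₗ[ℚ] TreeVec Y}
    {φ φ' : TreeVec X →ₗ[ℚ] ExteriorAlgebra ℚ (TreeVec Y)} (h : IsSubst F φ) (h' : IsSubst F' φ')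
    (e : ∀ i, F (leafVec i) = F' (leafVec i)) (e' : ∀ i, φ (leafVec i) = φ' (leafVec i)) :
    expand F φ = expand F' φ' := by
  obtain ⟨rfl, rfl⟩ := h.ext h' e e'
  rfl

theorem IsMagmatic.comp {F : TreeVec X →ₗ[ℚ] TreeVec Y} {G : TreeVec Y →ₗ[ℚ] TreeVec Z}
    (hG : IsMagmatic G) (hF : IsMagmatic F) : IsMagmatic (G ∘ₗ F) := fun a b => by
  simp only [LinearMap.comp_apply, hF a b]
  exact hG _ _

theorem IsSubst.precomp {f : TreeVec X →ₗ[ℚ] TreeVec Y} {F : TreeVec Y →ₗ[ℚ] TreeVec Z}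
    {φ : TreeVec Y →ₗ[ℚ] ExteriorAlgebra ℚ (TreeVec Z)} (h : IsSubst F φ) (hf : IsMagmatic f) :
    IsSubst (F ∘ₗ f) (φ ∘ₗ f) :=
  ⟨h.hom.comp hf, fun a b => by simp only [LinearMap.comp_apply, hf a b, h.der]⟩

theorem IsMagmatic.comp_graft {g : TreeVec Y →ₗ[ℚ] TreeVec Z} (hg : IsMagmatic g) (a : TreeVec Y) :
    g ∘ₗ graft Y a = graft Z (g a) ∘ₗ g :=
  LinearMap.ext fun b => hg a b

theorem IsSubst.postcomp {F : TreeVec X →ₗ[ℚ] TreeVec Y} {g : TreeVec Y →ₗ[ℚ] TreeVec Z}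
    {φ : TreeVec X →ₗ[ℚ] ExteriorAlgebra ℚ (TreeVec Y)} (h : IsSubst F φ) (hg : IsMagmatic g) :
    IsSubst (g ∘ₗ F) ((ExteriorAlgebra.map g).toLinearMap ∘ₗ φ) :=
  ⟨hg.comp h.hom, fun a b => by
    simp only [LinearMap.comp_apply, AlgHom.toLinearMap_apply, h.der, map_add]
    rw [map_derivation g _ _ (hg.comp_graft _), map_derivation g _ _ (hg.comp_graft _)]⟩

/-! The law for nested substitutions. -/

/-- The subtree grafted along the path of the first insertion has the form `F c`, and `φ'` vanishes
there. Hence the second expansion commutes with that grafting without an extra term. -/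
theorem IsSubst.comp_of_eq_zero {F : TreeVec X →ₗ[ℚ] TreeVec Y}
    {φ : TreeVec X →ₗ[ℚ] ExteriorAlgebra ℚ (TreeVec Y)} (h : IsSubst F φ)
    {F' : TreeVec Y →ₗ[ℚ] TreeVec Z} {φ' : TreeVec Y →ₗ[ℚ] ExteriorAlgebra ℚ (TreeVec Z)}
    (h' : IsSubst F' φ') (h0 : φ' ∘ₗ F = 0) : IsSubst (F' ∘ₗ F) (expand F' φ' ∘ₗ φ) := by
  refine ⟨h'.hom.comp h.hom, fun a b => ?_⟩
  have key : ∀ (c : TreeVec X) (u), expand F' φ' (derivation (graft Y (F c)) u)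
      = derivation (graft Z (F' (F c))) (expand F' φ' u) := by
    intro c u
    have hc : φ' (F c) = 0 := LinearMap.congr_fun h0 c
    have := expand_derivation F' φ' 0 (graft Y (F c)) (graft Z (F' (F c))) (h'.hom.comp_graft _)
      (LinearMap.ext fun m => by simp [h'.der, hc]) u
    rw [this, expand_zero]
    simp
  simp only [LinearMap.comp_apply, h.der, map_add, key]

/-- A factor left untouched by the first expansion cannot be selected by the second one, since `φ'`
vanishes on it. The second selection therefore falls inside `φ`. -/
theorem expand_expand_of_eq_zero {F : TreeVec X →ₗ[ℚ] TreeVec Y}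
    {φ : TreeVec X →ₗ[ℚ] ExteriorAlgebra ℚ (TreeVec Y)}
    {F' : TreeVec Y →ₗ[ℚ] TreeVec Z} {φ' : TreeVec Y →ₗ[ℚ] ExteriorAlgebra ℚ (TreeVec Z)}
    (h0 : φ' ∘ₗ F = 0) (x : ExteriorAlgebra ℚ (TreeVec X)) :
    expand F' φ' (expand F φ x) = expand (F' ∘ₗ F) (expand F' φ' ∘ₗ φ) x := by
  have key : ∀ (a : ExteriorAlgebra ℚ (TreeVec X)) v, expand F' φ' (ExteriorAlgebra.map F a * v)
      = ExteriorAlgebra.map (F' ∘ₗ F) a * expand F' φ' v := by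
    intro a v
    induction a using exterior_left_induction with
    | one => simp
    | smul c x hx => simp [hx]
    | add x y hx hy => simp [hx, hy, add_mul]
    | ι_mul m x hx =>
      have hm : φ' (F m) = 0 := LinearMap.congr_fun h0 m
      rw [map_mul (ExteriorAlgebra.map F), mul_assoc, ExteriorAlgebra.map_apply_ι, expand_ι_mul, hx, hm]
      simp [mul_assoc]
  refine LinearMap.congr_fun (f := expand F' φ' ∘ₗ expand F φ)
    (exterior_linear_ext _ _ (by simp [expand_one]) fun m x hx => ?_) x
  have hm : φ' (F m) = 0 := LinearMap.congr_fun h0 m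
  simp only [LinearMap.comp_apply] at hx ⊢
  rw [expand_ι_mul, expand_ι_mul, map_add, key, expand_ι_mul, hx, hm]
  simp

/-! The law for parallel substitutions. -/

/-- The insertion point may lie in the factors of `u` or in the tree `a` grafted on one of them. The
second possibility is the pairing term. -/
theorem IsSubst.expand_graft {F : TreeVec Y →ₗ[ℚ] TreeVec Z}
    {φ : TreeVec Y →ₗ[ℚ] ExteriorAlgebra ℚ (TreeVec Z)} (h : IsSubst F φ) (a : TreeVec Y)
    (u : ExteriorAlgebra ℚ (TreeVec Y)) :
    expand F φ (derivation (graft Y a) u) = derivation (graft Z (F a)) (expand F φ u)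
      + pairing (graft Z) (φ a) (ExteriorAlgebra.map F u) := by
  rw [pairing, expand_map]
  refine expand_derivation F φ _ _ _ (h.hom.comp_graft a) (LinearMap.ext fun m => ?_) u
  simp only [LinearMap.comp_apply, LinearMap.add_apply, h.der, LinearMap.coe_mk, AddHom.coe_mk]
  exact add_comm _ _

/-- The two routes from `X` to `W` perform the same two insertions in opposite orders: `φ₁` and `γ₂`
represent the insertion of degree `r`, `γ₁` and `φ₂` the one of degree `s`. The hypotheses concern
leaves only. They extend first to trees, where `pairing_symm` is needed, and then to exterior
products. -/
theorem expand_expand_parallel {F₁ : TreeVec X →ₗ[ℚ] TreeVec Y}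
    {φ₁ : TreeVec X →ₗ[ℚ] ExteriorAlgebra ℚ (TreeVec Y)}
    {F₂ : TreeVec Y →ₗ[ℚ] TreeVec W} {φ₂ : TreeVec Y →ₗ[ℚ] ExteriorAlgebra ℚ (TreeVec W)}
    {G₁ : TreeVec X →ₗ[ℚ] TreeVec Z} {γ₁ : TreeVec X →ₗ[ℚ] ExteriorAlgebra ℚ (TreeVec Z)}
    {G₂ : TreeVec Z →ₗ[ℚ] TreeVec W} {γ₂ : TreeVec Z →ₗ[ℚ] ExteriorAlgebra ℚ (TreeVec W)}
    (hF₁ : IsSubst F₁ φ₁) (hF₂ : IsSubst F₂ φ₂) (hG₁ : IsSubst G₁ γ₁) (hG₂ : IsSubst G₂ γ₂)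
    {r s : ℕ}
    (dφ₁ : ∀ m, φ₁ m ∈ (⋀[ℚ]^r (TreeVec Y) : Submodule ℚ (ExteriorAlgebra ℚ (TreeVec Y))))
    (dφ₂ : ∀ m, φ₂ m ∈ (⋀[ℚ]^s (TreeVec W) : Submodule ℚ (ExteriorAlgebra ℚ (TreeVec W))))
    (dγ₁ : ∀ m, γ₁ m ∈ (⋀[ℚ]^s (TreeVec Z) : Submodule ℚ (ExteriorAlgebra ℚ (TreeVec Z))))
    (dγ₂ : ∀ m, γ₂ m ∈ (⋀[ℚ]^r (TreeVec W) : Submodule ℚ (ExteriorAlgebra ℚ (TreeVec W))))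
    (hFG : ∀ i, F₂ (F₁ (leafVec i)) = G₂ (G₁ (leafVec i)))
    (hY : ∀ i, ExteriorAlgebra.map F₂ (φ₁ (leafVec i)) = γ₂ (G₁ (leafVec i)))
    (hZ : ∀ i, ExteriorAlgebra.map G₂ (γ₁ (leafVec i)) = φ₂ (F₁ (leafVec i)))
    (hleaf : ∀ i, expand F₂ φ₂ (φ₁ (leafVec i))
      = (-1 : ℚ) ^ ((r + 1) * (s + 1)) • expand G₂ γ₂ (γ₁ (leafVec i)))
    (x : ExteriorAlgebra ℚ (TreeVec X)) :
    expand F₂ φ₂ (expand F₁ φ₁ x)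
      = (-1 : ℚ) ^ ((r + 1) * (s + 1)) • expand G₂ γ₂ (expand G₁ γ₁ x) := by
  obtain ⟨eF, eY⟩ := (hF₁.postcomp hF₂.hom).ext (hG₂.precomp hG₁.hom) hFG hY
  obtain ⟨-, eZ⟩ := (hG₁.postcomp hG₂.hom).ext (hF₂.precomp hF₁.hom) (fun i => (hFG i).symm) hZ
  have eF' : ∀ m, F₂ (F₁ m) = G₂ (G₁ m) := LinearMap.congr_fun eF
  have eY' : ∀ m, ExteriorAlgebra.map F₂ (φ₁ m) = γ₂ (G₁ m) := LinearMap.congr_fun eY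
  have eZ' : ∀ m, ExteriorAlgebra.map G₂ (γ₁ m) = φ₂ (F₁ m) := LinearMap.congr_fun eZ
  have base : ∀ m, expand F₂ φ₂ (φ₁ m)
      = (-1 : ℚ) ^ ((r + 1) * (s + 1)) • expand G₂ γ₂ (γ₁ m) := by
    refine LinearMap.congr_fun (f := expand F₂ φ₂ ∘ₗ φ₁)
      (g := (-1 : ℚ) ^ ((r + 1) * (s + 1)) • (expand G₂ γ₂ ∘ₗ γ₁)) (treeVec_ext fun t => ?_)
    induction t using Tree.induction with
    | leaf i => exact hleaf i
    | mul t t' ht ht' =>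
      simp only [LinearMap.comp_apply, LinearMap.smul_apply] at ht ht' ⊢
      -- At a vertex, either both insertions happen on the same side, which is the induction
      -- hypothesis, or one on each side, which gives two pairings. Symmetry matches these with the
      -- pairings of the other route.
      rw [treeVec_mul, hF₁.der, hG₁.der, map_add, map_add, hF₂.expand_graft, hF₂.expand_graft,
        hG₂.expand_graft, hG₂.expand_graft, ht, ht', map_smul, map_smul, eF', eF', eY', eY', eZ',
        eZ', pairing_symm _ graft_comm _ _ (dγ₂ _) (dφ₂ _), pairing_symm _ graft_comm _ _ (dγ₂ _)
        (dφ₂ _)]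
      simp only [smul_add]
      abel
  have eFm : ∀ a, ExteriorAlgebra.map F₂ (ExteriorAlgebra.map F₁ a)
      = ExteriorAlgebra.map G₂ (ExteriorAlgebra.map G₁ a) := fun a => by
    simp only [← AlgHom.comp_apply, ExteriorAlgebra.map_comp_map, eF]
  have Ym : ∀ a, ExteriorAlgebra.map F₂ (expand F₁ φ₁ a) = expand G₂ γ₂ (ExteriorAlgebra.map G₁ a) :=
    fun a => by rw [map_expand, expand_map, eF, eY]
  have Zm : ∀ a, ExteriorAlgebra.map G₂ (expand G₁ γ₁ a) = expand F₂ φ₂ (ExteriorAlgebra.map F₁ a) :=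
    fun a => by rw [map_expand, expand_map, eZ, eF]
  refine LinearMap.congr_fun (f := expand F₂ φ₂ ∘ₗ expand F₁ φ₁)
      (g := (-1 : ℚ) ^ ((r + 1) * (s + 1)) • (expand G₂ γ₂ ∘ₗ expand G₁ γ₁))
    (exterior_linear_ext _ _ (by simp [expand_one]) fun m x hx => ?_) x
  simp only [LinearMap.comp_apply, LinearMap.smul_apply] at hx ⊢
  -- Each side has four terms, according to whether each insertion falls in the first vector or in
  -- the rest. The two mixed terms of one side are those of the other in exchanged order, with
  -- exponents agreeing modulo 2.
  rw [expand_ι_mul, expand_ι_mul, map_add, map_add, expand_ι_mul, expand_ι_mul, hx,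
    expand_mul_of_mem F₂ φ₂ dφ₂ _ _ (dφ₁ m), expand_mul_of_mem G₂ γ₂ dγ₂ _ _ (dγ₁ m), base,
    inv_expand F₁ φ₁ dφ₁, inv_expand G₁ γ₁ dγ₁, map_smul, map_smul, Ym, Zm, eFm, eF', eY', eZ']
  have e₁ : (-1 : ℚ) ^ ((r + 1) * (s + 1)) * (-1) ^ (s * (r + 1)) = (-1) ^ (r + 1) := by
    rw [← pow_add, show (r + 1) * (s + 1) + s * (r + 1) = 2 * (s * (r + 1)) + (r + 1) by ring,
      pow_add, pow_mul]
    simp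
  have e₂ : (-1 : ℚ) ^ ((r + 1) * (s + 1)) * (-1) ^ (s + 1) = (-1) ^ (r * (s + 1)) := by
    rw [← pow_add, show (r + 1) * (s + 1) + (s + 1) = 2 * (s + 1) + r * (s + 1) by ring,
      pow_add, pow_mul]
    simp
  simp only [smul_add, mul_smul_comm, smul_mul_assoc, smul_smul, e₁, e₂]
  abel

end Subst

end Bessel
end

noncomputable section

namespace Bessel

/-! ### The substitution of exterior products of trees -/

section TreeSubst

variable {X Y Z I J K : Type}

theorem Tree.map_mul (f : X → Y) (s t : Tree X) : (s * t).map f = s.map f * t.map f := by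
  induction s, t using Con.induction_on₂ with
  | H a b => rfl

theorem Tree.map_map (f : X → Y) (g : Y → Z) (t : Tree X) : (t.map f).map g = t.map (g ∘ f) := by
  induction t using Tree.induction with
  | leaf i => rfl
  | mul s t hs ht => simp only [Tree.map_mul, hs, ht]

theorem Tree.map_id (t : Tree X) : t.map id = t := by
  induction t using Tree.induction with
  | leaf i => rfl
  | mul s t hs ht => rw [Tree.map_mul, hs, ht]

/-- Linear extension of the relabelling of trees. -/
abbrev treeMap (f : X → Y) : TreeVec X →ₗ[ℚ] TreeVec Y := Finsupp.lmapDomain ℚ ℚ (Tree.map f)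

/-- Relabelling of exterior products of trees. -/
abbrev relabel (f : X → Y) : ExteriorAlgebra ℚ (TreeVec X) →ₐ[ℚ] ExteriorAlgebra ℚ (TreeVec Y) :=
  ExteriorAlgebra.map (treeMap f)

theorem treeMap_treeVec (f : X → Y) (t : Tree X) : treeMap f (treeVec t) = treeVec (t.map f) := by
  simp

theorem isMagmatic_treeMap (f : X → Y) : IsMagmatic (treeMap f) :=
  isMagmatic_of_tree fun s t => by
    rw [treeMap_treeVec, treeMap_treeVec, treeMap_treeVec, Tree.map_mul, treeVec_mul]

theorem treeMap_comp (f : X → Y) (g : Y → Z) : treeMap g ∘ₗ treeMap f = treeMap (g ∘ f) :=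
  treeVec_ext fun t => by
    rw [LinearMap.comp_apply, treeMap_treeVec, treeMap_treeVec, treeMap_treeVec, Tree.map_map]

theorem treeMap_id : treeMap (id : X → X) = LinearMap.id :=
  treeVec_ext fun t => by rw [treeMap_treeVec, Tree.map_id]; rfl

theorem relabel_relabel (f : X → Y) (g : Y → Z) (x : ExteriorAlgebra ℚ (TreeVec X)) :
    relabel g (relabel f x) = relabel (g ∘ f) x := by
  rw [relabel, relabel, ← AlgHom.comp_apply, ExteriorAlgebra.map_comp_map, treeMap_comp]

theorem relabel_id (x : ExteriorAlgebra ℚ (TreeVec X)) : relabel id x = x := by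
  rw [relabel, treeMap_id, ExteriorAlgebra.map_id]
  rfl

theorem forgetB_treeVec (t : Tree (Option I)) : forgetB I J (treeVec t) = treeForget I J t := by
  simp [forgetB]

theorem insertB_treeVec (y : ExteriorAlgebra ℚ (TreeVec J)) (t : Tree (Option I)) :
    insertB I J y (treeVec t) = treeInsert I J t (relabel Sum.inr y) := by
  simp [insertB]

/-- On planar representatives this is the recursive clause of `planarForget` and `planarInsert` at a
vertex, extended bilinearly. -/
theorem isSubst_forgetB (y : ExteriorAlgebra ℚ (TreeVec J)) :
    IsSubst (forgetB I J) (insertB I J y) := by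
  have hF : ∀ s t : Tree (Option I),
      treeForget I J (s * t) = graft (I ⊕ J) (treeForget I J s) (treeForget I J t) := by
    intro s t
    induction s, t using Con.induction_on₂ with
    | H a b => rfl
  have hI : ∀ s t : Tree (Option I), treeInsert I J (s * t)
      = derivation (graft (I ⊕ J) (treeForget I J t)) ∘ₗ treeInsert I J s
        + derivation (graft (I ⊕ J) (treeForget I J s)) ∘ₗ treeInsert I J t := by
    intro s t
    induction s, t using Con.induction_on₂ with
    | H a b => rfl
  have hm : IsMagmatic (forgetB I J) := isMagmatic_of_tree fun s t => by
    rw [forgetB_treeVec, forgetB_treeVec, forgetB_treeVec, hF]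
  refine ⟨hm, ?_⟩
  -- The first term of the derivation rule as a bilinear map; the second is its flip. The rule then
  -- needs checking on trees only.
  let f : TreeVec (Option I) →ₗ[ℚ] TreeVec (Option I) →ₗ[ℚ] ExteriorAlgebra ℚ (TreeVec (I ⊕ J)) :=
    LinearMap.mk₂ ℚ
      (fun a b => derivation (graft (I ⊕ J) (forgetB I J b)) (insertB I J y a))
      (fun a a' b => by rw [map_add, map_add]) (fun c a b => by rw [map_smul, map_smul])
      (fun a b b' => by rw [map_add, map_add, derivation_add]; rfl)
      (fun c a b => by rw [map_smul, map_smul, derivation_smul]; rfl)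
  have : (graft (Option I)).compr₂ (insertB I J y) = f + f.flip := by
    refine treeVec_ext fun s => treeVec_ext fun t => ?_
    change insertB I J y (graft (Option I) (treeVec s) (treeVec t))
      = derivation (graft (I ⊕ J) (forgetB I J (treeVec t))) (insertB I J y (treeVec s))
      + derivation (graft (I ⊕ J) (forgetB I J (treeVec s))) (insertB I J y (treeVec t))
    rw [← treeVec_mul, insertB_treeVec, insertB_treeVec, insertB_treeVec, forgetB_treeVec,
      forgetB_treeVec, hI]
    rfl
  exact fun a b => LinearMap.congr_fun₂ this a b

theorem forgetB_leaf_none : forgetB I J (leafVec none) = 0 := by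
  rw [forgetB_treeVec]
  rfl

theorem forgetB_leaf_some (i : I) : forgetB I J (leafVec (some i)) = leafVec (Sum.inl i) := by
  rw [forgetB_treeVec]
  rfl

theorem insertB_leaf_none (y : ExteriorAlgebra ℚ (TreeVec J)) :
    insertB I J y (leafVec none) = relabel Sum.inr y := by
  rw [insertB_treeVec]
  rfl

theorem insertB_leaf_some (y : ExteriorAlgebra ℚ (TreeVec J)) (i : I) :
    insertB I J y (leafVec (some i)) = 0 := by
  rw [insertB_treeVec]
  rfl

theorem treeMap_leafVec (f : X → Y) (i : X) : treeMap f (leafVec i) = leafVec (f i) :=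
  treeMap_treeVec f _

theorem insertB_mem {s : ℕ} (y : ExteriorAlgebra ℚ (TreeVec J))
    (hy : y ∈ (⋀[ℚ]^s (TreeVec J) : Submodule ℚ (ExteriorAlgebra ℚ (TreeVec J))))
    (m : TreeVec (Option I)) : insertB I J y m ∈
      (⋀[ℚ]^s (TreeVec (I ⊕ J)) : Submodule ℚ (ExteriorAlgebra ℚ (TreeVec (I ⊕ J)))) := by
  have key : ∀ t : Tree (Option I), insertB I J y (treeVec t) ∈
      (⋀[ℚ]^s (TreeVec (I ⊕ J)) : Submodule ℚ (ExteriorAlgebra ℚ (TreeVec (I ⊕ J)))) := by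
    intro t
    induction t using Tree.induction with
    | leaf i =>
      cases i with
      | none => rw [insertB_leaf_none]; exact map_mem_exteriorPower _ _ hy
      | some i => rw [insertB_leaf_some]; exact Submodule.zero_mem _
    | mul s t hs ht =>
      rw [treeVec_mul, (isSubst_forgetB y).der]
      exact Submodule.add_mem _ (derivation_mem_exteriorPower _ _ hs)
        (derivation_mem_exteriorPower _ _ ht)
  induction m using Finsupp.induction_linear with
  | zero => rw [map_zero]; exact Submodule.zero_mem _
  | add f g hf hg => rw [map_add]; exact Submodule.add_mem _ hf hg
  | single t c =>
    have : Finsupp.single t c = c • treeVec t := by simp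
    rw [this, map_smul]
    exact Submodule.smul_mem _ c (key t)

/-- The partial composition, on the whole exterior algebras. -/
def subst (x : ExteriorAlgebra ℚ (TreeVec (Option I))) (y : ExteriorAlgebra ℚ (TreeVec J)) :
    ExteriorAlgebra ℚ (TreeVec (I ⊕ J)) :=
  expand (forgetB I J) (insertB I J y) x

theorem insertB_treeMap_some (y : ExteriorAlgebra ℚ (TreeVec J)) (f : X → Option I) (g : X → I)
    (h : ∀ i, f i = some (g i)) : insertB I J y ∘ₗ treeMap f = 0 := by
  have h0 : IsSubst (forgetB I J ∘ₗ treeMap f) 0 :=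
    ⟨(isSubst_forgetB y).hom.comp (isMagmatic_treeMap f), fun a b => by simp⟩
  refine (((isSubst_forgetB y).precomp (isMagmatic_treeMap f)).ext h0 (fun i => rfl)
    fun i => ?_).2
  rw [LinearMap.comp_apply, treeMap_leafVec, h, insertB_leaf_some]
  rfl

theorem forgetB_treeMap_some (f : X → Option I) (g : X → I) (h : ∀ i, f i = some (g i)) :
    forgetB I J ∘ₗ treeMap f = treeMap (Sum.inl ∘ g) := by
  refine ((isSubst_forgetB (0 : ExteriorAlgebra ℚ (TreeVec J))).hom.comp
    (isMagmatic_treeMap f)).ext (isMagmatic_treeMap _) fun i => ?_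
  rw [LinearMap.comp_apply, treeMap_leafVec, h, forgetB_leaf_some, treeMap_leafVec]
  rfl

/-- Both sides are expansions of `x` along substitutions, which agree on `⋆` and on the other
leaves. -/
theorem subst_relabel {I' J' : Type} (e : I → I') (f : J → J')
    (x : ExteriorAlgebra ℚ (TreeVec (Option I))) (y : ExteriorAlgebra ℚ (TreeVec J)) :
    subst (relabel (Option.map e) x) (relabel f y) = relabel (Sum.map e f) (subst x y) := by
  rw [subst, subst, relabel, relabel, expand_map, map_expand]
  refine LinearMap.congr_fun (((isSubst_forgetB _).precomp (isMagmatic_treeMap _)).expand_ext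
    ((isSubst_forgetB _).postcomp (isMagmatic_treeMap _)) (fun i => ?_) fun i => ?_) x
  · cases i with
    | none => simp only [LinearMap.comp_apply, treeMap_leafVec, Option.map_none, forgetB_leaf_none,
        map_zero]
    | some i => simp only [LinearMap.comp_apply, treeMap_leafVec, Option.map_some,
        forgetB_leaf_some, Sum.map_inl]
  · cases i with
    | none =>
      simp only [LinearMap.comp_apply, treeMap_leafVec, Option.map_none, insertB_leaf_none,
        AlgHom.toLinearMap_apply, relabel_relabel]
      rfl
    | some i => simp only [LinearMap.comp_apply, treeMap_leafVec, Option.map_some,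
        insertB_leaf_some, map_zero]

theorem subst_ι_leaf (y : ExteriorAlgebra ℚ (TreeVec J)) :
    subst (ExteriorAlgebra.ι ℚ (leafVec (none : Option I))) y = relabel Sum.inr y := by
  rw [subst, expand_ι, insertB_leaf_none]

/-- The right side is a double expansion of `x` in which the second `⋆` comes from `y`, so it
collapses to a single expansion and the leaves can be compared. -/
theorem subst_subst_nested (x : ExteriorAlgebra ℚ (TreeVec (Option I)))
    (y : ExteriorAlgebra ℚ (TreeVec (Option J))) (z : ExteriorAlgebra ℚ (TreeVec K)) :
    subst x (subst y z)
      = relabel (Equiv.sumAssoc I J K) (subst (relabel (starRight I J) (subst x y)) z) := by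
  have hF := isSubst_forgetB (I := I) y
  have hF' := ((isSubst_forgetB (I := I ⊕ J) z).postcomp
    (isMagmatic_treeMap (Equiv.sumAssoc I J K))).precomp (isMagmatic_treeMap (starRight I J))
  -- The trees coming from `x` by `forgetB` do not contain the `⋆` of `y`.
  have h0 : (((relabel (Equiv.sumAssoc I J K)).toLinearMap ∘ₗ insertB (I ⊕ J) K z)
      ∘ₗ treeMap (starRight I J)) ∘ₗ forgetB I (Option J) = 0 := by
    refine ((hF'.precomp hF.hom).ext ⟨hF'.hom.comp hF.hom, fun a b => by simp⟩ (fun i => rfl)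
      fun i => ?_).2
    cases i with
    | none => simp only [LinearMap.comp_apply, forgetB_leaf_none, map_zero, LinearMap.zero_apply]
    | some i =>
      simp only [LinearMap.comp_apply, forgetB_leaf_some, treeMap_leafVec, LinearMap.zero_apply]
      change relabel _ (insertB (I ⊕ J) K z (leafVec (some _))) = 0
      rw [insertB_leaf_some, map_zero]
  have e : relabel (Equiv.sumAssoc I J K) (subst (relabel (starRight I J) (subst x y)) z)
      = expand ((treeMap (Equiv.sumAssoc I J K) ∘ₗ forgetB (I ⊕ J) K) ∘ₗ treeMap (starRight I J))
        (((relabel (Equiv.sumAssoc I J K)).toLinearMap ∘ₗ insertB (I ⊕ J) K z)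
          ∘ₗ treeMap (starRight I J))
        (expand (forgetB I (Option J)) (insertB I (Option J) y) x) := by
    rw [subst, relabel, relabel, expand_map, map_expand, subst]
    rfl
  rw [e, expand_expand_of_eq_zero h0, subst]
  refine LinearMap.congr_fun ((isSubst_forgetB _).expand_ext (hF.comp_of_eq_zero hF' h0)
    (fun i => ?_) fun i => ?_) x
  · cases i with
    | none => simp only [LinearMap.comp_apply, forgetB_leaf_none, map_zero]
    | some i =>
      simp only [LinearMap.comp_apply, forgetB_leaf_some, treeMap_leafVec]
      change _ = treeMap _ (forgetB (I ⊕ J) K (leafVec (some _)))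
      rw [forgetB_leaf_some, treeMap_leafVec]
      rfl
  · cases i with
    | none =>
      simp only [LinearMap.comp_apply, insertB_leaf_none]
      -- At the leaf `⋆` of `x` both sides become expansions of `y`, and the leaves of `y` are
      -- compared in turn.
      rw [subst, map_expand, relabel, expand_map]
      refine LinearMap.congr_fun (((isSubst_forgetB _).postcomp (isMagmatic_treeMap _)).expand_ext
        (hF'.precomp (isMagmatic_treeMap _)) (fun j => ?_) fun j => ?_) y
      · simp only [LinearMap.comp_apply, treeMap_leafVec]
        cases j with
        | none =>
          change treeMap _ (forgetB J K (leafVec none)) = treeMap _ (forgetB (I ⊕ J) K (leafVec none))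
          simp only [forgetB_leaf_none, map_zero]
        | some j =>
          change treeMap _ (forgetB J K (leafVec (some j)))
            = treeMap _ (forgetB (I ⊕ J) K (leafVec (some _)))
          simp only [forgetB_leaf_some, treeMap_leafVec]
          rfl
      · simp only [LinearMap.comp_apply, treeMap_leafVec, AlgHom.toLinearMap_apply]
        cases j with
        | none =>
          change relabel _ (insertB J K z (leafVec none))
            = relabel _ (insertB (I ⊕ J) K z (leafVec none))
          simp only [insertB_leaf_none, relabel_relabel]
          rfl
        | some j =>
          change relabel _ (insertB J K z (leafVec (some j)))
            = relabel _ (insertB (I ⊕ J) K z (leafVec (some _)))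
          simp only [insertB_leaf_some, map_zero]
    | some i => simp only [LinearMap.comp_apply, insertB_leaf_some, map_zero]

-- The work is to put both sides in the form required by `expand_expand_parallel`, and to check its
-- hypotheses on three kinds of leaves: the first `⋆`, the second `⋆`, and the points of `I`.
set_option maxHeartbeats 1000000 in
theorem subst_subst_parallel {r s : ℕ} (x : ExteriorAlgebra ℚ (TreeVec (Option (Option I))))
    (y : ExteriorAlgebra ℚ (TreeVec J)) (z : ExteriorAlgebra ℚ (TreeVec K))
    (hy : y ∈ (⋀[ℚ]^r (TreeVec J) : Submodule ℚ (ExteriorAlgebra ℚ (TreeVec J))))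
    (hz : z ∈ (⋀[ℚ]^s (TreeVec K) : Submodule ℚ (ExteriorAlgebra ℚ (TreeVec K)))) :
    subst (relabel (starLeft I J) (subst x y)) z = (-1 : ℚ) ^ ((r + 1) * (s + 1)) •
      relabel (swapRight I J K)
        (subst (relabel (starLeft I K) (subst (relabel (swapStars I) x) z)) y) := by
  have hy' := fun m => insertB_mem (I := Option I) y hy m
  have hz' := fun m => insertB_mem (I := Option I) z hz (treeMap (swapStars I) m)
  have hz₂ := fun m => insertB_mem (I := I ⊕ J) z hz (treeMap (starLeft I J) m)
  have hy₂ := fun m => map_mem_exteriorPower (treeMap (swapRight I J K)) _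
    (insertB_mem (I := I ⊕ K) y hy (treeMap (starLeft I K) m))
  have e₁ : subst (relabel (starLeft I J) (subst x y)) z
      = expand (forgetB (I ⊕ J) K ∘ₗ treeMap (starLeft I J))
        (insertB (I ⊕ J) K z ∘ₗ treeMap (starLeft I J))
        (expand (forgetB (Option I) J) (insertB (Option I) J y) x) := by
    rw [subst, relabel, expand_map, subst]
  have e₂ : relabel (swapRight I J K)
        (subst (relabel (starLeft I K) (subst (relabel (swapStars I) x) z)) y)
      = expand ((treeMap (swapRight I J K) ∘ₗ forgetB (I ⊕ K) J) ∘ₗ treeMap (starLeft I K))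
        (((relabel (swapRight I J K)).toLinearMap ∘ₗ insertB (I ⊕ K) J y) ∘ₗ treeMap (starLeft I K))
        (expand (forgetB (Option I) K ∘ₗ treeMap (swapStars I))
          (insertB (Option I) K z ∘ₗ treeMap (swapStars I)) x) := by
    rw [subst, relabel, relabel, expand_map, map_expand, subst, relabel, expand_map]
    rfl
  rw [e₁, e₂]
  refine expand_expand_parallel (isSubst_forgetB y)
    ((isSubst_forgetB z).precomp (isMagmatic_treeMap _))
    ((isSubst_forgetB z).precomp (isMagmatic_treeMap _))
    (((isSubst_forgetB y).postcomp (isMagmatic_treeMap _)).precomp (isMagmatic_treeMap _))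
    hy' hz₂ hz' hy₂ (fun i => ?_) (fun i => ?_) (fun i => ?_) (fun i => ?_) x
  · simp only [LinearMap.comp_apply, treeMap_leafVec]
    rcases i with _ | _ | i
    · change _ = treeMap _ (forgetB _ _ (treeMap _ (forgetB _ _ (leafVec (some none)))))
      simp only [forgetB_leaf_none, forgetB_leaf_some, treeMap_leafVec, map_zero]
      change _ = treeMap _ (forgetB _ _ (leafVec none))
      simp only [forgetB_leaf_none, map_zero]
    · change _ = treeMap _ (forgetB _ _ (treeMap _ (forgetB _ _ (leafVec none))))
      simp only [forgetB_leaf_none, forgetB_leaf_some, treeMap_leafVec, map_zero]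
      change forgetB _ _ (leafVec none) = _
      simp only [forgetB_leaf_none]
    · change _ = treeMap _ (forgetB _ _ (treeMap _ (forgetB _ _ (leafVec (some (some i))))))
      simp only [forgetB_leaf_some, treeMap_leafVec]
      change forgetB _ _ (leafVec (some _)) = treeMap _ (forgetB _ _ (leafVec (some _)))
      simp only [forgetB_leaf_some, treeMap_leafVec]
      rfl
  -- At the first `⋆` both routes insert `y`. Its trees do not contain the remaining `⋆`, so the
  -- other step only relabels them.
  · simp only [LinearMap.comp_apply, treeMap_leafVec, AlgHom.toLinearMap_apply]
    rcases i with _ | _ | i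
    · change _ = relabel _ (insertB _ _ y (treeMap _ (forgetB _ _ (leafVec (some none)))))
      rw [forgetB_leaf_some, treeMap_leafVec]
      change _ = relabel _ (insertB _ _ y (leafVec none))
      rw [insertB_leaf_none, insertB_leaf_none, relabel_relabel, ← AlgHom.comp_apply,
        ExteriorAlgebra.map_comp_map, LinearMap.comp_assoc, treeMap_comp,
        forgetB_treeMap_some (starLeft I J ∘ Sum.inr) Sum.inr fun j => rfl]
      rfl
    · change _ = relabel _ (insertB _ _ y (treeMap _ (forgetB _ _ (leafVec none))))
      simp only [insertB_leaf_some, forgetB_leaf_none, map_zero]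
    · change _ = relabel _ (insertB _ _ y (treeMap _ (forgetB _ _ (leafVec (some (some i))))))
      rw [forgetB_leaf_some, treeMap_leafVec]
      change _ = relabel _ (insertB _ _ y (leafVec (some _)))
      simp only [insertB_leaf_some, map_zero]
  · simp only [LinearMap.comp_apply, treeMap_leafVec]
    rcases i with _ | _ | i
    · change ExteriorAlgebra.map _ (insertB _ _ z (leafVec (some none))) = _
      simp only [insertB_leaf_some, forgetB_leaf_none, map_zero]
    · change ExteriorAlgebra.map _ (insertB _ _ z (leafVec none)) = _
      rw [forgetB_leaf_some, treeMap_leafVec]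
      change _ = insertB _ _ z (leafVec none)
      rw [insertB_leaf_none, insertB_leaf_none, ← AlgHom.comp_apply,
        ExteriorAlgebra.map_comp_map, LinearMap.comp_assoc, LinearMap.comp_assoc, treeMap_comp,
        forgetB_treeMap_some (starLeft I K ∘ Sum.inr) Sum.inr fun j => rfl, treeMap_comp]
      rfl
    · change ExteriorAlgebra.map _ (insertB _ _ z (leafVec (some (some i)))) = _
      rw [forgetB_leaf_some, treeMap_leafVec]
      change _ = insertB _ _ z (leafVec (some _))
      simp only [insertB_leaf_some, map_zero]
  -- A single leaf cannot receive both insertions, so both sides vanish.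
  · simp only [LinearMap.comp_apply, treeMap_leafVec]
    rcases i with _ | _ | i
    · change _ = _ • expand _ _ (insertB _ _ z (leafVec (some none)))
      rw [insertB_leaf_some, insertB_leaf_none, relabel, expand_map, LinearMap.comp_assoc,
        treeMap_comp, LinearMap.comp_assoc, treeMap_comp,
        insertB_treeMap_some z (starLeft I J ∘ Sum.inr) Sum.inr fun j => rfl, expand_zero, map_zero, smul_zero]
      rfl
    · change _ = _ • expand _ _ (insertB _ _ z (leafVec none))
      have h0 : (((relabel (swapRight I J K)).toLinearMap ∘ₗ insertB (I ⊕ K) J y)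
          ∘ₗ treeMap (starLeft I K)) ∘ₗ treeMap Sum.inr = 0 := by
        rw [LinearMap.comp_assoc, LinearMap.comp_assoc, treeMap_comp,
          insertB_treeMap_some y (starLeft I K ∘ Sum.inr) Sum.inr fun j => rfl,
          LinearMap.comp_zero]
      rw [insertB_leaf_some, insertB_leaf_none, relabel, expand_map, h0, expand_zero, map_zero,
        LinearMap.zero_apply, smul_zero]
    · change _ = _ • expand _ _ (insertB _ _ z (leafVec (some (some i))))
      simp only [insertB_leaf_some, map_zero, smul_zero]

theorem subst_mem {r s : ℕ} (x : ExteriorAlgebra ℚ (TreeVec (Option I)))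
    (y : ExteriorAlgebra ℚ (TreeVec J))
    (hx : x ∈ (⋀[ℚ]^(r + 1) (TreeVec (Option I)) :
      Submodule ℚ (ExteriorAlgebra ℚ (TreeVec (Option I)))))
    (hy : y ∈ (⋀[ℚ]^s (TreeVec J) : Submodule ℚ (ExteriorAlgebra ℚ (TreeVec J)))) :
    subst x y ∈
      (⋀[ℚ]^(r + s) (TreeVec (I ⊕ J)) : Submodule ℚ (ExteriorAlgebra ℚ (TreeVec (I ⊕ J)))) :=
  expand_mem _ _ (insertB_mem y hy) x hx

/-! The unit law holds for exterior products with exactly one leaf `⋆`. -/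

theorem tree_unit (t : Tree (Option I)) :
    (stars t.leaves = 0 → forgetB I PUnit.{1} (treeVec t)
        = treeVec (t.map (Equiv.optionEquivSumPUnit I)) ∧
      insertB I PUnit.{1} (ExteriorAlgebra.ι ℚ (leafVec PUnit.unit)) (treeVec t) = 0) ∧
    (stars t.leaves = 1 →
      insertB I PUnit.{1} (ExteriorAlgebra.ι ℚ (leafVec PUnit.unit)) (treeVec t)
        = ExteriorAlgebra.ι ℚ (treeVec (t.map (Equiv.optionEquivSumPUnit I)))) := by
  induction t using Tree.induction with
  | leaf i =>
    cases i with
    | none =>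
      refine ⟨fun h => absurd h (by exact one_ne_zero), fun _ => ?_⟩
      rw [insertB_leaf_none, ExteriorAlgebra.map_apply_ι, treeMap_leafVec]
      rfl
    | some i =>
      refine ⟨fun _ => ⟨?_, ?_⟩, fun h => absurd h (by exact zero_ne_one)⟩
      · rw [forgetB_leaf_some]
        rfl
      · rw [insertB_leaf_some]
  | mul s t hs ht =>
    have hd := (isSubst_forgetB (I := I)
      (ExteriorAlgebra.ι ℚ (leafVec PUnit.unit.{1}))).der (treeVec s) (treeVec t)
    rw [Tree.leaves_mul, stars_sum, Tree.map_mul, treeVec_mul, treeVec_mul, hd,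
      (isSubst_forgetB (I := I) (ExteriorAlgebra.ι ℚ (leafVec PUnit.unit.{1}))).hom]
    constructor
    · intro h
      obtain ⟨hs₁, hs₂⟩ := hs.1 (by omega)
      obtain ⟨ht₁, ht₂⟩ := ht.1 (by omega)
      rw [hs₁, hs₂, ht₁, ht₂, map_zero, map_zero, add_zero]
      exact ⟨rfl, rfl⟩
    · intro h
      rcases (by omega : stars s.leaves = 0 ∧ stars t.leaves = 1 ∨
        stars s.leaves = 1 ∧ stars t.leaves = 0) with ⟨h₁, h₂⟩ | ⟨h₁, h₂⟩
      · rw [(hs.1 h₁).1, (hs.1 h₁).2, ht.2 h₂, map_zero, zero_add, derivation_ι]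
      · rw [(ht.1 h₂).1, (ht.1 h₂).2, hs.2 h₁, map_zero, add_zero, derivation_ι, graft_comm]

theorem wedgeTrees_cons (t : Tree X) (l : List (Tree X)) :
    wedgeTrees (t :: l) = ExteriorAlgebra.ι ℚ (treeVec t) * wedgeTrees l := by
  simp [wedgeTrees, wedgeVec]

theorem wedgeTrees_append (l l' : List (Tree X)) :
    wedgeTrees (l ++ l') = wedgeTrees l * wedgeTrees l' := by
  simp [wedgeTrees, wedgeVec]

theorem wedgeTrees_mem (l : List (Tree X)) : wedgeTrees l ∈
    (⋀[ℚ]^l.length (TreeVec X) : Submodule ℚ (ExteriorAlgebra ℚ (TreeVec X))) :=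
  wedgeVec_mem _ (by simp)

/-- The cases of zero and of one `⋆` are proved together, because the `⋆` may be in the head or in
the tail of the list. With `⋆` in several trees, one is replaced while another is sent to `0`, and
the law fails. -/
theorem subst_unit (l : List (Tree (Option I))) :
    (stars ((l : Multiset (Tree (Option I))).bind Tree.leaves) = 0 →
      ExteriorAlgebra.map (forgetB I PUnit.{1}) (wedgeTrees l)
        = relabel (Equiv.optionEquivSumPUnit I) (wedgeTrees l) ∧
      subst (wedgeTrees l) (ExteriorAlgebra.ι ℚ (leafVec PUnit.unit.{1})) = 0) ∧
    (stars ((l : Multiset (Tree (Option I))).bind Tree.leaves) = 1 →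
      subst (wedgeTrees l) (ExteriorAlgebra.ι ℚ (leafVec PUnit.unit.{1}))
        = relabel (Equiv.optionEquivSumPUnit I) (wedgeTrees l)) := by
  induction l with
  | nil =>
    refine ⟨fun _ => ⟨?_, expand_one _ _⟩, fun h => absurd h (by exact zero_ne_one)⟩
    change ExteriorAlgebra.map _ (1 : ExteriorAlgebra ℚ _) = ExteriorAlgebra.map _ 1
    rw [map_one, map_one]
  | cons t l ih =>
    rw [← Multiset.cons_coe, Multiset.cons_bind, stars_sum, wedgeTrees_cons]
    have hr : subst (ExteriorAlgebra.ι ℚ (treeVec t) * wedgeTrees l)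
        (ExteriorAlgebra.ι ℚ (leafVec PUnit.unit.{1})) = _ := expand_ι_mul _ _ _ _
    rw [hr, map_mul, map_mul, ExteriorAlgebra.map_apply_ι, ExteriorAlgebra.map_apply_ι,
      treeMap_treeVec, map_inv]
    constructor
    · intro h
      obtain ⟨h₁, h₂⟩ := (tree_unit t).1 (by omega)
      obtain ⟨h₃, h₄⟩ := ih.1 (by omega)
      rw [subst] at h₄
      rw [h₁, h₂, h₃, h₄, mul_zero, mul_zero, add_zero]
      exact ⟨rfl, rfl⟩
    · intro h
      rcases (by omega : stars t.leaves = 0 ∧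
        stars ((l : Multiset (Tree (Option I))).bind Tree.leaves) = 1 ∨
        stars t.leaves = 1 ∧ stars ((l : Multiset (Tree (Option I))).bind Tree.leaves) = 0)
        with ⟨h₁, h₂⟩ | ⟨h₁, h₂⟩
      · have := ih.2 h₂
        rw [subst] at this
        rw [((tree_unit t).1 h₁).1, ((tree_unit t).1 h₁).2, this, mul_zero, zero_add]
      · have h₄ := (ih.1 h₂).2
        rw [subst] at h₄
        rw [(tree_unit t).2 h₁, h₄, (ih.1 h₂).1, mul_zero, add_zero, ι_mul_eq]

end TreeSubst

end Bessel
end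

noncomputable section

namespace Bessel

/-! ### Bases -/

section Bases

theorem wedgeVec_cons {M : Type*} [AddCommGroup M] [Module ℚ M] (m : M) (l : List M) :
    wedgeVec (m :: l) = ExteriorAlgebra.ι ℚ m * wedgeVec l := by
  simp [wedgeVec]

theorem wedgeVec_perm {M : Type*} [AddCommGroup M] [Module ℚ M] {l l' : List M} (h : l.Perm l') :
    wedgeVec l = wedgeVec l' ∨ wedgeVec l = -wedgeVec l' := by
  induction h with
  | nil => exact .inl rfl
  | cons m _ ih =>
    rw [wedgeVec_cons, wedgeVec_cons]
    rcases ih with ih | ih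
    · exact .inl (by rw [ih])
    · exact .inr (by rw [ih, mul_neg])
  | swap m n l =>
    rw [wedgeVec_cons, wedgeVec_cons, wedgeVec_cons, wedgeVec_cons, ← mul_assoc, ← mul_assoc,
      ← neg_mul]
    refine .inr (congrArg (· * wedgeVec l) ?_)
    exact eq_neg_of_add_eq_zero_left (ExteriorAlgebra.ι_add_mul_swap _ _)
  | trans _ _ ih ih' =>
    rcases ih with ih | ih <;> rcases ih' with ih' | ih' <;> rw [ih, ih'] <;> simp

/-- The basis of the exterior algebra depends on a linear order of `ι`. Up to sign this dependence
disappears, since any enumeration of a finite set differs from the increasing one by a permutation.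
-/
theorem exists_basis_exterior (ι : Type*) :
    ∃ b : Module.Basis (Finset ι) ℚ (ExteriorAlgebra ℚ (ι →₀ ℚ)), ∀ (l : List ι) (h : l.Nodup),
      wedgeVec (l.map fun i => Finsupp.single i (1 : ℚ)) = b ⟨(l : Multiset ι), h⟩ ∨
      wedgeVec (l.map fun i => Finsupp.single i (1 : ℚ)) = -b ⟨(l : Multiset ι), h⟩ := by
  classical
  let _ : LinearOrder ι := linearOrderOfSTO WellOrderingRel
  let b₀ : Module.Basis ι ℚ (ι →₀ ℚ) := Finsupp.basisSingleOne
  refine ⟨b₀.ExteriorAlgebra, fun l h => ?_⟩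
  set s : Finset ι := ⟨(l : Multiset ι), h⟩ with hs
  let f : Fin s.card ↪o ι := s.orderEmbOfFin rfl
  have e : b₀.ExteriorAlgebra s
      = wedgeVec ((List.ofFn f).map fun i => Finsupp.single i (1 : ℚ)) := by
    rw [ExteriorAlgebra.basis_apply_ofCard b₀ (s := s) rfl, ExteriorAlgebra.ιMulti_family,
      ExteriorAlgebra.ιMulti_apply, wedgeVec, List.map_map, List.map_ofFn]
    congr 1
  rw [e]
  refine wedgeVec_perm (List.Perm.map _ ?_)
  refine (List.perm_ext_iff_of_nodup h (List.nodup_ofFn.2 f.injective)).2 fun a => ?_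
  have : a ∈ Set.range f ↔ a ∈ (s : Set ι) := by rw [Finset.range_orderEmbOfFin]
  rw [List.mem_ofFn, ← Set.mem_range, this]
  rfl

/-! ### Forests and bases of `B(I)` and `Bess(I)` -/

variable {I J : Type}

/-- Every tree has a leaf, so a repeated tree would repeat a label. -/
theorem nodup_of_bind_leaves {s : Multiset (Tree I)} (h : (s.bind Tree.leaves).Nodup) :
    s.Nodup := by
  induction s using Multiset.induction_on with
  | empty => exact Multiset.nodup_zero
  | cons t s ih =>
    rw [Multiset.cons_bind, Multiset.nodup_add] at h
    refine Multiset.nodup_cons.2 ⟨fun ht => ?_, ih h.2.1⟩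
    obtain ⟨i, hi⟩ := Multiset.exists_mem_of_ne_zero t.leaves_ne_zero
    exact (Multiset.disjoint_left.1 h.2.2 hi) (Multiset.mem_bind.2 ⟨t, ht, hi⟩)

theorem IsForest.nodup {s : Multiset (Tree I)} (h : IsForest s) : s.Nodup :=
  nodup_of_bind_leaves h.2.1

/-- The forest underlying a root-oriented forest. -/
def IsForest.forest {s : Multiset (Tree I)} (h : IsForest s) : Forest I := ⟨⟨s, h.nodup⟩, h⟩

theorem orientedForest_perm {l l' : List (Tree I)} (h : IsForest (l : Multiset (Tree I)))
    (h' : IsForest (l' : Multiset (Tree I))) (e : (l : Multiset (Tree I)) = l') :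
    orientedForest l h = orientedForest l' h' ∨ orientedForest l h = -orientedForest l' h' := by
  rcases wedgeVec_perm ((Multiset.coe_eq_coe.1 e).map fun t => Finsupp.single t (1 : ℚ))
    with h | h
  · exact .inl (Subtype.ext h)
  · exact .inr (Subtype.ext h)

theorem orientedForest_span :
    Submodule.span ℚ {x : BSpace I | ∃ l h, x = orientedForest l h} = ⊤ := by
  refine Submodule.map_injective_of_injective (BSpace I).injective_subtype ?_
  rw [Submodule.map_span, Submodule.map_top, Submodule.range_subtype]
  change _ = Submodule.span ℚ _
  congr 1
  ext x
  constructor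
  · rintro ⟨_, ⟨l, h, rfl⟩, rfl⟩
    exact ⟨l, h, rfl⟩
  · rintro ⟨l, h, rfl⟩
    exact ⟨_, ⟨l, h, rfl⟩, rfl⟩

theorem bSpace_induction {P : BSpace I → Prop} (zero : P 0) (add : ∀ x y, P x → P y → P (x + y))
    (smul : ∀ (c : ℚ) x, P x → P (c • x)) (forest : ∀ l h, P (orientedForest l h))
    (x : BSpace I) : P x := by
  have hx : x ∈ Submodule.span ℚ {x : BSpace I | ∃ l h, x = orientedForest l h} := by
    rw [orientedForest_span]
    trivial
  induction hx using Submodule.span_induction with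
  | mem x hx =>
    obtain ⟨l, h, rfl⟩ := hx
    exact forest l h
  | zero => exact zero
  | add x y _ _ hx hy => exact add x y hx hy
  | smul c x _ hx => exact smul c x hx

/-- The root-oriented forest given by some order of the trees of a forest. -/
def someOriented (F : Forest I) : BSpace I :=
  orientedForest F.1.toList (by rw [Finset.coe_toList]; exact F.2)

/-- In the ambient exterior algebra these are signs times distinct members of the basis indexed by
finite sets of trees. -/
theorem someOriented_linearIndependent : LinearIndependent ℚ (someOriented (I := I)) := by
  obtain ⟨b, hb⟩ := exists_basis_exterior (Tree I)
  have hF : ∀ F : Forest I, ∃ u : ℚˣ, (someOriented F : ExteriorAlgebra ℚ (TreeVec I))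
      = u • b F.1 := by
    intro F
    have e : (⟨(F.1.toList : Multiset (Tree I)), F.1.nodup_toList⟩ : Finset (Tree I)) = F.1 := by
      ext t
      simp
    rcases hb F.1.toList F.1.nodup_toList with h | h
    · exact ⟨1, by rw [one_smul, ← e]; exact h⟩
    · refine ⟨-1, ?_⟩
      rw [Units.neg_smul, one_smul, ← e]
      exact h
  choose u hu using hF
  have h₁ : LinearIndependent ℚ fun F : Forest I => b F.1 :=
    b.linearIndependent.comp _ Subtype.val_injective
  have h₂ := h₁.units_smul u
  refine LinearIndependent.of_comp (BSpace I).subtype ?_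
  convert h₂ using 1
  funext F
  exact hu F

theorem someOriented_span : ⊤ ≤ Submodule.span ℚ (Set.range (someOriented (I := I))) := by
  rw [← orientedForest_span, Submodule.span_le]
  rintro _ ⟨l, h, rfl⟩
  have hF : someOriented h.forest ∈ Submodule.span ℚ (Set.range (someOriented (I := I))) :=
    Submodule.subset_span ⟨_, rfl⟩
  have e : (l : Multiset (Tree I)) = (h.forest.1.toList : Multiset (Tree I)) := by
    rw [Finset.coe_toList]
    rfl
  rcases orientedForest_perm h (e ▸ h) e with h' | h'
  · rw [h']
    exact hF
  · rw [h']
    exact Submodule.neg_mem _ hF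

theorem orient_ne_zero [Finite I] (k : List I) (hk : k.length = Nat.card I) (h : k.Nodup) :
    orient k hk ≠ 0 := by
  obtain ⟨b, hb⟩ := exists_basis_exterior I
  intro h0
  have h0' : wedgeVec (k.map fun i => Finsupp.single i (1 : ℚ)) = 0 := congrArg Subtype.val h0
  have hne := b.ne_zero ⟨(k : Multiset I), h⟩
  rcases hb k h with h' | h'
  · exact hne (h' ▸ h0')
  · exact hne (neg_eq_zero.1 (h' ▸ h0'))

theorem finrank_detSpace (I : Type) [Finite I] : Module.finrank ℚ (DetSpace I) = 1 := by
  have := Fintype.ofFinite I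
  rw [exteriorPower.finrank_eq, Module.finrank_finsupp_self, Nat.card_eq_fintype_card,
    Nat.choose_self]

theorem exists_enumeration (I : Type) [Finite I] : ∃ k : List I, k.Nodup ∧ ∀ i, i ∈ k := by
  have := Fintype.ofFinite I
  exact ⟨Finset.univ.toList, Finset.nodup_toList _, by simp⟩

theorem length_of_enumeration [Finite I] {k : List I} (hk : k.Nodup) (h : ∀ i, i ∈ k) :
    k.length = Nat.card I := by
  classical
  have := Fintype.ofFinite I
  have e : k.toFinset = Finset.univ := Finset.eq_univ_of_forall fun i => List.mem_toFinset.2 (h i)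
  rw [Nat.card_eq_fintype_card, ← List.toFinset_card_of_nodup hk, e, Finset.card_univ]

theorem det_eq_smul [Finite I] {o : DetSpace I} (ho : o ≠ 0) (o' : DetSpace I) :
    ∃ c : ℚ, c • o = o' :=
  (finrank_eq_one_iff_of_nonzero' o ho).1 (finrank_detSpace I) o'

/-- A family with one oriented forest for each forest is a basis. -/
theorem exists_basis_bess (I : Type) [Finite I] (v : Forest I → DetSpace I ⊗[ℚ] BSpace I)
    (hv : ∀ F, ∃ (o : DetSpace I) (l : List (Tree I)) (h : IsForest (l : Multiset (Tree I))),
      o ≠ 0 ∧ (l : Multiset (Tree I)) = F.1.val ∧ v F = o ⊗ₜ[ℚ] orientedForest l h) :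
    ∃ b : Module.Basis (Forest I) ℚ (DetSpace I ⊗[ℚ] BSpace I), ∀ F, b F = v F := by
  obtain ⟨k, hk, hk'⟩ := exists_enumeration I
  set o₀ : DetSpace I := orient k (length_of_enumeration hk hk') with ho₀
  have hne : o₀ ≠ 0 := orient_ne_zero k _ hk
  let bD : Module.Basis Unit ℚ (DetSpace I) :=
    FiniteDimensional.basisSingleton Unit (finrank_detSpace I) o₀ hne
  let bB : Module.Basis (Forest I) ℚ (BSpace I) :=
    Module.Basis.mk someOriented_linearIndependent someOriented_span
  let b : Module.Basis (Forest I) ℚ (DetSpace I ⊗[ℚ] BSpace I) :=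
    (bD.tensorProduct bB).reindex (Equiv.punitProd (Forest I))
  have hb : ∀ F, b F = o₀ ⊗ₜ[ℚ] someOriented F := by
    intro F
    have h : b F = bD () ⊗ₜ[ℚ] bB F := by
      rw [Module.Basis.reindex_apply]
      exact Module.Basis.tensorProduct_apply _ _ _ _
    rw [h, FiniteDimensional.basisSingleton_apply, Module.Basis.mk_apply]
  -- The given family is a rescaling of the reference basis: `Det(I)` is a line, and two orders of
  -- the roots of a forest differ by a sign.
  have hu : ∀ F, ∃ u : ℚˣ, v F = (u : ℚ) • b F := by
    intro F
    obtain ⟨o, l, h, ho, hl, e⟩ := hv F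
    obtain ⟨c, hc⟩ := det_eq_smul hne o
    have hc0 : c ≠ 0 := by
      rintro rfl
      exact ho (by rw [← hc, zero_smul])
    have hl' : (l : Multiset (Tree I)) = (F.1.toList : Multiset (Tree I)) := by
      rw [Finset.coe_toList]
      exact hl
    rw [e, hb, ← hc]
    rcases orientedForest_perm h (hl' ▸ h) hl' with h' | h'
    · refine ⟨Units.mk0 c hc0, ?_⟩
      rw [h', Units.val_mk0, TensorProduct.smul_tmul']
      rfl
    · refine ⟨-Units.mk0 c hc0, ?_⟩
      have e' : ∀ s : BSpace I, (c • o₀) ⊗ₜ[ℚ] (-s) = (-c) • (o₀ ⊗ₜ[ℚ] s) := fun s => by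
        rw [TensorProduct.tmul_neg, TensorProduct.smul_tmul', neg_smul, TensorProduct.neg_tmul]
      rw [h']
      exact e' _
  choose u hu using hu
  exact ⟨b.unitsSMul u, fun F => by
    rw [Module.Basis.unitsSMul_apply, hu]
    rfl⟩

theorem isInternal_of_basis {ι M : Type*} [AddCommGroup M] [Module ℚ M] (b : Module.Basis ι ℚ M)
    (d : ι → ℤ) (A : ℤ → Submodule ℚ M) (hA : ∀ n, A n = Submodule.span ℚ (b '' {i | d i = n})) :
    DirectSum.IsInternal A := by
  rw [DirectSum.isInternal_submodule_iff_iSupIndep_and_iSup_eq_top]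
  constructor
  · intro n
    have h : ⨆ (m) (_ : m ≠ n), A m ≤ Submodule.span ℚ (b '' {i | d i ≠ n}) := by
      refine iSup₂_le fun m hm => ?_
      rw [hA]
      refine Submodule.span_mono (Set.image_mono fun i hi => ?_)
      exact fun h => hm (hi.symm.trans h)
    refine Disjoint.mono_right h ?_
    rw [hA]
    refine b.linearIndependent.disjoint_span_image ?_
    rw [Set.disjoint_left]
    exact fun i hi hi' => hi' hi
  · rw [eq_top_iff, ← b.span_eq, Submodule.span_le]
    rintro _ ⟨i, rfl⟩
    refine Submodule.mem_iSup_of_mem (d i) ?_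
    rw [hA]
    exact Submodule.subset_span ⟨i, rfl, rfl⟩

end Bases

end Bessel
end

noncomputable section

namespace Bessel

/-! ### The laws of `Det` and `B` -/

section Laws

variable {I J K I' J' : Type}

theorem stars_eq_one {X : Multiset (Option I)} (hn : X.Nodup) (hm : none ∈ X) : stars X = 1 := by
  classical
  rw [stars, ← Multiset.count_eq_one_of_mem hn hm, Multiset.count]
  refine Multiset.countP_congr rfl fun o _ => ?_
  cases o <;> simp

theorem subst_unit_of_nodup (l : List (Tree (Option I)))
    (hn : ((l : Multiset (Tree (Option I))).bind Tree.leaves).Nodup)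
    (hm : none ∈ (l : Multiset (Tree (Option I))).bind Tree.leaves) :
    subst (wedgeTrees l) (ExteriorAlgebra.ι ℚ (leafVec PUnit.unit.{1}))
      = relabel (Equiv.optionEquivSumPUnit I) (wedgeTrees l) :=
  (subst_unit l).2 (stars_eq_one hn hm)

theorem Tree.leaves_leaf (i : I) : (Tree.leaf i).leaves = {i} := rfl

theorem Tree.leaf_injective : Function.Injective (Tree.leaf : I → Tree I) := fun i j h => by
  simpa [Tree.leaves_leaf] using congrArg Tree.leaves h

/-- The embedding of the exterior algebra on `I` into the exterior algebra on trees. -/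
abbrev leafLift (I : Type) : ExteriorAlgebra ℚ (Vec I) →ₐ[ℚ] ExteriorAlgebra ℚ (TreeVec I) :=
  ExteriorAlgebra.map (Finsupp.lmapDomain ℚ ℚ Tree.leaf)

/-- Identities in `Det` may therefore be tested on exterior products of trees. -/
theorem leafLift_injective : Function.Injective (leafLift I) :=
  ExteriorAlgebra.map_injective_field
    (LinearMap.ker_eq_bot.2 (Finsupp.mapDomain_injective Tree.leaf_injective))

theorem leafLift_map (f : I → J) (x : ExteriorAlgebra ℚ (Vec I)) :
    leafLift J (ExteriorAlgebra.map (Finsupp.lmapDomain ℚ ℚ f) x) = relabel f (leafLift I x) := by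
  rw [relabel, leafLift, leafLift, ← AlgHom.comp_apply, ← AlgHom.comp_apply,
    ExteriorAlgebra.map_comp_map, ExteriorAlgebra.map_comp_map, ← Finsupp.lmapDomain_comp,
    ← Finsupp.lmapDomain_comp]
  rfl

/-- On one-leaf trees the maps `forgetB` and `insertB` restrict to those defining the composition of
`Det`, so the laws of `Det` follow from the laws of `subst`. -/
theorem leafLift_expand (x : ExteriorAlgebra ℚ (Vec (Option I))) (y : ExteriorAlgebra ℚ (Vec J)) :
    leafLift (I ⊕ J) (expand (detForget I J) (detInsert I J y) x)
      = subst (leafLift _ x) (leafLift _ y) := by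
  rw [subst, leafLift, map_expand, leafLift, expand_map]
  congr 2
  · refine Finsupp.lhom_ext' fun o => LinearMap.ext_ring ?_
    cases o with
    | none => simpa [detForget] using forgetB_leaf_none.symm
    | some i => simpa [detForget] using (forgetB_leaf_some i).symm
  · refine Finsupp.lhom_ext' fun o => LinearMap.ext_ring ?_
    cases o with
    | none =>
      have h := insertB_leaf_none (I := I) (leafLift J y)
      rw [← leafLift_map] at h
      simpa [detInsert] using h.symm
    | some i => simpa [detInsert] using (insertB_leaf_some (leafLift J y) i).symm

theorem leafLift_orient [Finite I] (k : List I) (h : k.length = Nat.card I) :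
    leafLift I (orient k h).1 = wedgeTrees (k.map Tree.leaf) := by
  simp [orient, wedgeTrees, wedgeVec, map_list_prod, Function.comp_def]

theorem leafLift_mem [Finite I] (o : DetSpace I) : leafLift I o.1 ∈
    (⋀[ℚ]^(Nat.card I) (TreeVec I) : Submodule ℚ (ExteriorAlgebra ℚ (TreeVec I))) :=
  map_mem_exteriorPower _ _ o.2

theorem bind_leaves_leaf (k : List I) :
    ((k.map Tree.leaf : List (Tree I)) : Multiset (Tree I)).bind Tree.leaves = k := by
  rw [← Multiset.map_coe, Multiset.bind_map]
  simp only [Tree.leaves_leaf]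
  rw [Multiset.bind_singleton, Multiset.map_id']

/-- An element of the determinant is a multiple of the product of all points, in which `⋆` occurs
exactly once. -/
theorem leafLift_unit [Finite I] (o : DetSpace (Option I)) :
    subst (leafLift _ o.1) (ExteriorAlgebra.ι ℚ (leafVec PUnit.unit.{1}))
      = relabel (Equiv.optionEquivSumPUnit I) (leafLift _ o.1) := by
  obtain ⟨k, hk, hk'⟩ := exists_enumeration (Option I)
  obtain ⟨c, rfl⟩ := det_eq_smul (orient_ne_zero k (length_of_enumeration hk hk') hk) o
  have h := subst_unit_of_nodup (k.map Tree.leaf) (by rw [bind_leaves_leaf]; exact hk)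
    (by rw [bind_leaves_leaf]; exact hk' none)
  rw [Submodule.coe_smul, map_smul, map_smul, leafLift_orient, ← h, subst, map_smul, subst]

/-! ### The laws of `Det` -/

section Det

variable [Finite I] [Finite J] [Finite K] [Finite I'] [Finite J']

theorem det_ext {o o' : DetSpace I} (h : leafLift I o.1 = leafLift I o'.1) : o = o' :=
  Subtype.ext (leafLift_injective h)

theorem leafLift_detMap (e : I ≃ J) (o : DetSpace I) :
    leafLift J (detMap e o).1 = relabel e (leafLift I o.1) :=
  leafLift_map e o.1

theorem leafLift_detComp (o : DetSpace (Option I)) (o' : DetSpace J) :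
    leafLift (I ⊕ J) (detComp I J o o').1 = subst (leafLift _ o.1) (leafLift _ o'.1) :=
  leafLift_expand o.1 o'.1

/-- The unit of `Det`. -/
def detOne : DetSpace PUnit.{1} := Det.one

theorem leafLift_detOne : leafLift PUnit.{1} detOne.1
    = ExteriorAlgebra.ι ℚ (leafVec PUnit.unit.{1}) := by
  have h : leafLift PUnit.{1} detOne.1 = _ :=
    leafLift_orient [PUnit.unit] (by simp)
  rw [h]
  simp [wedgeTrees, wedgeVec]

theorem detMap_refl (o : DetSpace I) : detMap (Equiv.refl I) o = o :=
  det_ext (by rw [leafLift_detMap]; exact relabel_id _)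

theorem detMap_detMap (e : I ≃ J) (f : J ≃ K) (o : DetSpace I) :
    detMap f (detMap e o) = detMap (e.trans f) o :=
  det_ext (by rw [leafLift_detMap, leafLift_detMap, leafLift_detMap, relabel_relabel]; rfl)

theorem detComp_detMap (e : I ≃ I') (f : J ≃ J') (o : DetSpace (Option I)) (o' : DetSpace J) :
    detComp I' J' (detMap (Equiv.optionCongr e) o) (detMap f o')
      = detMap (Equiv.sumCongr e f) (detComp I J o o') :=
  det_ext (by
    rw [leafLift_detComp, leafLift_detMap, leafLift_detMap, leafLift_detMap, leafLift_detComp]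
    exact subst_relabel e f _ _)

theorem detComp_one (o : DetSpace (Option I)) :
    detComp I PUnit.{1} o detOne = detMap (Equiv.optionEquivSumPUnit I) o :=
  det_ext (by rw [leafLift_detComp, leafLift_detMap, leafLift_detOne, leafLift_unit])

theorem detComp_one_left (o : DetSpace J) : detMap (Equiv.emptySum Empty J)
    (detComp Empty J (detMap (Equiv.ofUnique PUnit.{1} (Option Empty)) detOne) o) = o :=
  det_ext (by
    rw [leafLift_detMap, leafLift_detComp, leafLift_detMap, leafLift_detOne,
      ExteriorAlgebra.map_apply_ι, treeMap_leafVec]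
    exact (congrArg _ (subst_ι_leaf _)).trans ((relabel_relabel _ _ _).trans (relabel_id _)))

theorem detComp_nested (o : DetSpace (Option I)) (o' : DetSpace (Option J)) (o'' : DetSpace K) :
    detComp I (J ⊕ K) o (detComp J K o' o'') = detMap (Equiv.sumAssoc I J K)
      (detComp (I ⊕ J) K (detMap (starRight I J) (detComp I (Option J) o o')) o'') :=
  det_ext (by
    rw [leafLift_detMap, leafLift_detComp, leafLift_detComp, leafLift_detComp, leafLift_detMap,
      leafLift_detComp, subst_subst_nested])

theorem detComp_parallel (o : DetSpace (Option (Option I))) (o' : DetSpace J) (o'' : DetSpace K) :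
    detComp (I ⊕ J) K (detMap (starLeft I J) (detComp (Option I) J o o')) o''
      = (-1 : ℚ) ^ ((Nat.card J + 1) * (Nat.card K + 1)) • detMap (swapRight I J K)
        (detComp (I ⊕ K) J (detMap (starLeft I K)
          (detComp (Option I) K (detMap (swapStars I) o) o'')) o') :=
  det_ext (by
    rw [Submodule.coe_smul, map_smul, leafLift_detMap, leafLift_detComp, leafLift_detMap,
      leafLift_detComp, leafLift_detComp, leafLift_detMap, leafLift_detComp, leafLift_detMap]
    exact subst_subst_parallel _ _ _ (leafLift_mem o') (leafLift_mem o''))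

end Det

/-! ### The laws of `B` -/

theorem coe_bMap (e : I ≃ J) (x : BSpace I) : (bMap e x).1 = relabel e x.1 := rfl

theorem coe_bComp (x : BSpace (Option I)) (y : BSpace J) : (bComp I J x y).1 = subst x.1 y.1 := rfl

/-- The unit of `B`. -/
def bOne : BSpace PUnit.{1} := B.one

theorem coe_bOne : bOne.1 = ExteriorAlgebra.ι ℚ (leafVec PUnit.unit.{1}) := by
  have h : bOne.1 = wedgeTrees [Tree.leaf PUnit.unit.{1}] := rfl
  rw [h]
  simp [wedgeTrees, wedgeVec]

theorem bMap_refl (x : BSpace I) : bMap (Equiv.refl I) x = x := Subtype.ext (relabel_id _)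

theorem bMap_bMap (e : I ≃ J) (f : J ≃ K) (x : BSpace I) :
    bMap f (bMap e x) = bMap (e.trans f) x := Subtype.ext (relabel_relabel _ _ _)

theorem bComp_bMap (e : I ≃ I') (f : J ≃ J') (x : BSpace (Option I)) (y : BSpace J) :
    bComp I' J' (bMap (Equiv.optionCongr e) x) (bMap f y)
      = bMap (Equiv.sumCongr e f) (bComp I J x y) := Subtype.ext (subst_relabel e f _ _)

/-- Unlike the other laws, this one fails on the whole exterior algebra. It is checked on forests,
which contain `⋆` exactly once. -/
theorem bComp_one (x : BSpace (Option I)) :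
    bComp I PUnit.{1} x bOne = bMap (Equiv.optionEquivSumPUnit I) x := by
  induction x using bSpace_induction with
  | zero => rw [map_zero, map_zero, LinearMap.zero_apply]
  | add x y hx hy => rw [map_add, map_add, LinearMap.add_apply, hx, hy]
  | smul c x hx => rw [map_smul, map_smul, LinearMap.smul_apply, hx]
  | forest l h =>
    refine Subtype.ext ?_
    rw [coe_bComp, coe_bOne]
    exact subst_unit_of_nodup l h.2.1 (h.2.2 none)

theorem bComp_one_left (x : BSpace J) : bMap (Equiv.emptySum Empty J)
    (bComp Empty J (bMap (Equiv.ofUnique PUnit.{1} (Option Empty)) bOne) x) = x :=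
  Subtype.ext (by
    rw [coe_bMap, coe_bComp, coe_bMap, coe_bOne, ExteriorAlgebra.map_apply_ι, treeMap_leafVec]
    exact (congrArg _ (subst_ι_leaf _)).trans ((relabel_relabel _ _ _).trans (relabel_id _)))

theorem bComp_nested (x : BSpace (Option I)) (y : BSpace (Option J)) (z : BSpace K) :
    bComp I (J ⊕ K) x (bComp J K y z) = bMap (Equiv.sumAssoc I J K)
      (bComp (I ⊕ J) K (bMap (starRight I J) (bComp I (Option J) x y)) z) :=
  Subtype.ext (subst_subst_nested _ _ _)

theorem bComp_parallel {r s : ℕ} (x : BSpace (Option (Option I))) (y : BSpace J) (z : BSpace K)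
    (hy : y.1 ∈ (⋀[ℚ]^r (TreeVec J) : Submodule ℚ (ExteriorAlgebra ℚ (TreeVec J))))
    (hz : z.1 ∈ (⋀[ℚ]^s (TreeVec K) : Submodule ℚ (ExteriorAlgebra ℚ (TreeVec K)))) :
    bComp (I ⊕ J) K (bMap (starLeft I J) (bComp (Option I) J x y)) z
      = (-1 : ℚ) ^ ((r + 1) * (s + 1)) • bMap (swapRight I J K)
        (bComp (I ⊕ K) J (bMap (starLeft I K)
          (bComp (Option I) K (bMap (swapStars I) x) z)) y) :=
  Subtype.ext (subst_subst_parallel _ _ _ hy hz)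

/-! The sign operator of `B`. -/

theorem coe_bSign (x : BSpace I) : (bSign I x).1 = -inv x.1 := rfl

theorem bSign_bSign (x : BSpace I) : bSign I (bSign I x) = x :=
  Subtype.ext (by rw [coe_bSign, coe_bSign, map_neg, inv_inv, neg_neg])

theorem bSign_bMap (e : I ≃ J) (x : BSpace I) : bSign J (bMap e x) = bMap e (bSign I x) :=
  Subtype.ext (by rw [coe_bSign, coe_bMap, coe_bMap, coe_bSign, map_neg, map_inv])

theorem bSign_of_mem {r : ℕ} (x : BSpace I)
    (hx : x.1 ∈ (⋀[ℚ]^r (TreeVec I) : Submodule ℚ (ExteriorAlgebra ℚ (TreeVec I)))) :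
    bSign I x = (-1 : ℚ) ^ (r + 1) • x :=
  Subtype.ext (by
    rw [coe_bSign, inv_of_mem hx, Submodule.coe_smul, pow_succ, mul_neg_one, neg_smul])

theorem orientedForest_mem (l : List (Tree I)) (h : IsForest (l : Multiset (Tree I))) :
    (orientedForest l h).1 ∈
      (⋀[ℚ]^l.length (TreeVec I) : Submodule ℚ (ExteriorAlgebra ℚ (TreeVec I))) :=
  wedgeTrees_mem l

/-- The degree, one less than the number of trees, is additive under composition, so the sign
attached to it is multiplicative. -/
theorem bSign_bComp (x : BSpace (Option I)) (y : BSpace J) :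
    bSign (I ⊕ J) (bComp I J x y) = bComp I J (bSign (Option I) x) (bSign J y) := by
  induction y using bSpace_induction with
  | zero => simp only [map_zero]
  | add y z hy hz => simp only [map_add, hy, hz]
  | smul c y hy => simp only [map_smul, hy]
  | forest l h =>
    have hl := orientedForest_mem l h
    rw [bSign_of_mem _ hl, map_smul]
    refine Subtype.ext ?_
    rw [Submodule.coe_smul, coe_bSign, coe_bComp, coe_bComp, coe_bSign, subst, subst, map_neg,
      smul_neg, inv_expand _ _ (insertB_mem _ hl)]

theorem bSign_pow_bMap (n : ℕ) (e : I ≃ J) (x : BSpace I) :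
    (bSign J ^ n) (bMap e x) = bMap e ((bSign I ^ n) x) := by
  induction n with
  | zero => rfl
  | succ n ih => rw [pow_succ', Module.End.mul_apply, ih, bSign_bMap, pow_succ',
      Module.End.mul_apply]

theorem bSign_pow_bComp (n : ℕ) (x : BSpace (Option I)) (y : BSpace J) :
    (bSign (I ⊕ J) ^ n) (bComp I J x y)
      = bComp I J ((bSign (Option I) ^ n) x) ((bSign J ^ n) y) := by
  induction n with
  | zero => rfl
  | succ n ih => simp only [pow_succ', Module.End.mul_apply, ih, bSign_bComp]

theorem bSign_pow_of_mem {r : ℕ} (n : ℕ) (x : BSpace I)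
    (hx : x.1 ∈ (⋀[ℚ]^r (TreeVec I) : Submodule ℚ (ExteriorAlgebra ℚ (TreeVec I)))) :
    (bSign I ^ n) x = (-1 : ℚ) ^ ((r + 1) * n) • x := by
  induction n with
  | zero => simp
  | succ n ih =>
    rw [pow_succ', Module.End.mul_apply, ih, map_smul, bSign_of_mem x hx, smul_smul, ← pow_add]
    rfl

theorem bSign_pow_sq (n : ℕ) (x : BSpace I) : (bSign I ^ (n + 2)) x = (bSign I ^ n) x := by
  rw [pow_add, Module.End.mul_apply, pow_two, Module.End.mul_apply, bSign_bSign]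

/-! Degrees. -/

theorem Tree.vertices_mul (s t : Tree I) : (s * t).vertices = s.vertices + t.vertices + 1 := by
  induction s, t using Con.induction_on₂ with
  | H a b => rfl

theorem Tree.card_leaves (t : Tree I) : t.leaves.card = t.vertices + 1 := by
  induction t using Tree.induction with
  | leaf i => rfl
  | mul s t hs ht => rw [Tree.leaves_mul, Multiset.card_add, hs, ht, Tree.vertices_mul]; omega

theorem card_bind_leaves (s : Multiset (Tree I)) :
    (s.bind Tree.leaves).card = forestVertices s + s.card := by
  induction s using Multiset.induction_on with
  | empty => rfl
  | cons t s ih =>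
    rw [Multiset.cons_bind, Multiset.card_add, ih, Tree.card_leaves, Multiset.card_cons,
      forestVertices, forestVertices, Multiset.map_cons, Multiset.sum_cons]
    omega

/-- A binary tree has one more leaf than inner vertices. This translates the grading of `Bess` by
vertices into the exterior degree. -/
theorem IsForest.vertices_add_card [Finite I] {s : Multiset (Tree I)} (h : IsForest s) :
    forestVertices s + s.card = Nat.card I := by
  rw [← card_bind_leaves]
  obtain ⟨-, hn, hm⟩ := h
  generalize s.bind Tree.leaves = X at hn hm
  induction X using Quotient.inductionOn with
  | h k => exact length_of_enumeration hn hm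

end Laws

end Bessel
end

noncomputable section

namespace Bessel

/-! ### `Bess` is an operad -/

section BessOperad

variable {I J K I' J' : Type} [Finite I] [Finite J] [Finite K] [Finite I'] [Finite J']

theorem negOnePow_smul {M : Type*} [AddCommGroup M] [Module ℚ M] (n : ℤ) (m : ℕ)
    (h : Even (n - m)) (x : M) : n.negOnePow • x = (-1 : ℚ) ^ m • x := by
  have e : n.negOnePow = (m : ℤ).negOnePow := (Int.negOnePow_eq_iff n m).2 h
  rw [e, Int.negOnePow_def, zpow_natCast, Units.smul_def, Units.val_pow_eq_pow_val, Units.val_neg,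
    Units.val_one, ← Int.cast_smul_eq_zsmul ℚ]
  push_cast
  rfl

/-- The underlying space of `Bess`. -/
abbrev BessSpace (I : Type) [Finite I] : Type := DetSpace I ⊗[ℚ] BSpace I

theorem bess_map_tmul (e : I ≃ J) (o : DetSpace I) (x : BSpace I) :
    Bess.map e (o ⊗ₜ[ℚ] x : BessSpace I) = (detMap e o ⊗ₜ[ℚ] bMap e x : BessSpace J) := rfl

theorem bess_comp_tmul (o : DetSpace (Option I)) (x : BSpace (Option I)) (o' : DetSpace J)
    (y : BSpace J) :
    Bess.comp (o ⊗ₜ[ℚ] x : BessSpace (Option I)) (o' ⊗ₜ[ℚ] y : BessSpace J)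
      = (detComp I J o o' ⊗ₜ[ℚ] bComp I J ((bSign (Option I) ^ (Nat.card J + 1)) x) y :
        BessSpace (I ⊕ J)) := rfl

theorem bess_one : Bess.one = (detOne ⊗ₜ[ℚ] bOne : BessSpace PUnit.{1}) := rfl

theorem bess_induction {P : Bess.obj I → Prop} (zero : P 0) (add : ∀ x y, P x → P y → P (x + y))
    (tmul : ∀ (o : DetSpace I) (x : BSpace I), P (o ⊗ₜ[ℚ] x : BessSpace I)) (x : Bess.obj I) :
    P x :=
  TensorProduct.induction_on (motive := P) x zero tmul add

/-- The homogeneous components of `Bess`. -/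
def bessDeg (I : Type) [Finite I] (n : ℤ) : Submodule ℚ (BessSpace I) :=
  Submodule.span ℚ {x | ∃ (o : DetSpace I) (l : List (Tree I))
    (h : IsForest (l : Multiset (Tree I))),
    (forestVertices (l : Multiset (Tree I)) : ℤ) = n ∧ x = o ⊗ₜ[ℚ] orientedForest l h}

-- Write the element as a combination of forests and project to exterior degree `r`: forests with
-- another number of trees are sent to `0`, and the element itself is unchanged.
omit [Finite I] in
theorem exists_forest_sum {r : ℕ} (x : BSpace I)
    (hx : x.1 ∈ (⋀[ℚ]^r (TreeVec I) : Submodule ℚ (ExteriorAlgebra ℚ (TreeVec I)))) :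
    x.1 ∈ Submodule.span ℚ {z | ∃ l : List (Tree I), IsForest (l : Multiset (Tree I)) ∧
      l.length = r ∧ z = wedgeTrees l} := by
  let 𝒜 : ℕ → Submodule ℚ (ExteriorAlgebra ℚ (TreeVec I)) := fun n => ⋀[ℚ]^n (TreeVec I)
  let π := GradedRing.proj 𝒜 r
  have hπ : ∀ z ∈ BSpace I, (DirectSum.decompose 𝒜 z r : ExteriorAlgebra ℚ (TreeVec I)) ∈
      Submodule.span ℚ {z | ∃ l : List (Tree I), IsForest (l : Multiset (Tree I)) ∧
        l.length = r ∧ z = wedgeTrees l} := by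
    intro z hz
    rw [BSpace] at hz
    induction hz using Submodule.span_induction with
    | mem z hz =>
      obtain ⟨l, hl, rfl⟩ := hz
      by_cases h : l.length = r
      · rw [DirectSum.decompose_of_mem_same 𝒜 (h ▸ wedgeTrees_mem l)]
        exact Submodule.subset_span ⟨l, hl, h, rfl⟩
      · rw [DirectSum.decompose_of_mem_ne 𝒜 (wedgeTrees_mem l) h]
        exact Submodule.zero_mem _
    | zero => rw [DirectSum.decompose_zero]; exact Submodule.zero_mem _
    | add x y _ _ hx hy => rw [DirectSum.decompose_add]; exact Submodule.add_mem _ hx hy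
    | smul c x _ hx => rw [DirectSum.decompose_smul]; exact Submodule.smul_mem _ c hx
  have := hπ x.1 x.2
  rwa [DirectSum.decompose_of_mem_same 𝒜 hx] at this

/-- A criterion for homogeneity in `Bess` by exterior degree alone. It applies to relabellings and
compositions, whose expansions in forests are not explicit. -/
theorem tmul_mem_deg {r : ℕ} (n : ℤ) (hn : n + r = Nat.card I) (o : DetSpace I) (x : BSpace I)
    (hx : x.1 ∈ (⋀[ℚ]^r (TreeVec I) : Submodule ℚ (ExteriorAlgebra ℚ (TreeVec I)))) :
    o ⊗ₜ[ℚ] x ∈ bessDeg I n := by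
  have key : ∀ z ∈ Submodule.span ℚ {z | ∃ l : List (Tree I), IsForest (l : Multiset (Tree I)) ∧
      l.length = r ∧ z = wedgeTrees l}, ∃ hz : z ∈ BSpace I,
      o ⊗ₜ[ℚ] (⟨z, hz⟩ : BSpace I) ∈ bessDeg I n := by
    intro z hz
    induction hz using Submodule.span_induction with
    | mem z hz =>
      obtain ⟨l, hl, hr, rfl⟩ := hz
      refine ⟨(orientedForest l hl).2, Submodule.subset_span ⟨o, l, hl, ?_, rfl⟩⟩
      have := hl.vertices_add_card
      rw [Multiset.coe_card] at this
      omega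
    | zero =>
      refine ⟨Submodule.zero_mem _, ?_⟩
      have : (o ⊗ₜ[ℚ] (0 : BSpace I) : BessSpace I) = 0 := TensorProduct.tmul_zero _ _
      exact this ▸ Submodule.zero_mem _
    | add x y _ _ hx hy =>
      obtain ⟨hx, hx'⟩ := hx
      obtain ⟨hy, hy'⟩ := hy
      refine ⟨Submodule.add_mem _ hx hy, ?_⟩
      have : (o ⊗ₜ[ℚ] (⟨x, hx⟩ + ⟨y, hy⟩ : BSpace I) : BessSpace I) = _ := TensorProduct.tmul_add _ _ _
      exact this ▸ Submodule.add_mem _ hx' hy'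
    | smul c x _ hx =>
      obtain ⟨hx, hx'⟩ := hx
      refine ⟨Submodule.smul_mem _ c hx, ?_⟩
      have : (o ⊗ₜ[ℚ] (c • ⟨x, hx⟩ : BSpace I) : BessSpace I) = _ := TensorProduct.tmul_smul _ _ _
      exact this ▸ Submodule.smul_mem _ c hx'
  exact (key x.1 (exists_forest_sum x hx)).2

theorem bessDeg_induction {n : ℤ} {P : ∀ x : BessSpace I, x ∈ bessDeg I n → Prop}
    (zero : P 0 (Submodule.zero_mem _))
    (add : ∀ x y hx hy, P x hx → P y hy → P (x + y) (Submodule.add_mem _ hx hy))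
    (smul : ∀ (c : ℚ) x hx, P x hx → P (c • x) (Submodule.smul_mem _ c hx))
    (tmul : ∀ (o : DetSpace I) (l : List (Tree I)) (h : IsForest (l : Multiset (Tree I)))
      (x : BessSpace I) hx, x = o ⊗ₜ[ℚ] orientedForest l h → n + l.length = Nat.card I → P x hx)
    (x : BessSpace I) (hx : x ∈ bessDeg I n) : P x hx := by
  refine Submodule.span_induction (p := P) ?_ zero add smul hx
  rintro _ ⟨o, l, h, hn, rfl⟩
  refine tmul o l h _ _ rfl ?_
  have := h.vertices_add_card
  rw [Multiset.coe_card] at this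
  omega

theorem eq_negOnePow_smul {n : ℤ} {m : ℕ} (h : Even (n - m)) {x y : BessSpace I}
    (hxy : x = (-1 : ℚ) ^ m • y) : (show Bess.obj I from x) = n.negOnePow • (show Bess.obj I from y) :=
  Eq.trans hxy (negOnePow_smul (M := Bess.obj I) n m h y).symm

theorem bess_deg_induction {n : ℤ} {P : ∀ x : Bess.obj I, x ∈ Bess.deg I n → Prop}
    (zero : P 0 (Submodule.zero_mem _))
    (add : ∀ x y hx hy, P x hx → P y hy → P (x + y) (Submodule.add_mem _ hx hy))
    (smul : ∀ (c : ℚ) x hx, P x hx → P (c • x) (Submodule.smul_mem _ c hx))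
    (tmul : ∀ (o : DetSpace I) (l : List (Tree I)) (h : IsForest (l : Multiset (Tree I)))
      (x : Bess.obj I) hx, x = (o ⊗ₜ[ℚ] orientedForest l h : BessSpace I) → n + l.length = Nat.card I → P x hx)
    (x : Bess.obj I) (hx : x ∈ Bess.deg I n) : P x hx :=
  bessDeg_induction (P := P) zero add smul tmul x hx

theorem smul_tmul_neg (c : ℚ) (o : DetSpace I) (s : BSpace I) :
    (c • o) ⊗ₜ[ℚ] (-s) = (-c) • (o ⊗ₜ[ℚ] s) := by
  rw [TensorProduct.tmul_neg, TensorProduct.smul_tmul', neg_smul, TensorProduct.neg_tmul]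

theorem bessDeg_eq_span {o₀ : DetSpace I} (hne : o₀ ≠ 0) (n : ℤ) : bessDeg I n = Submodule.span ℚ
    ((fun F => o₀ ⊗ₜ[ℚ] someOriented F) '' {F | (forestVertices F.1.val : ℤ) = n}) := by
  refine le_antisymm (Submodule.span_le.2 ?_) (Submodule.span_le.2 ?_)
  · rintro _ ⟨o, l, h, hn, rfl⟩
    obtain ⟨c, rfl⟩ := det_eq_smul hne o
    have e : (l : Multiset (Tree I)) = (h.forest.1.toList : Multiset (Tree I)) := by
      rw [Finset.coe_toList]
      rfl
    have hF : o₀ ⊗ₜ[ℚ] someOriented h.forest ∈ Submodule.span ℚ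
        ((fun F => o₀ ⊗ₜ[ℚ] someOriented F) '' {F | (forestVertices F.1.val : ℤ) = n}) :=
      Submodule.subset_span ⟨_, hn, rfl⟩
    have hs : ∀ s : BSpace I, s = someOriented h.forest ∨ s = -someOriented h.forest →
        (c • o₀) ⊗ₜ[ℚ] s ∈ Submodule.span ℚ
        ((fun F => o₀ ⊗ₜ[ℚ] someOriented F) '' {F | (forestVertices F.1.val : ℤ) = n}) := by
      rintro s (rfl | rfl)
      · rw [← TensorProduct.smul_tmul']
        exact Submodule.smul_mem _ _ hF
      · rw [smul_tmul_neg]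
        exact Submodule.smul_mem _ _ hF
    exact hs _ (orientedForest_perm h (e ▸ h) e)
  · rintro _ ⟨F, hF, rfl⟩
    refine Submodule.subset_span ⟨_, _, _, ?_, rfl⟩
    rw [Finset.coe_toList]
    exact hF

theorem bessDeg_isInternal (I : Type) [Finite I] : DirectSum.IsInternal (bessDeg I) := by
  obtain ⟨k, hk, hk'⟩ := exists_enumeration I
  have hne := orient_ne_zero k (length_of_enumeration hk hk') hk
  generalize orient k (length_of_enumeration hk hk') = o at hne
  obtain ⟨b, hb⟩ := exists_basis_bess I (fun F => o ⊗ₜ[ℚ] someOriented F)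
    (fun F => ⟨_, _, _, hne, Finset.coe_toList _, rfl⟩)
  have hb' : ⇑b = fun F => o ⊗ₜ[ℚ] someOriented F := funext hb
  have h := fun n => bessDeg_eq_span hne n
  rw [← hb'] at h
  exact isInternal_of_basis (M := BessSpace I) b _ (bessDeg I) h

theorem bess_isInternal (I : Type) [Finite I] : DirectSum.IsInternal (Bess.deg I) :=
  bessDeg_isInternal I

theorem bess_map_mem (e : I ≃ J) (n : ℤ) (x : Bess.obj I) (hx : x ∈ Bess.deg I n) :
    Bess.map e x ∈ Bess.deg J n := by
  induction x, hx using bess_deg_induction with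
  | zero => rw [map_zero]; exact Submodule.zero_mem _
  | add x y _ _ hx hy => rw [map_add]; exact Submodule.add_mem _ hx hy
  | smul c x _ hx => rw [map_smul]; exact Submodule.smul_mem _ c hx
  | tmul o l h _ _ e' hn =>
    subst e'
    rw [bess_map_tmul]
    exact tmul_mem_deg n (by rw [hn, Nat.card_congr e]) _ _
      (map_mem_exteriorPower _ _ (orientedForest_mem l h))

theorem bess_comp_mem (m n : ℤ) (x : Bess.obj (Option I)) (y : Bess.obj J)
    (hx : x ∈ Bess.deg (Option I) m) (hy : y ∈ Bess.deg J n) :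
    Bess.comp x y ∈ Bess.deg (I ⊕ J) (m + n) := by
  induction x, hx using bess_deg_induction with
  | zero => rw [map_zero, LinearMap.zero_apply]; exact Submodule.zero_mem _
  | add x y _ _ hx hy => rw [map_add, LinearMap.add_apply]; exact Submodule.add_mem _ hx hy
  | smul c x _ hx => rw [map_smul, LinearMap.smul_apply]; exact Submodule.smul_mem _ c hx
  | tmul o l h _ _ e' hm =>
    subst e'
    induction y, hy using bess_deg_induction with
    | zero => rw [map_zero]; exact Submodule.zero_mem _
    | add x y _ _ hx hy => rw [map_add]; exact Submodule.add_mem _ hx hy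
    | smul c x _ hx => rw [map_smul]; exact Submodule.smul_mem _ c hx
    | tmul o' l' h' _ _ e' hn =>
      subst e'
      have hl := orientedForest_mem l h
      obtain ⟨r, hr⟩ : ∃ r, l.length = r + 1 := by
        refine Nat.exists_eq_succ_of_ne_zero fun h0 => h.1 ?_
        rw [List.eq_nil_of_length_eq_zero h0]
        rfl
      rw [hr] at hl
      rw [bess_comp_tmul, bSign_pow_of_mem _ _ hl]
      refine tmul_mem_deg (r := r + l'.length) _ ?_ _ _ (subst_mem _ _ (Submodule.smul_mem _ _ hl)
        (orientedForest_mem l' h'))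
      rw [Nat.card_sum]
      have := Finite.card_option (α := I)
      push_cast
      omega

/-- Four signs contribute: the parallel laws of `Det` and of `B`, and on each side the tensor
product sign for crossing the factor inserted first. Together they give the Koszul sign, because
`|J| + r` has the parity of the vertex degree `|J| - r`. -/
theorem bess_parallel_tmul {r s : ℕ} (o : DetSpace (Option (Option I)))
    (x : BSpace (Option (Option I))) (o' : DetSpace J) (o'' : DetSpace K) {y : BSpace J}
    {z : BSpace K} (hy : y.1 ∈ (⋀[ℚ]^r (TreeVec J) : Submodule ℚ (ExteriorAlgebra ℚ (TreeVec J))))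
    (hz : z.1 ∈ (⋀[ℚ]^s (TreeVec K) : Submodule ℚ (ExteriorAlgebra ℚ (TreeVec K)))) :
    detComp (I ⊕ J) K (detMap (starLeft I J) (detComp (Option I) J o o')) o''
      ⊗ₜ[ℚ] bComp (I ⊕ J) K ((bSign _ ^ (Nat.card K + 1)) (bMap (starLeft I J)
        (bComp (Option I) J ((bSign _ ^ (Nat.card J + 1)) x) y))) z
    = (-1 : ℚ) ^ ((Nat.card J + r + 2) * (Nat.card K + s + 2)) •
      (detMap (swapRight I J K) (detComp (I ⊕ K) J (detMap (starLeft I K)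
        (detComp (Option I) K (detMap (swapStars I) o) o'')) o')
      ⊗ₜ[ℚ] bMap (swapRight I J K) (bComp (I ⊕ K) J ((bSign _ ^ (Nat.card J + 1))
        (bMap (starLeft I K) (bComp (Option I) K ((bSign _ ^ (Nat.card K + 1))
          (bMap (swapStars I) x)) z))) y)) := by
  rw [bSign_pow_bMap, bSign_pow_bMap, bSign_pow_bMap, bSign_pow_bComp, bSign_pow_bComp,
    bSign_pow_of_mem _ _ hy, bSign_pow_of_mem _ _ hz, detComp_parallel,
    bSign_pow_bMap, ← Module.End.mul_apply (bSign _ ^ (Nat.card K + 1)),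
    ← Module.End.mul_apply (bSign _ ^ (Nat.card J + 1)), ← pow_add, ← pow_add,
    add_comm (Nat.card K + 1) (Nat.card J + 1)]
  simp only [map_smul, LinearMap.smul_apply]
  rw [bComp_parallel _ _ _ hy hz]
  simp only [TensorProduct.tmul_smul, ← TensorProduct.smul_tmul', smul_smul, ← pow_add]
  congr 1
  generalize Nat.card J = j
  generalize Nat.card K = k
  -- The expansion of `((j + 1) + (r + 1)) * ((k + 1) + (s + 1))` into the four contributions. The
  -- one from the other side of the equation occurs twice.
  have e : (j + r + 2) * (k + s + 2) + (s + 1) * (j + 1)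
      = ((r + 1) * (k + 1) + ((r + 1) * (s + 1) + (j + 1) * (k + 1)))
        + 2 * ((s + 1) * (j + 1)) := by ring
  rw [e, pow_add _ _ (2 * _), pow_mul, neg_one_sq, one_pow, mul_one, add_assoc]

theorem bess_comp_parallel (p q : ℤ) (x : Bess.obj (Option (Option I))) (y : Bess.obj J)
    (z : Bess.obj K) (hy : y ∈ Bess.deg J p) (hz : z ∈ Bess.deg K q) :
    Bess.comp (Bess.map (starLeft I J) (Bess.comp x y)) z
      = (p * q).negOnePow • Bess.map (swapRight I J K)
          (Bess.comp (Bess.map (starLeft I K) (Bess.comp (Bess.map (swapStars I) x) z)) y) := by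
  -- As a rational scalar, the sign passes through the linear maps in the inductions below.
  have hs : ∀ w : Bess.obj ((I ⊕ J) ⊕ K), (p * q).negOnePow • w
      = (-1 : ℚ) ^ (p * q).natAbs • w := fun w => negOnePow_smul _ _ (by
    rw [Int.even_sub, Int.even_coe_nat, Int.natAbs_even]) w
  rw [hs]
  induction y, hy using bess_deg_induction with
  | zero => simp only [map_zero, LinearMap.zero_apply, smul_zero]
  | add y y' _ _ hy hy' => simp only [map_add, LinearMap.add_apply, hy, hy', smul_add]
  | smul c y _ hy => simp only [map_smul, LinearMap.smul_apply, hy, smul_comm c]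
  | tmul o' l h y _ hy hp =>
  induction z, hz using bess_deg_induction with
  | zero => simp only [map_zero, LinearMap.zero_apply, smul_zero]
  | add y y' _ _ hy hy' => simp only [map_add, LinearMap.add_apply, hy, hy', smul_add]
  | smul c y _ hy => simp only [map_smul, LinearMap.smul_apply, hy, smul_comm c]
  | tmul o'' l' h' z _ hz hq =>
  induction x using bess_induction with
  | zero => simp only [map_zero, LinearMap.zero_apply, smul_zero]
  | add x x' hx hx' => simp only [map_add, LinearMap.add_apply, hx, hx', smul_add]
  | tmul o x =>
    subst hy hz
    rw [← hs]
    clear hs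
    have hl := orientedForest_mem l h
    have hl' := orientedForest_mem l' h'
    refine eq_negOnePow_smul ?_ (bess_parallel_tmul o x o' o'' hl hl')
    -- With `p = j - r` and `q = k - s`, this is half of `p * q - (j + r + 2) * (k + s + 2)`.
    refine ⟨-((Nat.card J : ℤ) * l'.length + l.length * Nat.card K + Nat.card J + l.length
      + Nat.card K + l'.length + 2), ?_⟩
    obtain rfl : p = Nat.card J - l.length := by omega
    obtain rfl : q = Nat.card K - l'.length := by omega
    push_cast
    ring

/-- On pure tensors each law is the tensor product of the laws of `Det` and `B`. What has to be
compared are the powers of the sign operator, which commutes with relabelling, is multiplicative,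
and has square one. -/
theorem bess_laws (I : Type) [Finite I] (x : Bess.obj I) (hx : LawDefect Bess I x) : x = 0 := by
  cases hx with
  | map_refl x =>
    rw [sub_eq_zero]
    induction x using bess_induction with
    | zero => rw [map_zero]
    | add x y hx hy => rw [map_add, hx, hy]
    | tmul o x => rw [bess_map_tmul, detMap_refl, bMap_refl]
  | map_trans e f x =>
    rw [sub_eq_zero]
    induction x using bess_induction with
    | zero => simp only [map_zero]
    | add x y hx hy => simp only [map_add, hx, hy]
    | tmul o x => rw [bess_map_tmul, bess_map_tmul, bess_map_tmul, detMap_detMap, bMap_bMap]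
  | comp_map e f x y =>
    rw [sub_eq_zero]
    induction x using bess_induction with
    | zero => simp only [map_zero, LinearMap.zero_apply]
    | add x y hx hy => simp only [map_add, LinearMap.add_apply, hx, hy]
    | tmul o x =>
    induction y using bess_induction with
    | zero => simp only [map_zero]
    | add x y hx hy => simp only [map_add, hx, hy]
    | tmul o' y =>
      rw [bess_map_tmul, bess_map_tmul, bess_comp_tmul, bess_comp_tmul, bess_map_tmul,
        bSign_pow_bMap, detComp_detMap, ← Nat.card_congr f, bComp_bMap]
  | comp_one x =>
    rw [sub_eq_zero]
    induction x using bess_induction with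
    | zero => simp only [map_zero, LinearMap.zero_apply]
    | add x y hx hy => simp only [map_add, LinearMap.add_apply, hx, hy]
    | tmul o x =>
      rw [bess_one, bess_comp_tmul, bess_map_tmul, detComp_one, bComp_one, Nat.card_unique,
        bSign_pow_sq 0]
      rfl
  | one_comp y =>
    rw [sub_eq_zero]
    induction y using bess_induction with
    | zero => simp only [map_zero]
    | add x y hx hy => simp only [map_add, hx, hy]
    | tmul o x =>
      have h1 : bOne.1 ∈ (⋀[ℚ]^1 (TreeVec PUnit.{1}) :
          Submodule ℚ (ExteriorAlgebra ℚ (TreeVec PUnit.{1}))) := by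
        rw [coe_bOne]
        exact ι_mem _
      rw [bess_one, bess_map_tmul, bess_comp_tmul, bess_map_tmul, bSign_pow_bMap,
        bSign_pow_of_mem _ _ h1, pow_mul, neg_one_sq, one_pow, one_smul, detComp_one_left,
        bComp_one_left]
  | @nested I J K _ _ _ x y z =>
    rw [sub_eq_zero]
    induction x using bess_induction with
    | zero => simp only [map_zero, LinearMap.zero_apply]
    | add x y hx hy => simp only [map_add, LinearMap.add_apply, hx, hy]
    | tmul o x =>
    induction y using bess_induction with
    | zero => simp only [map_zero, LinearMap.zero_apply]
    | add x y hx hy => simp only [map_add, LinearMap.add_apply, hx, hy]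
    | tmul o' y =>
    induction z using bess_induction with
    | zero => simp only [map_zero]
    | add x y hx hy => simp only [map_add, hx, hy]
    | tmul o'' z =>
      -- Inserting `y` and then `z` applies the sign operator to `x` as often, modulo 2, as
      -- inserting their composite.
      have e : Nat.card K + 1 + (Nat.card (Option J) + 1) = Nat.card (J ⊕ K) + 1 + 2 := by
        rw [Nat.card_sum, Finite.card_option]
        omega
      rw [bess_comp_tmul, bess_comp_tmul, bess_comp_tmul, bess_map_tmul, bess_comp_tmul,
        bess_map_tmul, detComp_nested, bComp_nested, bSign_pow_bMap, bSign_pow_bComp,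
        ← Module.End.mul_apply, ← pow_add, e, bSign_pow_sq]
  | parallel p q x y z hy hz =>
    rw [sub_eq_zero]
    exact bess_comp_parallel p q x y z hy hz

theorem bess_isOperad : IsOperad Bess where
  isInternal := bess_isInternal
  map_mem := bess_map_mem
  comp_mem := bess_comp_mem
  one_mem := by
    refine tmul_mem_deg (r := 1) 0 (by simp) detOne bOne ?_
    rw [coe_bOne]
    exact ι_mem _
  laws := bess_laws

end BessOperad

end Bessel
end

noncomputable section

namespace Bessel

/-! ### Morphisms of operad data, and quotients -/

universe u v

section Hom

/-- All laws of operads hold in `P`. -/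
def Lawful (P : OperadData.{u}) : Prop :=
  ∀ (I : Type) [Finite I] (x : P.obj I), LawDefect P I x → x = 0

/-- The structure of `P` respects degrees. -/
structure IsGraded (P : OperadData.{u}) : Prop where
  map_mem : ∀ {I J : Type} [Finite I] [Finite J] (e : I ≃ J) (n : ℤ) (x : P.obj I),
    x ∈ P.deg I n → P.map e x ∈ P.deg J n
  comp_mem : ∀ {I J : Type} [Finite I] [Finite J] (m n : ℤ) (x : P.obj (Option I)) (y : P.obj J),
    x ∈ P.deg (Option I) m → y ∈ P.deg J n → P.comp x y ∈ P.deg (I ⊕ J) (m + n)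
  one_mem : P.one ∈ P.deg PUnit 0

/-- Morphisms of operad data. -/
structure Hom (P : OperadData.{u}) (Q : OperadData.{v}) where
  app : ∀ (I : Type) [Finite I], P.obj I →ₗ[ℚ] Q.obj I
  app_mem : ∀ (I : Type) [Finite I] (n : ℤ) (x : P.obj I), x ∈ P.deg I n → app I x ∈ Q.deg I n
  app_map : ∀ {I J : Type} [Finite I] [Finite J] (e : I ≃ J) (x : P.obj I),
    app J (P.map e x) = Q.map e (app I x)
  app_comp : ∀ {I J : Type} [Finite I] [Finite J] (x : P.obj (Option I)) (y : P.obj J),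
    app (I ⊕ J) (P.comp x y) = Q.comp (app (Option I) x) (app J y)
  app_one : app PUnit P.one = Q.one

variable {P : OperadData.{u}} {Q : OperadData.{v}}

theorem negOnePow_smul_map {M N : Type*} [AddCommGroup M] [AddCommGroup N] [Module ℚ M]
    [Module ℚ N] (f : M →ₗ[ℚ] N) (n : ℤ) (x : M) : f (n.negOnePow • x) = n.negOnePow • f x := by
  rw [negOnePow_smul n n.natAbs (by rw [Int.even_sub, Int.even_coe_nat, Int.natAbs_even]),
    negOnePow_smul n n.natAbs (by rw [Int.even_sub, Int.even_coe_nat, Int.natAbs_even]), map_smul]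

theorem Hom.lawDefect (f : Hom P Q) {I : Type} [Finite I] {x : P.obj I} (hx : LawDefect P I x) :
    LawDefect Q I (f.app I x) := by
  cases hx with
  | map_refl x => rw [map_sub, f.app_map]; exact .map_refl _
  | map_trans e e' x => rw [map_sub, f.app_map, f.app_map, f.app_map]; exact .map_trans _ _ _
  | comp_map e e' x y =>
    rw [map_sub, f.app_comp, f.app_map, f.app_map, f.app_map, f.app_comp]
    exact .comp_map _ _ _ _
  | comp_one x => rw [map_sub, f.app_comp, f.app_map, f.app_one]; exact .comp_one _
  | one_comp y =>
    rw [map_sub, f.app_map, f.app_comp, f.app_map, f.app_one]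
    exact .one_comp _
  | nested x y z =>
    rw [map_sub, f.app_map, f.app_comp, f.app_comp, f.app_comp, f.app_map, f.app_comp]
    exact .nested _ _ _
  | parallel p q x y z hy hz =>
    rw [map_sub, negOnePow_smul_map, f.app_map, f.app_comp, f.app_comp, f.app_map, f.app_map,
      f.app_comp, f.app_comp, f.app_map]
    exact .parallel p q _ _ _ (f.app_mem _ _ _ hy) (f.app_mem _ _ _ hz)

theorem Hom.app_eq_zero (f : Hom P Q) {R : ∀ (I : Type) [Finite I], P.obj I → Prop}
    (hR : ∀ (I : Type) [Finite I] (x : P.obj I), R I x → f.app I x = 0) {I : Type} [Finite I]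
    {x : P.obj I} (hx : IdealMem P R I x) : f.app I x = 0 := by
  induction hx with
  | of x hx => exact hR _ x hx
  | zero => rw [map_zero]
  | sum x y _ _ hx hy => rw [map_add, hx, hy, add_zero]
  | smul c x _ hx => rw [map_smul, hx, smul_zero]
  | map e x _ hx => rw [f.app_map, hx, map_zero]
  | comp_left x y _ hx => rw [f.app_comp, hx, map_zero, LinearMap.zero_apply]
  | comp_right x y _ hy => rw [f.app_comp, hy, map_zero]

variable {R : ∀ (I : Type) [Finite I], P.obj I → Prop}

/-- The morphism induced on a quotient. -/
def Hom.lift (f : Hom P Q) (hR : ∀ (I : Type) [Finite I] (x : P.obj I), R I x → f.app I x = 0) :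
    Hom (quotient P R) Q where
  app I _ := (ideal P R I).liftQ (f.app I) fun _ hx => f.app_eq_zero hR hx
  app_mem I _ n x hx := by
    obtain ⟨x, hx, rfl⟩ := hx
    exact f.app_mem I n x hx
  app_map {I J} _ _ e x := by
    obtain ⟨x, rfl⟩ := (ideal P R I).mkQ_surjective x
    exact f.app_map e x
  app_comp {I J} _ _ x y := by
    obtain ⟨x, rfl⟩ := (ideal P R (Option I)).mkQ_surjective x
    obtain ⟨y, rfl⟩ := (ideal P R J).mkQ_surjective y
    exact f.app_comp x y
  app_one := f.app_one

/-- The projection to a quotient. -/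
def quotientMk (P : OperadData.{u}) (R : ∀ (I : Type) [Finite I], P.obj I → Prop) :
    Hom P (quotient P R) where
  app I _ := (ideal P R I).mkQ
  app_mem _ _ _ x hx := ⟨x, hx, rfl⟩
  app_map _ _ := rfl
  app_comp _ _ := rfl
  app_one := rfl

theorem quotientMk_surjective (I : Type) [Finite I] :
    Function.Surjective ((quotientMk P R).app I) :=
  (ideal P R I).mkQ_surjective

theorem quotientMk_eq_zero {I : Type} [Finite I] {x : P.obj I} (hx : IdealMem P R I x) :
    (quotientMk P R).app I x = 0 :=
  (Submodule.Quotient.mk_eq_zero (ideal P R I)).2 hx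

theorem quotient_isGraded (h : IsGraded P) : IsGraded (quotient P R) where
  map_mem e n x hx := by
    obtain ⟨x, hx, rfl⟩ := hx
    exact ⟨_, h.map_mem e n x hx, rfl⟩
  comp_mem m n x y hx hy := by
    obtain ⟨x, hx, rfl⟩ := hx
    obtain ⟨y, hy, rfl⟩ := hy
    exact ⟨_, h.comp_mem m n x y hx hy, rfl⟩
  one_mem := ⟨_, h.one_mem, rfl⟩

/-- The arguments of the law are lifted to `P`. In the parallel law the lifts must be homogeneous,
which is possible because the components of the quotient are images of components. -/
theorem exists_lawDefect {I : Type} [Finite I] {x : (quotient P R).obj I}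
    (hx : LawDefect (quotient P R) I x) :
    ∃ x', LawDefect P I x' ∧ (quotientMk P R).app I x' = x := by
  have hs := @quotientMk_surjective P R
  cases hx with
  | map_refl x => obtain ⟨x, rfl⟩ := hs _ x; exact ⟨_, .map_refl x, map_sub _ _ _⟩
  | map_trans e e' x => obtain ⟨x, rfl⟩ := hs _ x; exact ⟨_, .map_trans e e' x, map_sub _ _ _⟩
  | comp_map e e' x y =>
    obtain ⟨x, rfl⟩ := hs _ x
    obtain ⟨y, rfl⟩ := hs _ y
    exact ⟨_, .comp_map e e' x y, map_sub _ _ _⟩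
  | comp_one x => obtain ⟨x, rfl⟩ := hs _ x; exact ⟨_, .comp_one x, map_sub _ _ _⟩
  | one_comp x => obtain ⟨x, rfl⟩ := hs _ x; exact ⟨_, .one_comp x, map_sub _ _ _⟩
  | nested x y z =>
    obtain ⟨x, rfl⟩ := hs _ x
    obtain ⟨y, rfl⟩ := hs _ y
    obtain ⟨z, rfl⟩ := hs _ z
    exact ⟨_, .nested x y z, map_sub _ _ _⟩
  | parallel p q x y z hy hz =>
    obtain ⟨x, rfl⟩ := hs _ x
    obtain ⟨y, hy, rfl⟩ := hy
    obtain ⟨z, hz, rfl⟩ := hz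
    refine ⟨_, .parallel p q x y z hy hz, ?_⟩
    rw [map_sub, negOnePow_smul_map]
    rfl

theorem quotient_lawful (h : ∀ (I : Type) [Finite I] (x : P.obj I), LawDefect P I x →
    IdealMem P R I x) : Lawful (quotient P R) := by
  intro I _ x hx
  obtain ⟨x', hx', rfl⟩ := exists_lawDefect hx
  exact quotientMk_eq_zero (h I x' hx')

theorem Hom.app_graft3 (f : Hom P Q) (σ : Equiv.Perm (Fin 3)) (g h : P.obj (Fin 2)) :
    f.app _ (graft3 P σ g h) = graft3 Q σ (f.app _ g) (f.app _ h) := by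
  rw [graft3, f.app_map, f.app_map, f.app_comp, f.app_map]
  rfl

end Hom

/-! ### Evaluation of formal monomials -/

section Eval

variable {Q : OperadData.{v}} (q : Gen → Q.obj (Fin 2))

/-- The value of a monomial, given the values of the generators. -/
def Monom.eval : {I : Type} → Monom I → [Finite I] → Q.obj I
  | _, .one, _ => Q.one
  | _, .gen g, _ => q g
  | _, .map e t, _ =>
    -- The index sets inside a monomial carry no finiteness assumption; finiteness is recovered from
    -- that of the target.
    haveI := Finite.of_equiv _ e.symm
    Q.map e t.eval
  | _, .comp (I := I) (J := J) s t, _ =>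
    haveI : Finite I := Finite.sum_left J
    haveI : Finite J := Finite.sum_right I
    Q.comp s.eval t.eval

/-- A monomial as an element of `formalData`. -/
def mono {I : Type} [Finite I] (t : Monom I) : formalData.obj I := (Finsupp.single t 1 : Monom I →₀ ℚ)

theorem single_eq_smul_mono {I : Type} [Finite I] (t : Monom I) (c : ℚ) :
    (show formalData.obj I from (Finsupp.single t c : Monom I →₀ ℚ)) = c • mono t := by
  have h : (Finsupp.single t c : Monom I →₀ ℚ) = c • Finsupp.single t 1 := by simp
  exact h

theorem formal_map_mono {I J : Type} [Finite I] [Finite J] (e : I ≃ J) (t : Monom I) :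
    formalData.map e (mono t) = mono (.map e t) :=
  Finsupp.mapDomain_single

theorem formal_comp_mono {I J : Type} [Finite I] [Finite J] (s : Monom (Option I)) (t : Monom J) :
    formalData.comp (mono s) (mono t) = mono (.comp s t) := by
  have h : (Finsupp.linearCombination ℚ (fun s : Monom (Option I) =>
      Finsupp.lmapDomain ℚ ℚ fun t : Monom J => Monom.comp s t)) (Finsupp.single s 1)
      (Finsupp.single t 1) = Finsupp.single (.comp s t) 1 := by simp
  exact h

theorem mono_mem {I : Type} [Finite I] (t : Monom I) : mono t ∈ formalData.deg I t.degree := by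
  have h : (Finsupp.single t 1 : Monom I →₀ ℚ) ∈ Submodule.span ℚ
    {x | ∃ s : Monom I, s.degree = t.degree ∧ x = Finsupp.single s 1} :=
    Submodule.subset_span ⟨t, rfl, rfl⟩
  exact h

theorem formal_deg_le {I : Type} [Finite I] {n : ℤ} {S : Submodule ℚ (formalData.obj I)}
    (h : ∀ t : Monom I, t.degree = n → mono t ∈ S) : formalData.deg I n ≤ S := by
  have key : ∀ S : Submodule ℚ (Monom I →₀ ℚ), (∀ t : Monom I, t.degree = n →
      Finsupp.single t 1 ∈ S) → Submodule.span ℚ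
        {x | ∃ s : Monom I, s.degree = n ∧ x = Finsupp.single s (1 : ℚ)} ≤ S := by
    intro S h
    rw [Submodule.span_le]
    rintro _ ⟨t, ht, rfl⟩
    exact h t ht
  exact key S h

theorem formal_isGraded : IsGraded formalData where
  map_mem {I J} _ _ e n x hx := by
    have h : formalData.deg I n ≤ (formalData.deg J n).comap (formalData.map e) :=
      formal_deg_le fun t ht => by
        rw [Submodule.mem_comap, formal_map_mono, ← ht]
        exact mono_mem (.map e t)
    exact h hx
  comp_mem {I J} _ _ m n x y hx hy := by
    have h : formalData.deg (Option I) m ≤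
        (formalData.deg (I ⊕ J) (m + n)).comap (formalData.comp.flip y) :=
      formal_deg_le fun s hs => by
        have h' : formalData.deg J n ≤
            (formalData.deg (I ⊕ J) (m + n)).comap (formalData.comp (mono s)) :=
          formal_deg_le fun t ht => by
            rw [Submodule.mem_comap, formal_comp_mono, ← hs, ← ht]
            exact mono_mem (.comp s t)
        exact h' hy
    exact h hx
  one_mem := mono_mem .one

theorem Monom.eval_mem (hQ : IsGraded Q) (hq : ∀ g, q g ∈ Q.deg _ g.degree) {I : Type}
    (t : Monom I) : ∀ [Finite I], t.eval q ∈ Q.deg I t.degree := by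
  induction t with
  | one => exact hQ.one_mem
  | gen g => exact hq g
  | @map I J e t ih =>
    intro _
    have := Finite.of_equiv _ e.symm
    exact hQ.map_mem e _ _ ih
  | @comp I J s t ihs iht =>
    intro _
    have : Finite I := Finite.sum_left J
    have : Finite J := Finite.sum_right I
    exact hQ.comp_mem _ _ _ _ ihs iht

/-- Linear extension of the evaluation of monomials. -/
def formalEval (I : Type) [Finite I] : formalData.obj I →ₗ[ℚ] Q.obj I :=
  Finsupp.linearCombination ℚ fun t : Monom I => t.eval q

theorem formalEval_mono {I : Type} [Finite I] (t : Monom I) :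
    formalEval q I (mono t) = t.eval q :=
  (Finsupp.linearCombination_single _ _ _).trans (one_smul _ _)

theorem formal_hom_ext {M : Type*} [AddCommGroup M] [Module ℚ M] {I : Type} [Finite I]
    {f g : formalData.obj I →ₗ[ℚ] M} (h : ∀ t, f (mono t) = g (mono t)) : f = g := by
  have key : ∀ f g : (Monom I →₀ ℚ) →ₗ[ℚ] M,
      (∀ t, f (Finsupp.single t 1) = g (Finsupp.single t 1)) → f = g :=
    fun f g h => Finsupp.lhom_ext' fun t => LinearMap.ext_ring (h t)
  exact key f g h

/-- The morphism out of the formal linear combinations of monomials. -/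
def formalHom (hQ : IsGraded Q) (hq : ∀ g, q g ∈ Q.deg _ g.degree) : Hom formalData Q where
  app I _ := formalEval q I
  app_mem I _ n x hx := by
    have h : formalData.deg I n ≤ (Q.deg I n).comap (formalEval q I) :=
      formal_deg_le fun t ht => by
        rw [Submodule.mem_comap, formalEval_mono, ← ht]
        exact t.eval_mem q hQ hq
    exact h hx
  app_map {I J} _ _ e x := by
    refine LinearMap.congr_fun (f := formalEval q J ∘ₗ formalData.map e)
      (g := Q.map e ∘ₗ formalEval q I) (formal_hom_ext fun t => ?_) x
    rw [LinearMap.comp_apply, LinearMap.comp_apply, formal_map_mono, formalEval_mono,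
      formalEval_mono]
    rfl
  app_comp {I J} _ _ x y := by
    refine LinearMap.congr_fun₂ (f := formalData.comp.compr₂ (formalEval q (I ⊕ J)))
      (g := Q.comp.compl₁₂ (formalEval q (Option I)) (formalEval q J))
      (formal_hom_ext fun s => formal_hom_ext fun t => ?_) x y
    rw [LinearMap.compr₂_apply, LinearMap.compl₁₂_apply, formal_comp_mono, formalEval_mono,
      formalEval_mono, formalEval_mono]
    rfl
  app_one := formalEval_mono q .one

theorem formalHom_gen (hQ : IsGraded Q) (hq : ∀ g, q g ∈ Q.deg _ g.degree) (g : Gen) :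
    (formalHom q hQ hq).app (Fin 2) (mono (.gen g)) = q g :=
  formalEval_mono q (.gen g)

/-- The morphism out of the free operad. -/
def freeHom (hQ : IsGraded Q) (hl : Lawful Q) (hq : ∀ g, q g ∈ Q.deg _ g.degree)
    (hs : ∀ g, Q.map (Equiv.swap 0 1) (q g) = g.symm • q g) : Hom freeOperad Q :=
  (formalHom q hQ hq).lift (R := FreeRel) (by
    intro I _ x hx
    cases hx with
    | ax x hx => exact hl _ _ ((formalHom q hQ hq).lawDefect hx)
    | symm g =>
      have h : (formalHom q hQ hq).app (Fin 2) (formalData.map (Equiv.swap 0 1) (mono (.gen g))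
          - g.symm • mono (.gen g)) = 0 := by
        rw [map_sub, map_smul, Hom.app_map, formalHom_gen, hs, sub_self]
      rw [formal_map_mono, ← single_eq_smul_mono] at h
      exact h)

theorem freeHom_gen (hQ : IsGraded Q) (hl : Lawful Q) (hq : ∀ g, q g ∈ Q.deg _ g.degree)
    (hs : ∀ g, Q.map (Equiv.swap 0 1) (q g) = g.symm • q g) (g : Gen) :
    (freeHom q hQ hl hq hs).app _ (freeGen g) = q g :=
  formalHom_gen q hQ hq g

/-- The morphism out of the presented operad. -/
def presentedHom (hQ : IsGraded Q) (hl : Lawful Q) (hq : ∀ g, q g ∈ Q.deg _ g.degree)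
    (hs : ∀ g, Q.map (Equiv.swap 0 1) (q g) = g.symm • q g)
    (h₁ : graft3 Q (Equiv.refl _) (q .E) (q .E) = graft3 Q perm201 (q .E) (q .E))
    (h₂ : graft3 Q (Equiv.refl _) (q .Om) (q .E)
      = graft3 Q perm102 (q .E) (q .Om) + graft3 Q perm201 (q .E) (q .Om)) :
    Hom presentedOperad Q :=
  (freeHom q hQ hl hq hs).lift (R := BessRel) (by
    intro I _ x hx
    cases hx with
    | rel₁ =>
      rw [map_sub, Hom.app_graft3, Hom.app_graft3, freeHom_gen, h₁, sub_self]
    | rel₂ =>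
      rw [map_sub, map_add, Hom.app_graft3, Hom.app_graft3, Hom.app_graft3, freeHom_gen,
        freeHom_gen, h₂, sub_self])

theorem free_lawful : Lawful freeOperad :=
  quotient_lawful fun _ _ x hx => .of x (.ax x hx)

theorem presented_lawful : Lawful presentedOperad :=
  quotient_lawful fun I _ x hx => by
    rw [free_lawful I x hx]
    exact .zero

theorem presented_isGraded : IsGraded presentedOperad :=
  quotient_isGraded (quotient_isGraded formal_isGraded)

end Eval

end Bessel
end

noncomputable section

namespace Bessel

/-! ### The generators of `Bess` -/

section Generators

variable {I J K X Y : Type}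

theorem ι_mul_ι_swap {M : Type*} [AddCommGroup M] [Module ℚ M] (m n : M) :
    ExteriorAlgebra.ι ℚ m * ExteriorAlgebra.ι ℚ n
      = -(ExteriorAlgebra.ι ℚ n * ExteriorAlgebra.ι ℚ m) :=
  eq_neg_of_add_eq_zero_left (ExteriorAlgebra.ι_add_mul_swap _ _)

theorem wedgeTrees_pair (s t : Tree X) : wedgeTrees [s, t]
    = ExteriorAlgebra.ι ℚ (treeVec s) * ExteriorAlgebra.ι ℚ (treeVec t) := by
  simp [wedgeTrees, wedgeVec]

theorem wedgeTrees_singleton (t : Tree X) :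
    wedgeTrees [t] = ExteriorAlgebra.ι ℚ (treeVec t) := by
  simp [wedgeTrees, wedgeVec]

theorem relabel_wedgeTrees (f : X → Y) (l : List (Tree X)) :
    relabel f (wedgeTrees l) = wedgeTrees (l.map (Tree.map f)) := by
  induction l with
  | nil => simp [wedgeTrees, wedgeVec]
  | cons t l ih =>
    rw [List.map_cons, wedgeTrees_cons, wedgeTrees_cons, map_mul, ih, ExteriorAlgebra.map_apply_ι,
      treeMap_treeVec]

theorem relabel_ι_treeVec (f : X → Y) (t : Tree X) :
    relabel f (ExteriorAlgebra.ι ℚ (treeVec t)) = ExteriorAlgebra.ι ℚ (treeVec (t.map f)) := by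
  rw [ExteriorAlgebra.map_apply_ι, treeMap_treeVec]

theorem subst_pair_right (i : I) (y : ExteriorAlgebra ℚ (TreeVec J)) :
    subst (wedgeTrees [Tree.leaf (some i), Tree.leaf none]) y
      = ExteriorAlgebra.ι ℚ (leafVec (Sum.inl i)) * relabel Sum.inr y := by
  rw [wedgeTrees_pair, subst, expand_ι_mul, expand_ι, insertB_leaf_some, forgetB_leaf_some,
    insertB_leaf_none, mul_zero, zero_add]

theorem subst_ι_none_mul (x : ExteriorAlgebra ℚ (TreeVec I)) (y : ExteriorAlgebra ℚ (TreeVec J)) :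
    subst (ExteriorAlgebra.ι ℚ (leafVec none) * relabel some x) y
      = inv (relabel Sum.inl x) * relabel Sum.inr y := by
  rw [subst, expand_ι_mul, forgetB_leaf_none, insertB_leaf_none, map_zero, zero_mul, add_zero,
    relabel, ← map_inv, ← AlgHom.comp_apply, ExteriorAlgebra.map_comp_map,
    forgetB_treeMap_some some id fun _ => rfl, map_inv]
  rfl

theorem subst_pair_left (i : I) (y : ExteriorAlgebra ℚ (TreeVec J)) :
    subst (wedgeTrees [Tree.leaf none, Tree.leaf (some i)]) y
      = -(ExteriorAlgebra.ι ℚ (leafVec (Sum.inl i)) * relabel Sum.inr y) := by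
  have h := subst_ι_none_mul (ExteriorAlgebra.ι ℚ (leafVec i)) y
  rw [relabel_ι_treeVec, relabel_ι_treeVec, inv_ι, neg_mul] at h
  rw [wedgeTrees_pair]
  exact h

/-- Since `⋆` lies only on the right side of the root, a single term of the derivation rule
survives. -/
theorem subst_ι_mul_leaf (t : Tree I) (y : ExteriorAlgebra ℚ (TreeVec J)) :
    subst (ExteriorAlgebra.ι ℚ (treeVec (t.map some * Tree.leaf none))) y
      = derivation (graft (I ⊕ J) (treeVec (t.map Sum.inl))) (relabel Sum.inr y) := by
  have h₁ : forgetB I J (treeVec (t.map some)) = treeVec (t.map Sum.inl) := by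
    have h := LinearMap.congr_fun (forgetB_treeMap_some (J := J) some id fun i : I => rfl)
      (treeVec t)
    rwa [LinearMap.comp_apply, treeMap_treeVec, treeMap_treeVec] at h
  have h₂ : insertB I J y (treeVec (t.map some)) = 0 := by
    have h := LinearMap.congr_fun (insertB_treeMap_some y some id fun i : I => rfl) (treeVec t)
    rwa [LinearMap.comp_apply, treeMap_treeVec] at h
  rw [subst, expand_ι, treeVec_mul, (isSubst_forgetB y).der, h₁, h₂, map_zero, zero_add,
    insertB_leaf_none]

section Finite

variable [Finite I] [Finite J] [Finite K]

theorem detMap_orient (e : I ≃ J) (k : List I) (h : k.length = Nat.card I) :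
    detMap e (orient k h) = orient (k.map e) (by rw [List.length_map, h, Nat.card_congr e]) :=
  det_ext (by
    rw [leafLift_detMap, leafLift_orient, leafLift_orient, relabel_wedgeTrees, List.map_map,
      List.map_map]
    rfl)

theorem orient_swap (i j : I) (k : List I) (h : (i :: j :: k).length = Nat.card I) :
    orient (i :: j :: k) h = -orient (j :: i :: k) h := by
  refine det_ext ?_
  rw [Submodule.coe_neg, map_neg, leafLift_orient, leafLift_orient]
  simp only [List.map_cons, wedgeTrees_cons, ← mul_assoc, ← neg_mul]
  congr 1
  exact (ι_mul_ι_swap _ _).trans (neg_mul _ _).symm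

theorem orient_cons_swap (a i j : I) (k : List I) (h : (a :: i :: j :: k).length = Nat.card I) :
    orient (a :: i :: j :: k) h = -orient (a :: j :: i :: k) h := by
  refine det_ext ?_
  rw [Submodule.coe_neg, map_neg, leafLift_orient, leafLift_orient]
  simp only [List.map_cons, wedgeTrees_cons]
  rw [← mul_neg]
  congr 1
  simp only [← mul_assoc, ← neg_mul]
  congr 1
  exact (ι_mul_ι_swap _ _).trans (neg_mul _ _).symm

end Finite

/-- The underlying elements of `B` of the generators. -/
def bGen : Gen → BSpace (Fin 2)
  | .E => bE
  | .Om => bOm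

/-- The orientation `0 ∧ 1`. -/
def orient01 : DetSpace (Fin 2) := orient [0, 1] (by simp)

/-- The generators of `Bess`. -/
def bessGenT (g : Gen) : BessSpace (Fin 2) := (-g.symm) • (orient01 ⊗ₜ[ℚ] bGen g)

/-- Both generators are written with the orientation `0 ∧ 1`, so that they can be treated uniformly.
The scalar `-g.symm` is at once the correction of orientation, the symmetry sign of the generator in
`B`, and the sign of its degree there. -/
theorem bessGen_eq (g : Gen) : bessGen g = bessGenT g := by
  cases g with
  | E =>
    have h := orient_swap (1 : Fin 2) 0 [] (by simp)
    have e : bessGen .E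
      = ((orient [1, 0] (by simp) : DetSpace (Fin 2)) ⊗ₜ[ℚ] bGen .E : BessSpace (Fin 2)) := rfl
    rw [e, h, bessGenT, TensorProduct.neg_tmul, Gen.symm]
    exact (neg_one_smul ℚ _).symm
  | Om =>
    rw [bessGenT, Gen.symm, neg_neg, one_smul]
    rfl

theorem coe_bGen_E : (bGen .E).1 = wedgeTrees [Tree.leaf 0, Tree.leaf 1] := rfl

theorem coe_bGen_Om : (bGen .Om).1 = wedgeTrees [Tree.leaf 0 * Tree.leaf 1] := rfl

theorem bGen_E_mem : (bGen .E).1 ∈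
    (⋀[ℚ]^2 (TreeVec (Fin 2)) : Submodule ℚ (ExteriorAlgebra ℚ (TreeVec (Fin 2)))) :=
  wedgeTrees_mem [Tree.leaf 0, Tree.leaf 1]

theorem bGen_Om_mem : (bGen .Om).1 ∈
    (⋀[ℚ]^1 (TreeVec (Fin 2)) : Submodule ℚ (ExteriorAlgebra ℚ (TreeVec (Fin 2)))) :=
  wedgeTrees_mem [Tree.leaf 0 * Tree.leaf 1]

theorem bessGen_mem (g : Gen) : bessGen g ∈ Bess.deg (Fin 2) g.degree := by
  have h : orient01 ⊗ₜ[ℚ] bGen g ∈ bessDeg (Fin 2) g.degree := by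
    cases g with
    | E => exact tmul_mem_deg (r := 2) 0 (by simp) _ _ bGen_E_mem
    | Om => exact tmul_mem_deg (r := 1) 1 (by simp) _ _ bGen_Om_mem
  rw [bessGen_eq]
  exact Submodule.smul_mem _ (-g.symm) h

theorem bMap_bGen (g : Gen) : bMap (Equiv.swap 0 1) (bGen g) = -g.symm • bGen g := by
  refine Subtype.ext ?_
  rw [coe_bMap, Submodule.coe_smul]
  cases g with
  | E =>
    rw [coe_bGen_E, relabel_wedgeTrees, Gen.symm, neg_one_smul]
    exact (wedgeTrees_pair _ _).trans ((ι_mul_ι_swap _ _).trans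
      (congrArg _ (wedgeTrees_pair _ _).symm))
  | Om =>
    rw [coe_bGen_Om, relabel_wedgeTrees, Gen.symm, neg_neg, one_smul]
    exact congrArg (fun t => wedgeTrees [t]) (Tree.mul_comm' (Tree.leaf 1) (Tree.leaf 0))

theorem detMap_swap : detMap (Equiv.swap (0 : Fin 2) 1) orient01 = (-1 : ℚ) • orient01 := by
  rw [orient01, detMap_orient]
  exact (orient_swap 1 0 [] _).trans (neg_one_smul ℚ _).symm

/-- The relabelling of `Bess`. -/
def bessMap [Finite I] [Finite J] (e : I ≃ J) : BessSpace I →ₗ[ℚ] BessSpace J :=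
  TensorProduct.map (detMap e) (bMap e)

/-- The composition of `Bess`. -/
def bessComp (I J : Type) [Finite I] [Finite J] :
    BessSpace (Option I) →ₗ[ℚ] BessSpace J →ₗ[ℚ] BessSpace (I ⊕ J) :=
  Bess.comp (I := I) (J := J)

theorem bessMap_tmul [Finite I] [Finite J] (e : I ≃ J) (o : DetSpace I) (x : BSpace I) :
    bessMap e (o ⊗ₜ[ℚ] x) = detMap e o ⊗ₜ[ℚ] bMap e x := rfl

theorem bessComp_tmul [Finite I] [Finite J] (o : DetSpace (Option I)) (x : BSpace (Option I))
    (o' : DetSpace J) (y : BSpace J) : bessComp I J (o ⊗ₜ[ℚ] x) (o' ⊗ₜ[ℚ] y)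
      = detComp I J o o' ⊗ₜ[ℚ] bComp I J ((bSign (Option I) ^ (Nat.card J + 1)) x) y := rfl

theorem bessGen_symm (g : Gen) : Bess.map (Equiv.swap 0 1) (bessGen g) = g.symm • bessGen g := by
  have h : bessMap (Equiv.swap 0 1) (bessGenT g) = g.symm • bessGenT g := by
    rw [bessGenT, map_smul, bessMap_tmul, detMap_swap, bMap_bGen, TensorProduct.tmul_smul,
      ← TensorProduct.smul_tmul', smul_smul, smul_smul, smul_smul]
    congr 1
    ring
  rw [bessGen_eq]
  exact h

theorem bSign_bGen (g : Gen) : bSign (Fin 2) (bGen g) = -g.symm • bGen g := by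
  cases g with
  | E => exact (bSign_of_mem _ bGen_E_mem).trans (by norm_num [Gen.symm])
  | Om => exact (bSign_of_mem _ bGen_Om_mem).trans (by norm_num [Gen.symm])

/-- The grafting of the generators of `B`. -/
def bGraft3 (σ : Equiv.Perm (Fin 3)) (g h : Gen) : BSpace (Fin 3) :=
  bMap σ (bMap (finSumFinEquiv (m := 1) (n := 2))
    (bComp (Fin 1) (Fin 2) (bMap finSuccEquivLast (bGen g)) (bGen h)))

theorem relabel_graft3 (σ : Equiv.Perm (Fin 3)) (x : ExteriorAlgebra ℚ (TreeVec (Fin 2))) :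
    relabel σ (relabel (finSumFinEquiv (m := 1) (n := 2)) (subst (relabel
      (finSuccEquivLast (n := 1)) (wedgeTrees [Tree.leaf 0, Tree.leaf 1])) x))
    = ExteriorAlgebra.ι ℚ (leafVec (σ 0)) * relabel (fun i : Fin 2 => σ i.succ) x := by
  have e : subst (relabel (finSuccEquivLast (n := 1)) (wedgeTrees [Tree.leaf 0, Tree.leaf 1])) x
      = _ := (congrArg (subst · x) (relabel_wedgeTrees _ _)).trans (subst_pair_right 0 x)
  have h : (fun i : Fin 2 => σ i.succ)
      = σ ∘ finSumFinEquiv (m := 1) (n := 2) ∘ Sum.inr := by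
    funext i
    fin_cases i <;> rfl
  rw [e, map_mul, map_mul, relabel_ι_treeVec, relabel_ι_treeVec, relabel_relabel, relabel_relabel,
    h]
  rfl

theorem coe_bGraft3_E (σ : Equiv.Perm (Fin 3)) (h : Gen) : (bGraft3 σ .E h).1
    = ExteriorAlgebra.ι ℚ (leafVec (σ 0)) * relabel (fun i : Fin 2 => σ i.succ) (bGen h).1 :=
  relabel_graft3 σ _

/-- Grafting with the leaf `σ 0` is a derivation, so it acts on each factor of `σ 1 ∧ σ 2` in turn.
-/
theorem coe_bGraft3_Om (σ : Equiv.Perm (Fin 3)) : (bGraft3 σ .Om .E).1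
    = wedgeTrees [Tree.leaf (σ 0) * Tree.leaf (σ 1), Tree.leaf (σ 2)]
      + wedgeTrees [Tree.leaf (σ 1), Tree.leaf (σ 0) * Tree.leaf (σ 2)] := by
  rw [bGraft3, coe_bMap, coe_bMap, coe_bComp, coe_bMap, coe_bGen_Om, coe_bGen_E, relabel_wedgeTrees]
  have e : subst (wedgeTrees ([Tree.leaf 0 * Tree.leaf 1].map
    (Tree.map (finSuccEquivLast (n := 1))))) (wedgeTrees [Tree.leaf 0, Tree.leaf (1 : Fin 2)]) = _ :=
    (congrArg (subst · _) (wedgeTrees_singleton _)).trans (subst_ι_mul_leaf (Tree.leaf 0) _)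
  rw [e, relabel_wedgeTrees, List.map_cons, List.map_cons, List.map_nil, wedgeTrees_pair,
    derivation_ι_mul, derivation_ι, ← treeVec_mul, ← treeVec_mul, ← wedgeTrees_pair,
    ← wedgeTrees_pair, map_add, map_add, relabel_wedgeTrees, relabel_wedgeTrees,
    relabel_wedgeTrees, relabel_wedgeTrees]
  rfl

theorem detGraft3 (σ : Equiv.Perm (Fin 3)) :
    detMap σ (detMap (finSumFinEquiv (m := 1) (n := 2)) (detComp (Fin 1) (Fin 2)
      (detMap finSuccEquivLast orient01) orient01)) = orient [σ 0, σ 1, σ 2] (by simp) := by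
  refine det_ext ?_
  have h : leafLift (Fin 2) orient01.1 = wedgeTrees [Tree.leaf 0, Tree.leaf 1] :=
    leafLift_orient [0, 1] (by simp)
  rw [leafLift_detMap, leafLift_detMap, leafLift_detComp, leafLift_detMap, leafLift_orient, h,
    relabel_graft3, relabel_wedgeTrees]
  exact (wedgeTrees_cons _ _).symm

/-- The scalar of `g` occurs twice, once from its orientation and once from crossing the orientation
of `h`, and cancels. Only the scalar of `h` remains. -/
theorem graft3_bessGen (σ : Equiv.Perm (Fin 3)) (g h : Gen) :
    graft3 Bess σ (bessGen g) (bessGen h) =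
      ((-h.symm) • ((orient [σ 0, σ 1, σ 2] (by simp) : DetSpace (Fin 3)) ⊗ₜ[ℚ] bGraft3 σ g h) :
        BessSpace (Fin 3)) := by
  have e : bessMap σ (bessMap (finSumFinEquiv (m := 1) (n := 2)) (bessComp (Fin 1) (Fin 2)
      (bessMap finSuccEquivLast (bessGenT g)) (bessGenT h)))
      = (-h.symm) • ((orient [σ 0, σ 1, σ 2] (by simp) : DetSpace (Fin 3)) ⊗ₜ[ℚ]
        bGraft3 σ g h) := by
    have hg : g.symm * g.symm = 1 := by cases g <;> norm_num [Gen.symm]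
    have e : bessComp (Fin 1) (Fin 2) (bessMap finSuccEquivLast (orient01 ⊗ₜ[ℚ] bGen g))
        (orient01 ⊗ₜ[ℚ] bGen h) = (-g.symm) • (detComp (Fin 1) (Fin 2) (detMap finSuccEquivLast
          orient01) orient01 ⊗ₜ[ℚ] bComp (Fin 1) (Fin 2) (bMap finSuccEquivLast (bGen g))
            (bGen h)) := by
      rw [bessMap_tmul, bessComp_tmul, bSign_pow_bMap, Nat.card_fin, bSign_pow_sq 1, pow_one,
        bSign_bGen, map_smul, map_smul, LinearMap.smul_apply, TensorProduct.tmul_smul]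
    rw [bessGenT, bessGenT]
    simp only [map_smul, LinearMap.smul_apply, e]
    simp only [bessMap_tmul, detGraft3, smul_smul]
    rw [bGraft3]
    congr 1
    linear_combination (-h.symm) * hg
  rw [bessGen_eq, bessGen_eq]
  exact e

theorem ι_mul_rotate {M : Type*} [AddCommGroup M] [Module ℚ M] (a b c : M) :
    ExteriorAlgebra.ι ℚ a * (ExteriorAlgebra.ι ℚ b * ExteriorAlgebra.ι ℚ c)
      = ExteriorAlgebra.ι ℚ c * (ExteriorAlgebra.ι ℚ a * ExteriorAlgebra.ι ℚ b) := by
  rw [ι_mul_ι_swap b c, mul_neg, ← mul_assoc, ι_mul_ι_swap a c, neg_mul, neg_neg, mul_assoc]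

/-- A 3-cycle is even, while the transposition in the next lemma is odd. This accounts for the
change of signs between the relations of `B` and those of `Bess`. -/
theorem orient_201 : (orient [perm201 0, perm201 1, perm201 2] (by simp) : DetSpace (Fin 3))
    = orient [0, 1, 2] (by simp) := by
  have h := orient_swap (2 : Fin 3) 0 [1] (by simp)
  have h' := orient_cons_swap (0 : Fin 3) 2 1 [] (by simp)
  rw [h', neg_neg] at h
  exact h

theorem orient_102 : (orient [perm102 0, perm102 1, perm102 2] (by simp) : DetSpace (Fin 3))
    = -orient [0, 1, 2] (by simp) :=
  orient_swap 1 0 [2] _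

theorem bGraft3_E_E : bGraft3 (Equiv.refl _) .E .E = bGraft3 perm201 .E .E := by
  refine Subtype.ext ?_
  rw [coe_bGraft3_E, coe_bGraft3_E, coe_bGen_E, relabel_wedgeTrees, relabel_wedgeTrees]
  refine (congrArg _ (wedgeTrees_pair _ _)).trans (Eq.trans ?_
    (congrArg _ (wedgeTrees_pair _ _).symm))
  exact ι_mul_rotate (leafVec (0 : Fin 3)) (leafVec 1) (leafVec 2)

/-- This is the distributive law of `B`; its minus sign comes from moving the bare leaf `2` to the
left. -/
theorem bGraft3_Om_E : bGraft3 (Equiv.refl _) .Om .E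
    = bGraft3 perm102 .E .Om - bGraft3 perm201 .E .Om := by
  refine Subtype.ext ?_
  rw [AddSubgroupClass.coe_sub, coe_bGraft3_E, coe_bGraft3_E, coe_bGraft3_Om, coe_bGen_Om,
    relabel_wedgeTrees, relabel_wedgeTrees, add_comm, sub_eq_add_neg]
  congr 1
  exact (wedgeTrees_pair _ _).trans ((ι_mul_ι_swap _ _).trans
    (congrArg Neg.neg (congrArg _ (wedgeTrees_singleton _).symm)))

theorem bess_rel₁ : graft3 Bess (Equiv.refl _) (bessGen .E) (bessGen .E)
    = graft3 Bess perm201 (bessGen .E) (bessGen .E) := by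
  rw [graft3_bessGen, graft3_bessGen, orient_201, bGraft3_E_E]
  rfl

/-- The odd permutation in one term changes its sign, so the difference in the distributive law
becomes, up to the overall sign of `E`, the sum in the relation. -/
theorem bess_rel₂ : graft3 Bess (Equiv.refl _) (bessGen .Om) (bessGen .E)
    = graft3 Bess perm102 (bessGen .E) (bessGen .Om)
      + graft3 Bess perm201 (bessGen .E) (bessGen .Om) := by
  rw [graft3_bessGen, graft3_bessGen, graft3_bessGen, orient_201, orient_102, bGraft3_Om_E]
  have e : ∀ (o : DetSpace (Fin 3)) (x y : BSpace (Fin 3)),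
      (-Gen.E.symm) • (o ⊗ₜ[ℚ] (x - y)) = (-Gen.Om.symm) • ((-o) ⊗ₜ[ℚ] x)
        + (-Gen.Om.symm) • (o ⊗ₜ[ℚ] y) := by
    intro o x y
    rw [Gen.symm, Gen.symm, TensorProduct.tmul_sub, TensorProduct.neg_tmul]
    module
  exact e _ _ _

theorem bess_isGraded : IsGraded Bess :=
  ⟨bess_isOperad.map_mem, bess_isOperad.comp_mem, bess_isOperad.one_mem⟩

/-- The morphism from the presented operad to `Bess`. -/
def toBess : Hom presentedOperad Bess :=
  presentedHom bessGen bess_isGraded bess_isOperad.laws bessGen_mem bessGen_symm bess_rel₁ bess_rel₂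

theorem toBess_gen (g : Gen) : toBess.app _ (presentedGen g) = bessGen g :=
  freeHom_gen bessGen bess_isGraded bess_isOperad.laws bessGen_mem bessGen_symm g

end Generators

end Bessel
end

noncomputable section

namespace Bessel

universe u v

/-! ### Partial compositions along arbitrary identifications -/

section Laws

variable {P : OperadData.{u}} {I J K I' J' : Type} [Finite I] [Finite J] [Finite K]
  [Finite I'] [Finite J']

theorem Lawful.map_refl (hP : Lawful P) (x : P.obj I) : P.map (Equiv.refl I) x = x :=
  sub_eq_zero.1 (hP _ _ (.map_refl x))

theorem Lawful.map_trans (hP : Lawful P) (e : I ≃ J) (f : J ≃ K) (x : P.obj I) :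
    P.map f (P.map e x) = P.map (e.trans f) x :=
  sub_eq_zero.1 (hP _ _ (.map_trans e f x))

theorem Lawful.comp_map (hP : Lawful P) (e : I ≃ I') (f : J ≃ J') (x : P.obj (Option I)) (y : P.obj J) :
    P.comp (P.map (Equiv.optionCongr e) x) (P.map f y)
      = P.map (Equiv.sumCongr e f) (P.comp x y) :=
  sub_eq_zero.1 (hP _ _ (.comp_map e f x y))

theorem Lawful.comp_map_left (hP : Lawful P) (e : I ≃ I') (x : P.obj (Option I)) (y : P.obj J) :
    P.comp (P.map (Equiv.optionCongr e) x) y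
      = P.map (Equiv.sumCongr e (Equiv.refl J)) (P.comp x y) := by
  rw [← hP.comp_map, hP.map_refl]

theorem Lawful.comp_map_right (hP : Lawful P) (f : J ≃ J') (x : P.obj (Option I)) (y : P.obj J) :
    P.comp x (P.map f y) = P.map (Equiv.sumCongr (Equiv.refl I) f) (P.comp x y) := by
  rw [← hP.comp_map, Equiv.optionCongr_refl, hP.map_refl]

theorem Lawful.comp_one (hP : Lawful P) (x : P.obj (Option I)) :
    P.comp x P.one = P.map (Equiv.optionEquivSumPUnit I) x :=
  sub_eq_zero.1 (hP _ _ (.comp_one x))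

theorem Lawful.one_comp (hP : Lawful P) (y : P.obj J) : P.map (Equiv.emptySum Empty J)
    (P.comp (P.map (Equiv.ofUnique PUnit.{1} (Option Empty)) P.one) y) = y :=
  sub_eq_zero.1 (hP _ _ (.one_comp y))

theorem Lawful.nested (hP : Lawful P) (x : P.obj (Option I)) (y : P.obj (Option J)) (z : P.obj K) :
    P.comp x (P.comp y z) = P.map (Equiv.sumAssoc I J K)
      (P.comp (P.map (starRight I J) (P.comp x y)) z) :=
  sub_eq_zero.1 (hP _ _ (.nested x y z))

theorem Lawful.parallel (hP : Lawful P) {p q : ℤ} (x : P.obj (Option (Option I))) {y : P.obj J} {z : P.obj K}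
    (hy : y ∈ P.deg J p) (hz : z ∈ P.deg K q) :
    P.comp (P.map (starLeft I J) (P.comp x y)) z
      = (p * q).negOnePow • P.map (swapRight I J K)
          (P.comp (P.map (starLeft I K) (P.comp (P.map (swapStars I) x) z)) y) :=
  sub_eq_zero.1 (hP _ _ (.parallel p q x y z hy hz))

end Laws

/-- An identification of `A ⊔ B` with `C ⊔ {⋆}` which sends an element of `A` to `⋆`. -/
structure Ins (A B C : Type) where
  toEquiv : A ⊕ B ≃ Option C
  star : A
  star_eq : toEquiv (.inl star) = none

namespace Ins

variable {A B C A' B' C' D D' I J : Type}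

/-- The restriction to `A`. -/
def u (s : Ins A B C) (a : A) : Option C := s.toEquiv (.inl a)

/-- The restriction to `B`. -/
def v (s : Ins A B C) (b : B) : Option C := s.toEquiv (.inr b)

theorem u_star (s : Ins A B C) : s.u s.star = none := s.star_eq

theorem u_eq_none (s : Ins A B C) {a : A} : s.u a = none ↔ a = s.star :=
  ⟨fun h => Sum.inl_injective (s.toEquiv.injective (h.trans s.star_eq.symm)),
    fun h => h ▸ s.star_eq⟩

/-- Relabelling of the source. -/
def pre (s : Ins A B C) (f : A' ≃ A) (g : B' ≃ B) : Ins A' B' C where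
  toEquiv := (Equiv.sumCongr f g).trans s.toEquiv
  star := f.symm s.star
  star_eq := by simp [s.star_eq]

/-- Relabelling of the target. -/
def post (s : Ins A B C) (h : C ≃ C') : Ins A B C' where
  toEquiv := s.toEquiv.trans (Equiv.optionCongr h)
  star := s.star
  star_eq := by simp [s.star_eq]

/-- Factorizations of an identification through `(I ⊔ {⋆}) ⊔ B` and `I ⊔ B`. -/
structure Rep (s : Ins A B C) (c : A ≃ Option I) (e : I ⊕ B ≃ C) : Prop where
  left : ∀ a, s.u a = (c a).map fun i => e (.inl i)
  right : ∀ b, s.v b = some (e (.inr b))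

/-- Once `c` matches the insertion points, the induced bijection of `(I ⊔ B) ⊔ {⋆}` with `C ⊔ {⋆}`
fixes `⋆`, and `e` is its restriction. -/
theorem exists_rep (s : Ins A B C) (c : A ≃ Option I) (h : c s.star = none) :
    ∃ e : I ⊕ B ≃ C, s.Rep c e := by
  set E : Option (I ⊕ B) ≃ Option C := (starLeft I B).symm.trans
    ((Equiv.sumCongr c.symm (Equiv.refl B)).trans s.toEquiv) with hE
  have h0 : E none = none := by
    have : E none = s.u (c.symm none) := rfl
    rw [this, s.u_eq_none, ← h, c.symm_apply_apply]
  have hs : ∀ m, some (Equiv.removeNone E m) = E (some m) := fun m => by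
    refine Equiv.removeNone_some _ (Option.ne_none_iff_exists'.1 fun hm => ?_)
    cases E.injective (hm.trans h0.symm)
  refine ⟨Equiv.removeNone E, fun a => ?_, fun b => (hs (.inr b)).symm⟩
  obtain ⟨i, rfl⟩ := c.symm.surjective a
  rw [c.apply_symm_apply]
  cases i with
  | none => exact h0
  | some i => exact (hs (.inl i)).symm

theorem Rep.star {s : Ins A B C} {c : A ≃ Option I} {e : I ⊕ B ≃ C} (h : s.Rep c e) :
    c s.star = none := by
  have := h.left s.star
  rw [s.u_star] at this
  exact Option.map_eq_none_iff.1 this.symm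

/-- The standard factorization. -/
def stdLeft (s : Ins A B C) : A ≃ Option {a // a ≠ s.star} :=
  (@Equiv.optionSubtypeNe A (Classical.decEq A) s.star).symm

theorem stdLeft_star (s : Ins A B C) : s.stdLeft s.star = none :=
  @Equiv.optionSubtypeNe_symm_self A (Classical.decEq A) s.star

/-- The standard factorization. -/
def stdRight (s : Ins A B C) : {a // a ≠ s.star} ⊕ B ≃ C :=
  (s.exists_rep s.stdLeft s.stdLeft_star).choose

theorem std_rep (s : Ins A B C) : s.Rep s.stdLeft s.stdRight :=
  (s.exists_rep s.stdLeft s.stdLeft_star).choose_spec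

end Ins

theorem trans_symm_trans {A B C : Type} (e : A ≃ B) (f : A ≃ C) : e.trans (e.symm.trans f) = f := by
  rw [← Equiv.trans_assoc, Equiv.self_trans_symm, Equiv.refl_trans]

section Pc

variable {P : OperadData.{u}} {A B C A' B' C' D D' I J : Type} [Finite A] [Finite B] [Finite C]
  [Finite A'] [Finite B'] [Finite C'] [Finite D] [Finite D'] [Finite I] [Finite J]

/-- The partial composition along an identification. -/
def pc (s : Ins A B C) : P.obj A →ₗ[ℚ] P.obj B →ₗ[ℚ] P.obj C :=
  (P.comp.compr₂ (P.map s.stdRight)) ∘ₗ P.map s.stdLeft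

/-- Two factorizations differ by a bijection of the intermediate set, which naturality of the
composition absorbs. Identities can thus be proved with whichever factorization suits them, and
equality of identifications tested pointwise. -/
theorem pc_eq (hP : Lawful P) {s : Ins A B C} {c : A ≃ Option I} {e : I ⊕ B ≃ C} (h : s.Rep c e) (x : P.obj A)
    (y : P.obj B) : pc s x y = P.map e (P.comp (P.map c x) y) := by
  change P.map s.stdRight (P.comp (P.map s.stdLeft x) y) = _
  set f : {a // a ≠ s.star} ≃ I := Equiv.removeNone (s.stdLeft.symm.trans c) with hf
  have h0 : (s.stdLeft.symm.trans c) none = none := by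
    rw [Equiv.trans_apply, ← s.stdLeft_star, Equiv.symm_apply_apply, h.star]
  have hs : ∀ m, some (f m) = c (s.stdLeft.symm (some m)) := fun m => by
    refine Equiv.removeNone_some _ (Option.ne_none_iff_exists'.1 fun hm => ?_)
    cases (s.stdLeft.symm.trans c).injective (hm.trans h0.symm)
  have hc : c = s.stdLeft.trans (Equiv.optionCongr f) := by
    refine Equiv.ext fun a => ?_
    obtain ⟨i, rfl⟩ := s.stdLeft.symm.surjective a
    cases i with
    | none => simpa using h0
    | some i => simp [hs]
  have he : s.stdRight = (Equiv.sumCongr f (Equiv.refl B)).trans e := by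
    refine Equiv.ext fun m => Option.some_injective _ ?_
    rcases m with i | b
    · have h₁ := s.std_rep.left (s.stdLeft.symm (some i))
      have h₂ := h.left (s.stdLeft.symm (some i))
      rw [Equiv.apply_symm_apply] at h₁
      rw [← hs] at h₂
      exact h₁.symm.trans h₂
    · exact (s.std_rep.right b).symm.trans (h.right b)
  rw [he, hc, ← hP.map_trans, ← hP.map_trans, hP.comp_map_left]

theorem pc_ext (hP : Lawful P) {s t : Ins A B C} (hu : ∀ a, s.u a = t.u a) (hv : ∀ b, s.v b = t.v b) (x : P.obj A)
    (y : P.obj B) : pc s x y = pc t x y :=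
  pc_eq hP ⟨fun a => (hu a).trans (t.std_rep.left a), fun b => (hv b).trans (t.std_rep.right b)⟩ x y

theorem map_pc (hP : Lawful P) (s : Ins A B C) (h : C ≃ C') (x : P.obj A) (y : P.obj B) :
    P.map h (pc s x y) = pc (s.post h) x y := by
  have hr := s.std_rep
  rw [pc_eq hP hr, pc_eq hP (c := s.stdLeft) (e := s.stdRight.trans h) ⟨fun a => ?_, fun b => ?_⟩,
    hP.map_trans]
  · have := congrArg (Option.map h) (hr.left a)
    rw [Option.map_map] at this
    exact this
  · exact congrArg (Option.map h) (hr.right b)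

theorem pc_map (hP : Lawful P) (s : Ins A B C) (f : A' ≃ A) (g : B' ≃ B) (x : P.obj A') (y : P.obj B') :
    pc s (P.map f x) (P.map g y) = pc (s.pre f g) x y := by
  have hr := s.std_rep
  rw [pc_eq hP hr, pc_eq hP (c := f.trans s.stdLeft)
      (e := (Equiv.sumCongr (Equiv.refl _) g).trans s.stdRight)
      ⟨fun a => hr.left (f a), fun b => hr.right (g b)⟩, hP.map_trans, hP.comp_map_right,
    hP.map_trans]

theorem pc_map_left (hP : Lawful P) (s : Ins A B C) (f : A' ≃ A) (x : P.obj A') (y : P.obj B) :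
    pc s (P.map f x) y = pc (s.pre f (Equiv.refl B)) x y := by
  rw [← pc_map hP, hP.map_refl]

/-- The hypotheses say that the two iterated identifications give the same label to each point of
`A`, `A'` and `B'`. In concrete cases they hold by computation, which spares explicit chains of
bijections. -/
theorem pc_nested (hP : Lawful P) (s : Ins A B C) (t : Ins A' B' B) (s₁ : Ins A A' D) (s₂ : Ins D B' C)
    (h₁ : ∀ a, s.u a = (s₁.u a).bind s₂.u) (h₂ : ∀ a, (s₁.v a).bind s₂.u = (t.u a).bind s.v)
    (h₃ : ∀ b, s₂.v b = (t.v b).bind s.v) (x : P.obj A) (y : P.obj A') (z : P.obj B') :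
    pc s x (pc t y z) = pc s₂ (pc s₁ x y) z := by
  have hs := s.std_rep
  have ht := t.std_rep
  set c := s.stdLeft
  set e := s.stdRight
  set c' := t.stdLeft
  set e' := t.stdRight
  have hv : s.v = fun b => some (e (.inr b)) := funext hs.right
  have hstar : s₁.star = s.star := by
    have := h₁ s₁.star
    rw [s₁.u_star] at this
    exact s.u_eq_none.1 this
  obtain ⟨e₁, hr₁⟩ := s₁.exists_rep c (by rw [hstar]; exact hs.star)
  have hu₁ : ∀ i, s₁.u (c.symm (some i)) = some (e₁ (.inl i)) := fun i => by
    rw [hr₁.left, Equiv.apply_symm_apply]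
    rfl
  have key : ∀ j, s₂.u (e₁ (.inr j)) = (t.u j).bind s.v := fun j => by
    have := h₂ j
    rwa [hr₁.right] at this
  have key' : ∀ i, s₂.u (e₁ (.inl i)) = some (e (.inl i)) := fun i => by
    have := h₁ (c.symm (some i))
    rw [hu₁, hs.left, Equiv.apply_symm_apply] at this
    exact this.symm
  have hr₂ : s₂.Rep (e₁.symm.trans ((Equiv.sumCongr (Equiv.refl _) c').trans (starRight _ _)))
      ((Equiv.sumAssoc _ _ _).trans ((Equiv.sumCongr (Equiv.refl _) e').trans e)) := by
    refine ⟨fun d => ?_, fun b => ?_⟩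
    · obtain ⟨m, rfl⟩ := e₁.surjective d
      rw [Equiv.trans_apply, Equiv.symm_apply_apply]
      rcases m with i | j
      · rw [key']
        rfl
      · rw [key, ht.left, hv]
        change _ = (starRight _ _ (.inr (c' j))).map _
        cases c' j <;> rfl
    · rw [h₃, ht.right, hv]
      rfl
  rw [pc_eq hP hs, pc_eq hP ht, pc_eq hP hr₁, pc_eq hP hr₂, hP.map_trans e₁, trans_symm_trans,
    hP.comp_map_right e', ← hP.map_trans (Equiv.sumCongr _ _),
    ← hP.comp_map_right c', hP.nested, hP.map_trans, hP.map_trans]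

/-- As in the nested case, agreement of labels suffices; moreover the two insertion points in `A`
have to be distinct. -/
theorem pc_parallel (hP : Lawful P) {p q : ℤ} (s₁ : Ins A B D) (s₂ : Ins D B' C) (t₁ : Ins A B' D')
    (t₂ : Ins D' B C) (h : s₁.star ≠ t₁.star)
    (h₁ : ∀ a, (s₁.u a).bind s₂.u = (t₁.u a).bind t₂.u) (h₂ : ∀ b, (s₁.v b).bind s₂.u = t₂.v b)
    (h₃ : ∀ b, s₂.v b = (t₁.v b).bind t₂.u) (x : P.obj A) {y : P.obj B} {z : P.obj B'}
    (hy : y ∈ P.deg B p) (hz : z ∈ P.deg B' q) :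
    pc s₂ (pc s₁ x y) z = (p * q).negOnePow • pc t₂ (pc t₁ x z) y := by
  -- Coordinates on `A` in which the two insertion points are the two extra points of the parallel
  -- law.
  obtain ⟨I, _, c, hc₁, hc₂⟩ : ∃ (I : Type) (_ : Finite I) (c : A ≃ Option (Option I)),
      c s₁.star = none ∧ c t₁.star = some none := by
    classical
    let a : {a // a ≠ s₁.star} := ⟨t₁.star, h.symm⟩
    refine ⟨{b // b ≠ a}, inferInstance,
      s₁.stdLeft.trans (Equiv.optionCongr (Equiv.optionSubtypeNe a).symm), ?_, ?_⟩
    · rw [Equiv.trans_apply, s₁.stdLeft_star]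
      rfl
    · have : s₁.stdLeft t₁.star = some a := by
        rw [← Equiv.eq_symm_apply]
        rfl
      rw [Equiv.trans_apply, this]
      exact congrArg some (Equiv.optionSubtypeNe_symm_self a)
  obtain ⟨e₁, hr₁⟩ := s₁.exists_rep c hc₁
  obtain ⟨f₁, hq₁⟩ := t₁.exists_rep (c.trans (swapStars I)) (by
    rw [Equiv.trans_apply, hc₂]; rfl)
  have hsu : ∀ i, s₁.u (c.symm (some i)) = some (e₁ (.inl i)) := fun i => by
    rw [hr₁.left, Equiv.apply_symm_apply]
    rfl
  have hs2 : ∀ i, (s₁.u (c.symm (some i))).bind s₂.u = s₂.u (e₁ (.inl i)) := fun i => by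
    rw [hsu]
    rfl
  have htu : ∀ i, t₁.u (c.symm (swapStars I (some i))) = some (f₁ (.inl i)) := fun i => by
    rw [hq₁.left, Equiv.trans_apply, Equiv.apply_symm_apply]
    cases i <;> rfl
  have hsn : s₂.u (e₁ (.inl none)) = none := by
    rw [← hs2, h₁, ← hc₂, Equiv.symm_apply_apply, t₁.u_star]
    rfl
  have htn : t₂.u (f₁ (.inl none)) = none := by
    have h' := h₁ s₁.star
    have : t₁.u s₁.star = some (f₁ (.inl none)) := by
      rw [← htu none, ← c.symm_apply_apply s₁.star, hc₁]
      rfl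
    rw [this, s₁.u_star] at h'
    exact h'.symm
  have hsv : ∀ b, s₂.u (e₁ (.inr b)) = t₂.v b := fun b => by
    rw [← h₂, hr₁.right]
    rfl
  have htv : ∀ b, t₂.u (f₁ (.inr b)) = s₂.v b := fun b => by
    rw [h₃, hq₁.right]
    rfl
  have hst : ∀ i, s₂.u (e₁ (.inl (some i))) = t₂.u (f₁ (.inl (some i))) := fun i => by
    have h' := h₁ (c.symm (some (some i)))
    rw [hsu] at h'
    have := htu (some i)
    rw [show swapStars I (some (some i)) = some (some i) from rfl] at this
    rw [this] at h'
    exact h'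
  obtain ⟨e₂, hr₂⟩ := s₂.exists_rep (e₁.symm.trans (starLeft I B)) (by
    rw [← s₂.u_eq_none.1 hsn, Equiv.trans_apply, Equiv.symm_apply_apply]; rfl)
  have hs3 : ∀ m, s₂.u (e₁ m) = (starLeft I B m).map fun i => e₂ (.inl i) := fun m => by
    rw [hr₂.left, Equiv.trans_apply, Equiv.symm_apply_apply]
  have hq₂ : t₂.Rep (f₁.symm.trans (starLeft I B')) ((swapRight I B B').trans e₂) := by
    refine ⟨fun d => ?_, fun b => ?_⟩
    · obtain ⟨m, rfl⟩ := f₁.surjective d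
      rw [Equiv.trans_apply, Equiv.symm_apply_apply]
      rcases m with (_ | i) | b
      · exact htn
      · rw [← hst, hs3]
        rfl
      · rw [htv, hr₂.right]
        rfl
    · rw [← hsv, hs3]
      rfl
  rw [pc_eq hP hr₁, pc_eq hP hr₂, pc_eq hP hq₁, pc_eq hP hq₂, hP.map_trans, hP.map_trans,
    trans_symm_trans, trans_symm_trans, hP.parallel _ hy hz, hP.map_trans, negOnePow_smul_map,
    hP.map_trans]

theorem pc_one (hP : Lawful P) (s : Ins A PUnit.{1} C) (e : A ≃ C) (h : ∀ a, s.u a = none ∨ s.u a = some (e a))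
    (h' : s.v PUnit.unit = some (e s.star)) (x : P.obj A) : pc s x P.one = P.map e x := by
  have hs := s.std_rep
  rw [pc_eq hP hs, hP.comp_one, hP.map_trans, hP.map_trans]
  congr 2
  refine Equiv.ext fun a => Option.some_injective _ ?_
  obtain ⟨i, rfl⟩ := s.stdLeft.symm.surjective a
  rw [Equiv.trans_apply, Equiv.trans_apply, Equiv.apply_symm_apply]
  cases i with
  | none =>
    have h₀ : s.stdLeft.symm none = s.star := by rw [← s.stdLeft_star, Equiv.symm_apply_apply]
    rw [h₀, ← h', hs.right]
    rfl
  | some i =>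
    have h₁ := hs.left (s.stdLeft.symm (some i))
    rw [Equiv.apply_symm_apply] at h₁
    rcases h (s.stdLeft.symm (some i)) with h | h
    · rw [h] at h₁
      cases h₁
    · rw [← h, h₁]
      rfl

theorem one_pc (hP : Lawful P) (s : Ins PUnit.{1} B C) (e : B ≃ C) (h : ∀ b, s.v b = some (e b)) (y : P.obj B) :
    pc s P.one y = P.map e y := by
  have hr : s.Rep (Equiv.ofUnique PUnit.{1} (Option Empty)) ((Equiv.emptySum Empty B).trans e) :=
    ⟨fun a => s.u_star, h⟩
  rw [pc_eq hP hr, ← hP.map_trans, hP.one_comp]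

end Pc

end Bessel
end

noncomputable section

namespace Bessel

universe u v

/-! ### Binary operations in an operad with generators `E` and `Ω` -/

/-- Operations `E` and `Ω` in the operad `P`, subject to the symmetries and relations of the
presented operad. -/
structure Presentation (P : OperadData.{u}) where
  gen : Gen → P.obj (Fin 2)
  lawful : Lawful P
  graded : IsGraded P
  gen_mem : ∀ g, gen g ∈ P.deg (Fin 2) g.degree
  gen_symm : ∀ g, P.map (Equiv.swap 0 1) (gen g) = g.symm • gen g
  rel₁ : graft3 P (Equiv.refl _) (gen .E) (gen .E) = graft3 P perm201 (gen .E) (gen .E)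
  rel₂ : graft3 P (Equiv.refl _) (gen .Om) (gen .E)
    = graft3 P perm102 (gen .E) (gen .Om) + graft3 P perm201 (gen .E) (gen .Om)

/-- Equality up to sign. -/
def PM {M : Type*} [AddCommGroup M] (x y : M) : Prop := x = y ∨ x = -y

/-! ### Equality up to sign -/

section PM

variable {M N : Type*} [AddCommGroup M] [AddCommGroup N] [Module ℚ M] [Module ℚ N]

omit [Module ℚ M] in
theorem PM.refl (x : M) : PM x x := .inl rfl

omit [Module ℚ M] in
theorem PM.symm {x y : M} (h : PM x y) : PM y x := by
  rcases h with rfl | rfl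
  · exact .inl rfl
  · exact .inr (neg_neg y).symm

omit [Module ℚ M] in
theorem PM.trans {x y z : M} (h : PM x y) (h' : PM y z) : PM x z := by
  rcases h with rfl | rfl <;> rcases h' with rfl | rfl
  · exact .inl rfl
  · exact .inr rfl
  · exact .inr rfl
  · exact .inl (neg_neg z)

theorem PM.map (f : M →ₗ[ℚ] N) {x y : M} (h : PM x y) : PM (f x) (f y) := by
  rcases h with rfl | rfl
  · exact .inl rfl
  · exact .inr (map_neg f y)

theorem PM.map₂ {M' : Type*} [AddCommGroup M'] [Module ℚ M'] (f : M →ₗ[ℚ] N →ₗ[ℚ] M') {x x' : M}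
    {y y' : N} (h : PM x x') (h' : PM y y') : PM (f x y) (f x' y') :=
  (PM.map (f.flip y) h).trans (PM.map (f x') h')

omit [Module ℚ M] in
theorem pm_negOnePow (n : ℤ) (x : M) : PM (n.negOnePow • x) x := by
  rcases Int.even_or_odd n with h | h
  · exact .inl (by rw [Int.negOnePow_even n h, one_smul])
  · exact .inr (by rw [Int.negOnePow_odd n h, Units.neg_smul, one_smul])

theorem pm_symm (g : Gen) (x : M) : PM (g.symm • x) x := by
  cases g
  · exact .inl (one_smul _ _)
  · exact .inr (neg_one_smul _ _)

omit [Module ℚ M] in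
theorem PM.eq_smul [Module ℚ M] {x y : M} (h : PM x y) : ∃ c : ℚ, x = c • y := by
  rcases h with rfl | rfl
  · exact ⟨1, (one_smul _ _).symm⟩
  · exact ⟨-1, (neg_one_smul _ _).symm⟩

end PM

namespace Ins

variable (I J K : Type) {C : Type}

/-- Insertion in the first input of a binary operation. -/
def slotA : Ins (Fin 2) I (Option I) where
  toEquiv :=
    { toFun
        | .inl 0 => none
        | .inl 1 => some none
        | .inr i => some (some i)
      invFun
        | none => .inl 0
        | some none => .inl 1
        | some (some i) => .inr i
      left_inv := by rintro (a | i) <;> [fin_cases a; skip] <;> rfl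
      right_inv := by rintro (_ | _ | i) <;> rfl }
  star := 0
  star_eq := rfl

/-- Insertion in the second input of a binary operation. -/
def slotB : Ins (Fin 2) I (Option I) := (slotA I).pre (Equiv.swap 0 1) (Equiv.refl I)

variable {I J} in
/-- The factorized identifications. -/
def insOf (e : I ⊕ J ≃ C) : Ins (Option I) J C where
  toEquiv := (starLeft I J).trans (Equiv.optionCongr e)
  star := none
  star_eq := rfl

/-- `g_{0,⋆} ∘ h_{1,2}`. -/
def triple : Ins (Fin 2) (Fin 2) (Fin 3) where
  toEquiv := (Equiv.sumCongr (finSuccEquivLast (n := 1)) (Equiv.refl (Fin 2))).trans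
    ((starLeft (Fin 1) (Fin 2)).trans (Equiv.optionCongr (finSumFinEquiv (m := 1) (n := 2))))
  star := 1
  star_eq := rfl

/-- Insertion in the first input of a ternary operation. -/
def slot₀ : Ins (Fin 3) I (Option (Option I)) where
  toEquiv :=
    { toFun
        | .inl 0 => none
        | .inl 1 => some none
        | .inl 2 => some (some none)
        | .inr i => some (some (some i))
      invFun
        | none => .inl 0
        | some none => .inl 1
        | some (some none) => .inl 2
        | some (some (some i)) => .inr i
      left_inv := by rintro (a | i) <;> [fin_cases a; skip] <;> rfl
      right_inv := by rintro (_ | _ | _ | i) <;> rfl }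
  star := 0
  star_eq := rfl

/-- Insertion in the second input of a ternary operation. -/
def slot₁ : Ins (Option (Option I)) J (Option (I ⊕ J)) where
  toEquiv := (starLeft (Option I) J).trans (Equiv.optionCongr (starLeft I J))
  star := none
  star_eq := rfl

/-- Insertion of a binary operation. -/
def insTwo : Ins (Option I) (Fin 2) (Option (Option I)) where
  toEquiv :=
    { toFun
        | .inl none => none
        | .inl (some i) => some (some (some i))
        | .inr 0 => some none
        | .inr 1 => some (some none)
      invFun
        | none => .inl none
        | some none => .inr 0
        | some (some none) => .inr 1
        | some (some (some i)) => .inl (some i)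
      left_inv := by rintro ((_ | i) | a) <;> [skip; skip; fin_cases a] <;> rfl
      right_inv := by rintro (_ | _ | _ | i) <;> rfl }
  star := none
  star_eq := rfl

/-- Insertion of a unary operation in a unary operation. -/
def insRight : Ins (Option I) (Option J) (Option (I ⊕ J)) where
  toEquiv := (starLeft I (Option J)).trans (Equiv.optionCongr (starRight I J))
  star := none
  star_eq := rfl

/-- Insertion of a unary operation in a unary operation. -/
def insLeft : Ins (Option J) (Option I) (Option (I ⊕ J)) :=
  (insRight J I).post (Equiv.optionCongr (Equiv.sumComm J I))

/-- Insertion of a unary operation in the second input of a binary operation. -/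
def binRight : Ins (Fin 2) (Option I) (Option (Option I)) :=
  (slotB (Option I)).post (swapStars I)

end Ins

/-- `J ⊔ (I ⊔ K) ≃ (I ⊔ J) ⊔ K`. -/
def leftComm (I J K : Type) : J ⊕ (I ⊕ K) ≃ (I ⊕ J) ⊕ K :=
  (Equiv.sumAssoc J I K).symm.trans (Equiv.sumCongr (Equiv.sumComm J I) (Equiv.refl K))

namespace Presentation

open Ins

variable {P : OperadData.{u}} (S : Presentation P) {I J K C D I' J' : Type} [Finite I] [Finite J]
  [Finite K] [Finite C] [Finite D] [Finite I'] [Finite J']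

/-- `x ↦ g(x, ⋆)`. -/
def lin (g : Gen) : P.obj I →ₗ[ℚ] P.obj (Option I) := pc (slotA I) (S.gen g)

/-- `(x, y) ↦ g(x, y)`. -/
def bin (g : Gen) (e : I ⊕ J ≃ C) : P.obj I →ₗ[ℚ] P.obj J →ₗ[ℚ] P.obj C :=
  pc (insOf e) ∘ₗ S.lin g

theorem bin_apply (g : Gen) (e : I ⊕ J ≃ C) (x : P.obj I) (y : P.obj J) :
    S.bin g e x y = pc (insOf e) (S.lin g x) y := rfl

theorem map_bin (g : Gen) (e : I ⊕ J ≃ C) (h : C ≃ D) (x : P.obj I) (y : P.obj J) :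
    P.map h (S.bin g e x y) = S.bin g (e.trans h) x y := by
  rw [bin_apply, bin_apply, map_pc S.lawful]
  apply pc_ext S.lawful
  · rintro (_ | i) <;> rfl
  · exact fun _ => rfl

theorem lin_map (g : Gen) (f : I ≃ I') (x : P.obj I) :
    S.lin g (P.map f x) = P.map (Equiv.optionCongr f) (S.lin g x) := by
  rw [lin, lin, map_pc S.lawful, ← S.lawful.map_refl (S.gen g), pc_map S.lawful,
    S.lawful.map_refl]
  apply pc_ext S.lawful
  · intro a
    fin_cases a <;> rfl
  · exact fun _ => rfl

theorem bin_map (g : Gen) (e : I' ⊕ J' ≃ C) (f : I ≃ I') (h : J ≃ J') (x : P.obj I)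
    (y : P.obj J) :
    S.bin g e (P.map f x) (P.map h y) = S.bin g ((Equiv.sumCongr f h).trans e) x y := by
  rw [bin_apply, lin_map, pc_map S.lawful]
  apply pc_ext S.lawful
  · rintro (_ | i) <;> rfl
  · exact fun _ => rfl

theorem pc_mem (h : IsGraded P) {A B : Type} [Finite A] [Finite B] (s : Ins A B C) {m n : ℤ}
    {x : P.obj A} {y : P.obj B} (hx : x ∈ P.deg A m) (hy : y ∈ P.deg B n) :
    pc s x y ∈ P.deg C (m + n) :=
  h.map_mem _ _ _ (h.comp_mem _ _ _ _ (h.map_mem _ _ _ hx) hy)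

theorem lin_mem (g : Gen) {n : ℤ} {x : P.obj I} (hx : x ∈ P.deg I n) :
    S.lin g x ∈ P.deg (Option I) (g.degree + n) :=
  pc_mem S.graded _ (S.gen_mem g) hx

theorem bin_mem (g : Gen) (e : I ⊕ J ≃ C) {m n : ℤ} {x : P.obj I} {y : P.obj J}
    (hx : x ∈ P.deg I m) (hy : y ∈ P.deg J n) :
    S.bin g e x y ∈ P.deg C (g.degree + m + n) :=
  pc_mem S.graded _ (S.lin_mem g hx) hy

theorem pc_slotB (g : Gen) (x : P.obj I) : pc (slotB I) (S.gen g) x = g.symm • S.lin g x := by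
  rw [slotB, ← pc_map_left S.lawful, S.gen_symm, map_smul, LinearMap.smul_apply, lin]

/-- The parallel law exchanges the order of the two insertions into the generator, and the symmetry
of the generator exchanges its inputs. Each costs a sign. -/
theorem bin_symm (g : Gen) (e : I ⊕ J ≃ C) {m n : ℤ} {x : P.obj I} {y : P.obj J}
    (hx : x ∈ P.deg I m) (hy : y ∈ P.deg J n) :
    PM (S.bin g e x y) (S.bin g ((Equiv.sumComm J I).trans e) y x) := by
  have h := pc_parallel S.lawful (slotA I) (insOf e) (slotB J)
    (insOf ((Equiv.sumComm J I).trans e)) (fun h => Fin.zero_ne_one h)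
    (fun a => by fin_cases a <;> rfl) (fun _ => rfl) (fun _ => rfl) (S.gen g) hx hy
  rw [pc_slotB, map_smul, LinearMap.smul_apply] at h
  rw [bin_apply, lin, h]
  exact (pm_negOnePow _ _).trans (pm_symm _ _)

theorem pc_bin {A : Type} [Finite A] (g : Gen) (e : I ⊕ J ≃ C) (s : Ins C K D) (s' : Ins J K A)
    (e' : I ⊕ A ≃ D) (h₁ : ∀ i, s.u (e (.inl i)) = some (e' (.inl i)))
    (h₂ : ∀ j, s.u (e (.inr j)) = (s'.u j).map fun a => e' (.inr a))
    (h₃ : ∀ k, s.v k = (s'.v k).map fun a => e' (.inr a)) (x : P.obj I) (y : P.obj J)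
    (z : P.obj K) : pc s (S.bin g e x y) z = S.bin g e' x (pc s' y z) := by
  refine (pc_nested S.lawful (insOf e') s' (insOf e) s ?_ ?_ ?_ (S.lin g x) y z).symm
  · rintro (_ | i)
    · rfl
    · exact (h₁ i).symm
  · intro j
    refine (h₂ j).trans ?_
    cases s'.u j <;> rfl
  · intro k
    refine (h₃ k).trans ?_
    cases s'.v k <;> rfl

/-- The identification of two points with `Fin 2`. -/
def twoPoints : PUnit.{1} ⊕ PUnit.{1} ≃ Fin 2 where
  toFun
    | .inl _ => 0
    | .inr _ => 1
  invFun
    | 0 => .inl PUnit.unit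
    | 1 => .inr PUnit.unit
  left_inv := by rintro (_ | _) <;> rfl
  right_inv a := by fin_cases a <;> rfl

/-- This places the generators themselves among the normal forms. -/
theorem bin_one_one (g : Gen) : S.bin g twoPoints P.one P.one = S.gen g := by
  let f : Fin 2 ≃ Option PUnit.{1} :=
    { toFun
        | 0 => some PUnit.unit
        | 1 => none
      invFun
        | some _ => 0
        | none => 1
      left_inv := fun a => by fin_cases a <;> rfl
      right_inv := by rintro (_ | _) <;> rfl }
  rw [bin_apply, lin, pc_one S.lawful (slotA PUnit) f (fun a => by
      fin_cases a <;> [exact .inl rfl; exact .inr rfl]) rfl, pc_map_left S.lawful,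
    pc_one S.lawful _ (Equiv.refl _) (fun a => by
      fin_cases a <;> [exact .inr rfl; exact .inl rfl]) rfl, S.lawful.map_refl]

/-- The three inputs of a ternary operation. -/
def plug (w : P.obj (Fin 3)) (e : (I ⊕ J) ⊕ K ≃ C) (x : P.obj I) (y : P.obj J) (z : P.obj K) :
    P.obj C :=
  pc (insOf e) (pc (slot₁ I J) (pc (slot₀ I) w x) y) z

theorem graft3_eq (hP : Lawful P) (σ : Equiv.Perm (Fin 3)) (g h : P.obj (Fin 2)) :
    graft3 P σ g h = pc (triple.post σ) g h := by
  rw [pc_eq hP (c := finSuccEquivLast) (e := (finSumFinEquiv (m := 1) (n := 2)).trans σ)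
    ⟨fun a => by fin_cases a <;> rfl, fun b => rfl⟩, graft3, hP.map_trans]

/-- The arguments are pulled out by nested associativity, leaving a ternary operation on which the
relations act. The one parallel exchange is between `x` and the inner generator, so only `x` must be
homogeneous. -/
theorem bin_bin_right (g h : Gen) (e : (I ⊕ J) ⊕ K ≃ C) {n : ℤ} {x : P.obj I}
    (hx : x ∈ P.deg I n) (y : P.obj J) (z : P.obj K) :
    PM (S.bin g ((Equiv.sumAssoc I J K).symm.trans e) x (S.bin h (Equiv.refl _) y z))
      (plug (graft3 P (Equiv.refl _) (S.gen g) (S.gen h)) e x y z) := by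
  have h₁ := pc_nested S.lawful (insOf ((Equiv.sumAssoc I J K).symm.trans e))
    (insOf (Equiv.refl (J ⊕ K))) (insRight I J) (insOf e) (by rintro (_ | i) <;> rfl)
    (by rintro (_ | j) <;> rfl) (fun _ => rfl) (S.lin g x) (S.lin h y) z
  have h₂ := pc_nested S.lawful (insRight I J) (slotA J) (insTwo I) (slot₁ I J)
    (by rintro (_ | i) <;> rfl) (fun a => by fin_cases a <;> rfl) (fun _ => rfl)
    (S.lin g x) (S.gen h) y
  have h₃ := pc_parallel S.lawful (slotA I) (insTwo I) triple (slot₀ I)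
    (fun h => Fin.zero_ne_one h) (fun a => by fin_cases a <;> rfl) (fun _ => rfl)
    (fun a => by fin_cases a <;> rfl) (S.gen g) hx (S.gen_mem h)
  have h₄ : pc triple (S.gen g) (S.gen h) = pc (triple.post (Equiv.refl _)) (S.gen g) (S.gen h) :=
    pc_ext S.lawful (fun a => by fin_cases a <;> rfl) (fun a => by fin_cases a <;> rfl) _ _
  rw [bin_apply, bin_apply, h₁, lin, lin, ← lin, h₂, lin, h₃, h₄, ← graft3_eq S.lawful]
  exact ((pm_negOnePow _ _).map₂ (pc (slot₁ I J)) (.refl y)).map₂ (pc (insOf e)) (.refl z)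

/-- For `(i, j, k) = (2, 0, 1)` the ternary operation is `g(z, h(x, y))`. Nested associativity and
the symmetry of `g` suffice, so no homogeneity is needed. -/
theorem plug_201 (g h : Gen) (e : (I ⊕ J) ⊕ K ≃ C) (x : P.obj I) (y : P.obj J) (z : P.obj K) :
    PM (plug (graft3 P perm201 (S.gen g) (S.gen h)) e x y z)
      (S.bin g e (S.bin h (Equiv.refl _) x y) z) := by
  have h₁ := pc_nested S.lawful (binRight I) (slotA I) (triple.post perm201) (slot₀ I)
    (fun a => by fin_cases a <;> rfl) (fun a => by fin_cases a <;> rfl) (fun _ => rfl)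
    (S.gen g) (S.gen h) x
  have h₂ := pc_nested S.lawful (slotB (I ⊕ J)) (insOf (Equiv.refl (I ⊕ J))) (binRight I)
    (slot₁ I J) (fun a => by fin_cases a <;> rfl) (by rintro (_ | i) <;> rfl) (fun _ => rfl)
    (S.gen g) (S.lin h x) y
  rw [plug, graft3_eq S.lawful, ← h₁, ← lin, ← h₂, ← bin_apply, pc_slotB, bin_apply]
  exact (pm_symm _ _).map₂ (pc (insOf e)) (.refl z)

/-- For `(i, j, k) = (1, 0, 2)` the operation is `g(y, h(x, z))`. The parallel law exchanges the
insertion of `y` with that of `h(x, ⋆)`. -/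
theorem plug_102 (g h : Gen) (e : (I ⊕ J) ⊕ K ≃ C) {m n : ℤ} {x : P.obj I} {y : P.obj J}
    (hx : x ∈ P.deg I m) (hy : y ∈ P.deg J n) (z : P.obj K) :
    PM (plug (graft3 P perm102 (S.gen g) (S.gen h)) e x y z)
      (S.bin g ((leftComm I J K).trans e) y (S.bin h (Equiv.refl _) x z)) := by
  have h₁ := pc_nested S.lawful (slotB (Option I)) (slotA I) (triple.post perm102) (slot₀ I)
    (fun a => by fin_cases a <;> rfl) (fun a => by fin_cases a <;> rfl) (fun _ => rfl)
    (S.gen g) (S.gen h) x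
  have h₂ := pc_parallel S.lawful (slotB (Option I)) (slot₁ I J) (slotA J) (insLeft I J)
    (fun h => Fin.zero_ne_one h.symm) (fun a => by fin_cases a <;> rfl)
    (by rintro (_ | i) <;> rfl) (fun _ => rfl) (S.gen g) (S.lin_mem h hx) hy
  have h₃ := pc_nested S.lawful (insOf ((leftComm I J K).trans e)) (insOf (Equiv.refl (I ⊕ K)))
    (insLeft I J) (insOf e) (by rintro (_ | i) <;> rfl) (by rintro (_ | j) <;> rfl)
    (fun _ => rfl) (S.lin g y) (S.lin h x) z
  rw [plug, graft3_eq S.lawful, ← h₁, ← lin, h₂, ← lin, bin_apply, bin_apply, h₃]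
  exact (pm_negOnePow _ _).map₂ (pc (insOf e)) (.refl z)

theorem plug_add (w w' : P.obj (Fin 3)) (e : (I ⊕ J) ⊕ K ≃ C) (x : P.obj I) (y : P.obj J)
    (z : P.obj K) : plug (w + w') e x y z = plug w e x y z + plug w' e x y z := by
  simp only [plug, map_add, LinearMap.add_apply]

/-- The operation `E` is associative up to sign. -/
theorem bin_assoc (e : (I ⊕ J) ⊕ K ≃ C) {n : ℤ} {x : P.obj I} (hx : x ∈ P.deg I n) (y : P.obj J)
    (z : P.obj K) :
    PM (S.bin .E ((Equiv.sumAssoc I J K).symm.trans e) x (S.bin .E (Equiv.refl _) y z))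
      (S.bin .E e (S.bin .E (Equiv.refl _) x y) z) := by
  refine (S.bin_bin_right .E .E e hx y z).trans ?_
  rw [S.rel₁]
  exact S.plug_201 .E .E e x y z

/-- The operation `Ω` is a derivation of `E` up to signs. -/
theorem bin_leibniz (e : (I ⊕ J) ⊕ K ≃ C) {m n : ℤ} {x : P.obj I} {y : P.obj J}
    (hx : x ∈ P.deg I m) (hy : y ∈ P.deg J n) (z : P.obj K) : ∃ c d : ℚ,
    S.bin .Om ((Equiv.sumAssoc I J K).symm.trans e) x (S.bin .E (Equiv.refl _) y z)
      = c • S.bin .E e (S.bin .Om (Equiv.refl _) x y) z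
        + d • S.bin .E ((leftComm I J K).trans e) y (S.bin .Om (Equiv.refl _) x z) := by
  obtain ⟨c, hc⟩ := (S.bin_bin_right .Om .E e hx y z).eq_smul
  obtain ⟨d, hd⟩ := (S.plug_201 .E .Om e x y z).eq_smul
  obtain ⟨d', hd'⟩ := (S.plug_102 .E .Om e hx hy z).eq_smul
  refine ⟨c * d, c * d', ?_⟩
  rw [hc, S.rel₂, plug_add, hd, hd', smul_add, smul_smul, smul_smul, add_comm]

end Presentation

end Bessel
end

noncomputable section

namespace Bessel

universe u v

/-! ### Combinatorics of trees -/

section TreeCombinatorics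

variable {X Y I J A B C : Type}

/-- The two trees grafted at the root, for a planar tree. -/
def planarChildren : FreeMagma X → Option (Sym2 (Tree X))
  | .of _ => none
  | .mul a b => some s((a : Tree X), (b : Tree X))

/-- The two trees grafted at the root. -/
def Tree.children (t : Tree X) : Option (Sym2 (Tree X)) :=
  Con.liftOn t planarChildren fun a b h => by
    induction h with
    | of s t h =>
      obtain ⟨a, b, rfl, rfl⟩ := h
      exact congrArg some Sym2.eq_swap
    | refl => rfl
    | symm _ ih => exact ih.symm
    | trans _ _ ih ih' => exact ih.trans ih'
    | @mul w x y z h h' _ _ =>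
      have e : (w : Tree X) = x := (Con.eq _).2 h
      have e' : (y : Tree X) = z := (Con.eq _).2 h'
      change some s((w : Tree X), (y : Tree X)) = some s((x : Tree X), (z : Tree X))
      rw [e, e']

theorem Tree.children_leaf (i : X) : (Tree.leaf i).children = none := rfl

theorem Tree.children_mul (s t : Tree X) : (s * t).children = some s(s, t) := by
  induction s, t using Con.induction_on₂ with
  | H a b => rfl

theorem Tree.mul_ne_leaf (s t : Tree X) (i : X) : s * t ≠ Tree.leaf i := fun h => by
  have := congrArg Tree.children h
  rw [Tree.children_mul, Tree.children_leaf] at this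
  cases this

/-- The unordered pair of subtrees at the root is well defined on the quotient, since commutativity
only exchanges its members. -/
theorem Tree.mul_eq_mul {s t s' t' : Tree X} (h : s * t = s' * t') :
    (s = s' ∧ t = t') ∨ (s = t' ∧ t = s') := by
  have := congrArg Tree.children h
  rw [Tree.children_mul, Tree.children_mul] at this
  exact Sym2.eq_iff.1 (Option.some_injective _ this)

theorem Tree.vertices_map (f : X → Y) (t : Tree X) : (t.map f).vertices = t.vertices := by
  induction t using Tree.induction with
  | leaf i => rfl
  | mul s t hs ht => rw [Tree.map_mul, Tree.vertices_mul, Tree.vertices_mul, hs, ht]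

theorem Tree.map_injective {f : X → Y} (hf : Function.Injective f) :
    Function.Injective (Tree.map f) := fun s t h => by
  obtain ⟨i, -⟩ := Multiset.exists_mem_of_ne_zero s.leaves_ne_zero
  have : Nonempty X := ⟨i⟩
  have := congrArg (Tree.map (Function.invFun f)) h
  rwa [Tree.map_map, Tree.map_map, Function.invFun_comp hf, Tree.map_id, Tree.map_id] at this

/-- A decomposition of `C` into two labelled parts is determined by its first part, up to
relabelling each of them. -/
theorem exists_sumCongr (e : I ⊕ J ≃ C) (e' : A ⊕ B ≃ C)
    (h : ∀ c, (∃ i, e (.inl i) = c) ↔ ∃ a, e' (.inl a) = c) :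
    ∃ (g : I ≃ A) (k : J ≃ B), (Equiv.sumCongr g k).trans e' = e := by
  have key : ∀ {I A : Type} (f : I → C) (f' : A → C), f.Injective → f'.Injective →
      Set.range f = Set.range f' → ∃ g : I ≃ A, ∀ i, f' (g i) = f i := by
    intro I A f f' hf hf' hr
    refine ⟨(Equiv.ofInjective f hf).trans ((Equiv.setCongr hr).trans
      (Equiv.ofInjective f' hf').symm), fun i => ?_⟩
    exact Equiv.apply_ofInjective_symm hf' _
  have hl : Set.range (e ∘ Sum.inl) = Set.range (e' ∘ Sum.inl) := Set.ext h
  have hr : Set.range (e ∘ Sum.inr) = Set.range (e' ∘ Sum.inr) := by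
    have hc : ∀ {I J : Type} (e : I ⊕ J ≃ C), Set.range (e ∘ Sum.inr) = (Set.range (e ∘ Sum.inl))ᶜ := by
      intro I J e
      rw [Set.range_comp, Set.range_comp, ← Set.image_compl_eq e.bijective, Set.compl_range_inl]
    rw [hc, hc, hl]
  obtain ⟨g, hg⟩ := key _ _ (e.injective.comp Sum.inl_injective)
    (e'.injective.comp Sum.inl_injective) hl
  obtain ⟨k, hk⟩ := key _ _ (e.injective.comp Sum.inr_injective)
    (e'.injective.comp Sum.inr_injective) hr
  refine ⟨g, k, Equiv.ext ?_⟩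
  rintro (i | j)
  · exact hg i
  · exact hk j

end TreeCombinatorics

/-! ### Normal forms -/

namespace Presentation

variable {P : OperadData.{u}} (S : Presentation P)

/-- The elements obtained from the unit and the operation `Ω`, indexed by trees. -/
inductive IsT : ∀ {I : Type} [Finite I], Tree I → P.obj I → Prop
  | one : IsT (Tree.leaf PUnit.unit) P.one
  | bin {I J C : Type} [Finite I] [Finite J] [Finite C] (e : I ⊕ J ≃ C) {s : Tree I} {t : Tree J}
      {x : P.obj I} {y : P.obj J} (hx : IsT s x) (hy : IsT t y) :
      IsT (s.map (fun i => e (.inl i)) * t.map (fun j => e (.inr j))) (S.bin .Om e x y)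
  | map {I J : Type} [Finite I] [Finite J] (e : I ≃ J) {t : Tree I} {x : P.obj I} (hx : IsT t x) :
      IsT (t.map e) (P.map e x)
  | neg {I : Type} [Finite I] {t : Tree I} {x : P.obj I} (hx : IsT t x) : IsT t (-x)

/-- The elements obtained by combining trees with the operation `E`. -/
inductive IsC : ∀ {I : Type} [Finite I], List (Tree I) → P.obj I → Prop
  | single {I : Type} [Finite I] {t : Tree I} {x : P.obj I} (hx : S.IsT t x) : IsC [t] x
  | cons {I J C : Type} [Finite I] [Finite J] [Finite C] (e : I ⊕ J ≃ C) {s : Tree I}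
      {l : List (Tree J)} {x : P.obj I} {y : P.obj J} (hx : S.IsT s x) (hy : IsC l y) :
      IsC (s.map (fun i => e (.inl i)) :: l.map (Tree.map fun j => e (.inr j))) (S.bin .E e x y)

variable {S} {I J K C D : Type} [Finite I] [Finite J] [Finite K] [Finite C] [Finite D]

theorem IsT.mem_deg {t : Tree I} {x : P.obj I} (h : S.IsT t x) : x ∈ P.deg I t.vertices := by
  induction h with
  | one => exact S.graded.one_mem
  | bin e _ _ hx hy =>
    have h := S.bin_mem .Om e hx hy
    rw [Tree.vertices_mul, Tree.vertices_map, Tree.vertices_map]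
    push_cast
    rwa [Gen.degree, add_assoc, add_comm] at h
  | map e _ hx =>
    rw [Tree.vertices_map]
    exact S.graded.map_mem e _ _ hx
  | neg _ hx => exact Submodule.neg_mem _ hx

theorem IsT.mem_leaves {t : Tree I} {x : P.obj I} (h : S.IsT t x) : ∀ i, i ∈ t.leaves := by
  induction h with
  | one => exact fun i => Multiset.mem_singleton.2 rfl
  | bin e _ _ hx hy =>
    intro c
    obtain ⟨m, rfl⟩ := e.surjective c
    rw [Tree.leaves_mul, Multiset.mem_add, Tree.leaves_map, Tree.leaves_map]
    rcases m with i | j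
    · exact .inl (Multiset.mem_map_of_mem _ (hx i))
    · exact .inr (Multiset.mem_map_of_mem _ (hy j))
  | map e _ hx =>
    intro c
    obtain ⟨i, rfl⟩ := e.surjective c
    rw [Tree.leaves_map]
    exact Multiset.mem_map_of_mem _ (hx i)
  | neg _ hx => exact hx

/-- Relabellings are absorbed into the identification `e` and signs into `PM`, so only the last
genuine operation remains. -/
theorem IsT.cases {t : Tree C} {x : P.obj C} (h : S.IsT t x) :
    (∃ e : PUnit.{1} ≃ C, t = Tree.leaf (e PUnit.unit) ∧ PM x (P.map e P.one)) ∨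
    ∃ (I J : Type) (_ : Finite I) (_ : Finite J) (e : I ⊕ J ≃ C) (s : Tree I) (s' : Tree J)
      (y : P.obj I) (z : P.obj J), S.IsT s y ∧ S.IsT s' z ∧
        t = s.map (fun i => e (.inl i)) * s'.map (fun j => e (.inr j)) ∧
        PM x (S.bin .Om e y z) := by
  induction h with
  | one => exact .inl ⟨Equiv.refl _, rfl, .inl (S.lawful.map_refl _).symm⟩
  | @bin I J C _ _ _ e s t x y hx hy _ _ =>
    exact .inr ⟨I, J, _, _, e, s, t, x, y, hx, hy, rfl, .refl _⟩
  | map e _ ih =>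
    rcases ih with ⟨e', rfl, h⟩ | ⟨I, J, _, _, e', s, s', y, z, hy, hz, rfl, h⟩
    · exact .inl ⟨e'.trans e, rfl, by rw [← S.lawful.map_trans]; exact h.map _⟩
    · refine .inr ⟨I, J, _, _, e'.trans e, s, s', y, z, hy, hz, ?_, by
        rw [← S.map_bin]; exact h.map _⟩
      rw [Tree.map_mul, Tree.map_map, Tree.map_map]
      rfl
  | neg _ ih =>
    have hn : ∀ {J : Type} [Finite J] (x : P.obj J), PM (-x) x := fun x => .inr rfl
    rcases ih with ⟨e', rfl, h⟩ | ⟨I, J, _, _, e', s, s', y, z, hy, hz, rfl, h⟩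
    · exact .inl ⟨e', rfl, (hn _).trans h⟩
    · exact .inr ⟨I, J, _, _, e', s, s', y, z, hy, hz, rfl, (hn _).trans h⟩

-- The leaves of the left subtree recover the left part of the decomposition of `C`.
omit [Finite C] in
theorem range_eq {A B I' J' : Type} {e : I' ⊕ J' ≃ C} {e' : A ⊕ B ≃ C} {s : Tree I'} {s' : Tree A}
    (hs : ∀ i, i ∈ s.leaves) (hs' : ∀ i, i ∈ s'.leaves)
    (h : s.map (fun i => e (.inl i)) = s'.map (fun i => e' (.inl i))) (c : C) :
    (∃ i, e (.inl i) = c) ↔ ∃ a, e' (.inl a) = c := by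
  have h' := congrArg (fun t => c ∈ Tree.leaves t) h
  simp only [Tree.leaves_map, Multiset.mem_map] at h'
  constructor
  · rintro ⟨i, hi⟩
    obtain ⟨a, -, ha⟩ := h'.mp ⟨i, hs i, hi⟩
    exact ⟨a, ha⟩
  · rintro ⟨i, hi⟩
    obtain ⟨a, -, ha⟩ := h'.mpr ⟨i, hs' i, hi⟩
    exact ⟨a, ha⟩

/-- The element attached to a tree is unique up to sign. -/
theorem IsT.unique {t : Tree I} {x : P.obj I} (h : S.IsT t x) : ∀ {C : Type} [Finite C]
    (f : I ≃ C) {x' : P.obj C}, S.IsT (t.map f) x' → PM x' (P.map f x) := by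
  induction h with
  | one =>
    intro C _ f x' h'
    rcases h'.cases with ⟨e, he, h⟩ | ⟨I, J, _, _, e, s, s', y, z, hy, hz, he, h⟩
    · have : e = f := Equiv.ext fun _ => (Tree.leaf_injective he).symm
      rwa [← this]
    · exact absurd he.symm (Tree.mul_ne_leaf _ _ _)
  | @bin I J C _ _ _ e s t x y hx hy ihx ihy =>
    intro D _ f x' h'
    rw [Tree.map_mul, Tree.map_map, Tree.map_map] at h'
    -- The case where the subtrees match in the given order; the exchanged order reduces to it by
    -- `bin_symm`.
    have key : ∀ {A B : Type} [Finite A] [Finite B] (e' : A ⊕ B ≃ D) {s' : Tree A} {t' : Tree B}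
        {y' : P.obj A} {z' : P.obj B}, S.IsT s' y' → S.IsT t' z' →
        s.map (fun i => (e.trans f) (.inl i)) = s'.map (fun i => e' (.inl i)) →
        t.map (fun i => (e.trans f) (.inr i)) = t'.map (fun i => e' (.inr i)) →
        PM (S.bin .Om e' y' z') (P.map f (S.bin .Om e x y)) := by
      intro A B _ _ e' s' t' y' z' hy' hz' hs ht
      obtain ⟨g, k, he⟩ := exists_sumCongr (e.trans f) e'
        (range_eq hx.mem_leaves hy'.mem_leaves hs)
      rw [← he] at hs ht
      have hs' : s' = s.map g := by
        refine Tree.map_injective (e'.injective.comp Sum.inl_injective) (hs.symm.trans ?_)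
        rw [Tree.map_map]
        rfl
      have ht' : t' = t.map k := by
        refine Tree.map_injective (e'.injective.comp Sum.inr_injective) (ht.symm.trans ?_)
        rw [Tree.map_map]
        rfl
      subst hs' ht'
      rw [S.map_bin, ← he, ← S.bin_map]
      exact (ihx g hy').map₂ (S.bin .Om e') (ihy k hz')
    rcases h'.cases with ⟨e, he, h⟩ | ⟨A, B, _, _, e', s', t', y', z', hy', hz', he', h⟩
    · exact absurd he (Tree.mul_ne_leaf _ _ _)
    · refine h.trans ?_
      rcases Tree.mul_eq_mul he' with ⟨h₁, h₂⟩ | ⟨h₁, h₂⟩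
      · exact key e' hy' hz' h₁ h₂
      · exact (S.bin_symm .Om e' hy'.mem_deg hz'.mem_deg).trans
          (key ((Equiv.sumComm B A).trans e') hz' hy' h₁ h₂)
  | map e _ ih =>
    intro C _ f x' h'
    rw [Tree.map_map] at h'
    rw [S.lawful.map_trans]
    exact ih (e.trans f) h'
  | neg _ ih =>
    intro C _ f x' h'
    exact (ih f h').trans (by rw [map_neg]; exact .inr (neg_neg _).symm)

theorem IsC.map {l : List (Tree I)} {x : P.obj I} (h : S.IsC l x) : ∀ {J : Type} [Finite J]
    (e : I ≃ J), S.IsC (l.map (Tree.map e)) (P.map e x) := by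
  cases h with
  | single hx => exact fun e => .single (hx.map e)
  | cons e hx hy =>
    intro J _ f
    have h := IsC.cons (e.trans f) hx hy
    rw [S.map_bin, List.map_cons, List.map_map, Tree.map_map]
    have : ∀ {J' : Type} (g : J' → I), Tree.map f ∘ Tree.map g = Tree.map fun j => f (g j) :=
      fun g => funext fun t => Tree.map_map g f t
    rw [this]
    exact h

theorem IsC.ne_nil {l : List (Tree I)} {x : P.obj I} (h : S.IsC l x) : l ≠ [] := by
  cases h <;> simp

theorem IsC.neg {l : List (Tree I)} {x : P.obj I} (h : S.IsC l x) : S.IsC l (-x) := by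
  cases h with
  | single hx => exact .single hx.neg
  | cons e hx hy =>
    have h := IsC.cons e hx.neg hy
    rwa [map_neg, LinearMap.neg_apply] at h

theorem IsC.pm {l : List (Tree I)} {x y : P.obj I} (h : S.IsC l x) (hy : PM y x) : S.IsC l y := by
  rcases hy with rfl | rfl
  · exact h
  · exact h.neg

theorem IsC.mem_deg {l : List (Tree I)} {x : P.obj I} (h : S.IsC l x) :
    x ∈ P.deg I (forestVertices (l : Multiset (Tree I))) := by
  induction h with
  | single hx =>
    convert hx.mem_deg
    simp [forestVertices]
  | cons e hx _ hy =>
    convert S.bin_mem .E e hx.mem_deg hy using 1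
    simp [forestVertices, Gen.degree, Function.comp_def, Tree.vertices_map]

theorem IsC.cases {l : List (Tree C)} {x : P.obj C} (h : S.IsC l x) :
    (∃ t, l = [t] ∧ S.IsT t x) ∨
    ∃ (I J : Type) (_ : Finite I) (_ : Finite J) (e : I ⊕ J ≃ C) (s : Tree I) (r : List (Tree J))
      (y : P.obj I) (z : P.obj J), S.IsT s y ∧ S.IsC r z ∧
        l = s.map (fun i => e (.inl i)) :: r.map (Tree.map fun j => e (.inr j)) ∧
        x = S.bin .E e y z := by
  cases h with
  | single hx => exact .inl ⟨_, rfl, hx⟩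
  | @cons I J _ _ _ _ e s l x y hx hy => exact .inr ⟨I, J, _, _, e, s, l, x, y, hx, hy, rfl, rfl⟩

/-- The element attached to a list of trees is unique up to sign. -/
theorem IsC.unique {l : List (Tree I)} {x : P.obj I} (h : S.IsC l x) : ∀ {C : Type} [Finite C]
    (f : I ≃ C) {x' : P.obj C}, S.IsC (l.map (Tree.map f)) x' → PM x' (P.map f x) := by
  induction h with
  | single hx =>
    intro C _ f x' h'
    rcases h'.cases with ⟨t, ht, h⟩ | ⟨I, J, _, _, e, s, r, y, z, hy, hz, he, h⟩
    · rw [List.map_cons, List.map_nil] at ht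
      cases ht
      exact hx.unique f h
    · rw [List.map_cons, List.map_nil] at he
      have := (List.cons.inj he).2
      exact absurd (List.map_eq_nil_iff.1 this.symm) hz.ne_nil
  | @cons I J C _ _ _ e s l x y hx hy ihy =>
    intro D _ f x' h'
    rcases h'.cases with ⟨t, ht, h⟩ | ⟨A, B, _, _, e', s', r, y', z', hy', hz', he', rfl⟩
    · rw [List.map_cons] at ht
      have := (List.cons.inj ht).2
      exact absurd (List.map_eq_nil_iff.1 (List.map_eq_nil_iff.1 this)) hy.ne_nil
    · rw [List.map_cons, Tree.map_map, List.map_map] at he'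
      obtain ⟨hs, hr⟩ := List.cons.inj he'
      obtain ⟨g, k, he⟩ := exists_sumCongr (e.trans f) e'
        (range_eq hx.mem_leaves hy'.mem_leaves hs)
      have hs' : s' = s.map g := by
        refine Tree.map_injective (e'.injective.comp Sum.inl_injective) (hs.symm.trans ?_)
        rw [Tree.map_map]
        refine congrArg (Tree.map · s) (funext fun i => ?_)
        exact (Equiv.congr_fun he (.inl i)).symm
      have hr' : r = l.map (Tree.map k) := by
        refine List.map_injective_iff.2 (Tree.map_injective
          (e'.injective.comp Sum.inr_injective)) (hr.symm.trans ?_)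
        rw [List.map_map]
        refine congrArg (List.map · l) (funext fun t => ?_)
        rw [Function.comp_apply, Function.comp_apply, Tree.map_map, Tree.map_map]
        refine congrArg (Tree.map · t) (funext fun i => ?_)
        exact (Equiv.congr_fun he (.inr i)).symm
      subst hs' hr'
      rw [S.map_bin, ← he, ← S.bin_map]
      exact (hx.unique g hy').map₂ (S.bin .E e') (ihy k hz')

end Presentation

end Bessel
end

noncomputable section

namespace Bessel

universe u v

/-! ### Independence of the order of the trees, and existence -/

namespace Presentation

variable {P : OperadData.{u}} {S : Presentation P} {I J K A C D X : Type} [Finite I] [Finite J]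
  [Finite K] [Finite A] [Finite C] [Finite D]

theorem bin_map_left (g : Gen) (e : A ⊕ J ≃ C) (f : I ≃ A) (x : P.obj I) (y : P.obj J) :
    S.bin g e (P.map f x) y = S.bin g ((Equiv.sumCongr f (Equiv.refl J)).trans e) x y := by
  rw [← S.bin_map, S.lawful.map_refl]

theorem bin_map_right (g : Gen) (e : I ⊕ A ≃ C) (f : J ≃ A) (x : P.obj I) (y : P.obj J) :
    S.bin g e x (P.map f y) = S.bin g ((Equiv.sumCongr (Equiv.refl I) f).trans e) x y := by
  rw [← S.bin_map, S.lawful.map_refl]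

theorem bin_bin (g h : Gen) (e : I ⊕ A ≃ C) (f : J ⊕ K ≃ A) (x : P.obj I) (y : P.obj J)
    (z : P.obj K) : S.bin g e x (S.bin h f y z)
      = S.bin g ((Equiv.sumAssoc I J K).symm.trans ((Equiv.sumAssoc I J K).trans
          ((Equiv.sumCongr (Equiv.refl I) f).trans e))) x (S.bin h (Equiv.refl _) y z) := by
  rw [← Equiv.trans_assoc, Equiv.symm_trans_self, Equiv.refl_trans, ← bin_map_right, map_bin,
    Equiv.refl_trans]

/-- Reassociate, exchange the inner pair, and reassociate back. This is the effect on an `E`-product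
of exchanging its first two trees. -/
theorem bin_left_comm (e : I ⊕ A ≃ C) (f : J ⊕ K ≃ A) {m n : ℤ} {x : P.obj I} {y : P.obj J}
    (hx : x ∈ P.deg I m) (hy : y ∈ P.deg J n) (z : P.obj K) :
    PM (S.bin .E e x (S.bin .E f y z))
      (S.bin .E ((leftComm I J K).trans ((Equiv.sumAssoc I J K).trans
        ((Equiv.sumCongr (Equiv.refl I) f).trans e))) y (S.bin .E (Equiv.refl _) x z)) := by
  rw [bin_bin]
  generalize (Equiv.sumAssoc I J K).trans ((Equiv.sumCongr (Equiv.refl I) f).trans e) = E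
  refine (S.bin_assoc E hx y z).trans ?_
  refine ((S.bin_symm .E _ hx hy).map₂ (S.bin .E E) (.refl z)).trans ?_
  have h : S.bin .E ((Equiv.sumComm J I).trans (Equiv.refl _)) y x
      = P.map (Equiv.sumComm J I) (S.bin .E (Equiv.refl _) y x) := by
    rw [map_bin]
    rfl
  rw [h, bin_map_left]
  exact (S.bin_assoc _ hy x z).symm

theorem IsC.swap {s t : Tree C} {r : List (Tree C)} {x : P.obj C} (h : S.IsC (s :: t :: r) x) :
    S.IsC (t :: s :: r) x := by
  rcases h.cases with ⟨_, h, -⟩ | ⟨I, A, _, _, e, s', r', y, z, hy, hz, he, rfl⟩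
  · cases h
  obtain ⟨rfl, hr⟩ := List.cons.inj he
  rcases hz.cases with ⟨t', rfl, hz'⟩ | ⟨J, K, _, _, f, t', r', z, w, hz', hw, rfl, rfl⟩
  · rw [List.map_cons, List.map_nil] at hr
    cases hr
    exact (IsC.cons ((Equiv.sumComm A I).trans e) hz' (.single hy)).pm
      (S.bin_symm .E e hy.mem_deg hz'.mem_deg)
  · rw [List.map_cons, List.map_map, Tree.map_map] at hr
    cases hr
    refine IsC.pm ?_ (bin_left_comm e f hy.mem_deg hz'.mem_deg w)
    have h := IsC.cons ((leftComm I J K).trans ((Equiv.sumAssoc I J K).trans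
        ((Equiv.sumCongr (Equiv.refl I) f).trans e))) hz' (IsC.cons (Equiv.refl _) hy hw)
    rw [List.map_cons, List.map_map, Tree.map_map] at h
    have hc : ∀ {A B : Type} (f : B → C) (g : A → B), Tree.map f ∘ Tree.map g
        = Tree.map fun a => f (g a) := fun f g => funext fun t => Tree.map_map g f t
    rw [hc] at h ⊢
    exact h

/-- The tail of a normal form lives on a smaller set of labels. The permutation is therefore one of
lists over a fixed `X`, to which all these sets map, and the induction can pass to the tail. -/
theorem IsC.exists_perm {l l' : List (Tree X)} (p : l.Perm l') : ∀ {A : Type} [Finite A]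
    (f : A → X) {m : List (Tree A)} {x : P.obj A}, S.IsC m x → m.map (Tree.map f) = l →
      ∃ m', m'.map (Tree.map f) = l' ∧ S.IsC m' x := by
  induction p with
  | nil => exact fun f m x h hm => ⟨m, hm, h⟩
  | @cons a l l' p ih =>
    intro A _ f m x h hm
    rcases h.cases with ⟨t, rfl, h'⟩ | ⟨I, J, _, _, e, s, r, y, z, hy, hz, rfl, rfl⟩
    · rw [List.map_cons, List.map_nil] at hm
      cases hm
      rw [p.symm.eq_nil]
      exact ⟨_, rfl, h⟩
    · have hf : Tree.map f ∘ Tree.map (fun j => e (.inr j)) = Tree.map fun j => f (e (.inr j)) :=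
        funext fun t => Tree.map_map _ _ t
      rw [List.map_cons, List.map_map, hf] at hm
      obtain ⟨ha, hr⟩ := List.cons.inj hm
      obtain ⟨r', rfl, hr'⟩ := ih _ hz hr
      exact ⟨_, by rw [List.map_cons, ha, List.map_map, hf], IsC.cons e hy hr'⟩
  | swap a b l =>
    intro A _ f m x h hm
    obtain ⟨b, r, rfl, rfl, hr⟩ := List.map_eq_cons_iff.1 hm
    obtain ⟨a, r, rfl, rfl, rfl⟩ := List.map_eq_cons_iff.1 hr
    exact ⟨_, rfl, h.swap⟩
  | trans _ _ ih ih' =>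
    intro A _ f m x h hm
    obtain ⟨m', hm', h'⟩ := ih f h hm
    exact ih' f h' hm'

theorem IsC.perm {l l' : List (Tree I)} {x : P.obj I} (h : S.IsC l x) (p : l.Perm l') :
    S.IsC l' x := by
  have hid : ∀ m : List (Tree I), m.map (Tree.map id) = m := fun m =>
    (List.map_congr_left fun t _ => Tree.map_id t).trans (List.map_id m)
  obtain ⟨m, hm, h'⟩ := IsC.exists_perm p id h (hid l)
  rw [hid] at hm
  rwa [← hm]

theorem IsT.nodup {t : Tree I} {x : P.obj I} (h : S.IsT t x) : t.leaves.Nodup := by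
  induction h with
  | one => exact Multiset.nodup_singleton _
  | bin e _ _ hx hy =>
    rw [Tree.leaves_mul, Tree.leaves_map, Tree.leaves_map, Multiset.nodup_add]
    refine ⟨hx.map (e.injective.comp Sum.inl_injective),
      hy.map (e.injective.comp Sum.inr_injective), Multiset.disjoint_left.2 @fun c hc hc' => ?_⟩
    obtain ⟨i, -, rfl⟩ := Multiset.mem_map.1 hc
    obtain ⟨j, -, hj⟩ := Multiset.mem_map.1 hc'
    cases e.injective hj
  | map e _ hx =>
    rw [Tree.leaves_map]
    exact hx.map e.injective
  | neg _ hx => exact hx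

theorem IsC.mem_leaves {l : List (Tree I)} {x : P.obj I} (h : S.IsC l x) :
    ∀ i, i ∈ (l : Multiset (Tree I)).bind Tree.leaves := by
  induction h with
  | single hx =>
    intro i
    rw [Multiset.coe_singleton, Multiset.singleton_bind]
    exact hx.mem_leaves i
  | cons e hx _ hy =>
    intro c
    obtain ⟨m, rfl⟩ := e.surjective c
    rw [← Multiset.cons_coe, Multiset.cons_bind, Multiset.mem_add, Tree.leaves_map, bind_map_leaves]
    rcases m with i | j
    · exact .inl (Multiset.mem_map_of_mem _ (hx.mem_leaves i))
    · exact .inr (Multiset.mem_map_of_mem _ (hy j))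

theorem IsC.nodup {l : List (Tree I)} {x : P.obj I} (h : S.IsC l x) :
    ((l : Multiset (Tree I)).bind Tree.leaves).Nodup := by
  induction h with
  | single hx =>
    rw [Multiset.coe_singleton, Multiset.singleton_bind]
    exact hx.nodup
  | cons e hx _ hy =>
    rw [← Multiset.cons_coe, Multiset.cons_bind, Tree.leaves_map, bind_map_leaves,
      Multiset.nodup_add]
    refine ⟨hx.nodup.map (e.injective.comp Sum.inl_injective),
      hy.map (e.injective.comp Sum.inr_injective), Multiset.disjoint_left.2 @fun c hc hc' => ?_⟩
    obtain ⟨i, -, rfl⟩ := Multiset.mem_map.1 hc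
    obtain ⟨j, -, hj⟩ := Multiset.mem_map.1 hc'
    cases e.injective hj

theorem IsC.isForest {l : List (Tree I)} {x : P.obj I} (h : S.IsC l x) :
    IsForest (l : Multiset (Tree I)) :=
  ⟨fun h' => h.ne_nil (Multiset.coe_eq_zero l |>.1 h'), h.nodup, h.mem_leaves⟩

/-- The leaves of a subtree form only a part of `X`, so its set of labels is built along with the
element and then mapped into `X`. -/
theorem exists_isT (S : Presentation P) (t : Tree X) (ht : t.leaves.Nodup) :
    ∃ (A : Type) (_ : Finite A) (f : A → X) (s : Tree A) (x : P.obj A),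
      f.Injective ∧ S.IsT s x ∧ s.map f = t := by
  induction t using Tree.induction with
  | leaf i =>
    exact ⟨PUnit, inferInstance, fun _ => i, _, _, fun _ _ _ => rfl, .one, rfl⟩
  | mul s t hs ht' =>
    rw [Tree.leaves_mul, Multiset.nodup_add] at ht
    obtain ⟨A, _, f, s, x, hf, hx, rfl⟩ := hs ht.1
    obtain ⟨B, _, g, t, y, hg, hy, rfl⟩ := ht' ht.2.1
    refine ⟨A ⊕ B, inferInstance, Sum.elim f g, _, _, hf.sumElim hg fun a b hab => ?_,
      .bin (Equiv.refl _) hx hy, ?_⟩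
    · refine Multiset.disjoint_left.1 ht.2.2 (?_ : f a ∈ _) ?_
      · rw [Tree.leaves_map]
        exact Multiset.mem_map_of_mem _ (hx.mem_leaves a)
      · rw [Tree.leaves_map, hab]
        exact Multiset.mem_map_of_mem _ (hy.mem_leaves b)
    · rw [Tree.map_mul, Tree.map_map, Tree.map_map]
      rfl

theorem exists_isC (S : Presentation P) (l : List (Tree X)) (hl : l ≠ [])
    (hn : ((l : Multiset (Tree X)).bind Tree.leaves).Nodup) :
    ∃ (A : Type) (_ : Finite A) (f : A → X) (m : List (Tree A)) (x : P.obj A),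
      f.Injective ∧ S.IsC m x ∧ m.map (Tree.map f) = l := by
  induction l with
  | nil => exact absurd rfl hl
  | cons t l ih =>
    rw [← Multiset.cons_coe, Multiset.cons_bind, Multiset.nodup_add] at hn
    obtain ⟨A, _, f, s, x, hf, hx, rfl⟩ := S.exists_isT t hn.1
    by_cases h : l = []
    · subst h
      exact ⟨A, inferInstance, f, [s], x, hf, .single hx, rfl⟩
    · obtain ⟨B, _, g, m, y, hg, hy, rfl⟩ := ih h hn.2.1
      refine ⟨A ⊕ B, inferInstance, Sum.elim f g, _, _, hf.sumElim hg fun a b hab => ?_,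
        .cons (Equiv.refl _) hx hy, ?_⟩
      · refine Multiset.disjoint_left.1 hn.2.2 (?_ : f a ∈ _) ?_
        · rw [Tree.leaves_map]
          exact Multiset.mem_map_of_mem _ (hx.mem_leaves a)
        · rw [bind_map_leaves, hab]
          exact Multiset.mem_map_of_mem _ (hy.mem_leaves b)
      · rw [List.map_cons, List.map_map, Tree.map_map]
        refine congrArg₂ _ rfl (List.map_congr_left fun t _ => ?_)
        rw [Function.comp_apply, Tree.map_map]
        rfl

theorem exists_isC_of_isForest (S : Presentation P) {l : List (Tree I)}
    (hl : IsForest (l : Multiset (Tree I))) : ∃ x : P.obj I, S.IsC l x := by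
  obtain ⟨A, _, f, m, x, hf, hx, rfl⟩ := S.exists_isC l (fun h => hl.1 (by rw [h]; rfl)) hl.2.1
  have hs : f.Surjective := fun i => by
    have := hl.2.2 i
    rw [bind_map_leaves] at this
    obtain ⟨a, -, ha⟩ := Multiset.mem_map.1 this
    exact ⟨a, ha⟩
  exact ⟨_, hx.map (Equiv.ofBijective f ⟨hf, hs⟩)⟩

end Presentation

end Bessel
end

noncomputable section

namespace Bessel

universe u v

/-! ### The span of the normal forms -/

namespace Presentation

open Ins

variable {P : OperadData.{u}} (S : Presentation P) {I J K A C D : Type} [Finite I] [Finite J]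
  [Finite K] [Finite A] [Finite C] [Finite D]

/-- The span of the normal forms. -/
def normal (I : Type) [Finite I] : Submodule ℚ (P.obj I) :=
  Submodule.span ℚ {x | ∃ l, S.IsC l x}

variable {S}

theorem IsC.mem_normal {l : List (Tree I)} {x : P.obj I} (h : S.IsC l x) : x ∈ S.normal I :=
  Submodule.subset_span ⟨l, h⟩

theorem _root_.Bessel.PM.mem {M : Type*} [AddCommGroup M] [Module ℚ M] {N : Submodule ℚ M} {x y : M}
    (h : PM x y) (hy : y ∈ N) : x ∈ N := by
  rcases h with rfl | rfl
  · exact hy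
  · exact N.neg_mem hy

theorem map_mem_normal (e : I ≃ J) {x : P.obj I} (hx : x ∈ S.normal I) : P.map e x ∈ S.normal J := by
  rw [normal] at hx
  induction hx using Submodule.span_induction with
  | mem x hx =>
    obtain ⟨l, hl⟩ := hx
    exact (hl.map e).mem_normal
  | zero => rw [map_zero]; exact Submodule.zero_mem _
  | add x y _ _ hx hy => rw [map_add]; exact Submodule.add_mem _ hx hy
  | smul c x _ hx => rw [map_smul]; exact Submodule.smul_mem _ c hx

theorem bin_bin_left (g h : Gen) (e : A ⊕ K ≃ C) (f : I ⊕ J ≃ A) (x : P.obj I) (y : P.obj J)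
    (z : P.obj K) : S.bin g e (S.bin h f x y) z
      = S.bin g ((Equiv.sumCongr f (Equiv.refl K)).trans e) (S.bin h (Equiv.refl _) x y) z := by
  rw [← bin_map_left, map_bin, Equiv.refl_trans]

/-- Associativity brings the brackets to the right, one tree of the left factor at a time. -/
theorem IsC.bin_E {l : List (Tree I)} {x : P.obj I} (h : S.IsC l x) : ∀ {J C : Type} [Finite J]
    [Finite C] (e : I ⊕ J ≃ C) {k : List (Tree J)} {y : P.obj J}, S.IsC k y →
      ∃ m, S.IsC m (S.bin .E e x y) := by
  induction h with
  | single hx => exact fun e _ _ hy => ⟨_, .cons e hx hy⟩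
  | cons f hx hx' ih =>
    intro J C _ _ e k y hy
    obtain ⟨m, hm⟩ := ih (Equiv.refl _) hy
    rw [bin_bin_left]
    exact ⟨_, (IsC.cons _ hx hm).pm (S.bin_assoc _ hx.mem_deg _ y).symm⟩

theorem bin_mem_of_mem_normal (g : Gen) (e : I ⊕ J ≃ C)
    (h : ∀ (l : List (Tree I)) x (k : List (Tree J)) y, S.IsC l x → S.IsC k y → S.bin g e x y ∈ S.normal C)
    {x : P.obj I} {y : P.obj J} (hx : x ∈ S.normal I) (hy : y ∈ S.normal J) :
    S.bin g e x y ∈ S.normal C :=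
  LinearMap.BilinMap.apply_apply_mem_of_mem_span _ {x | ∃ l, S.IsC l x} {y | ∃ l, S.IsC l y}
    (S.bin g e) (fun x ⟨l, hl⟩ y ⟨k, hk⟩ => h l x k y hl hk) x y hx hy

theorem bin_E_mem (e : I ⊕ J ≃ C) {x : P.obj I} {y : P.obj J} (hx : x ∈ S.normal I)
    (hy : y ∈ S.normal J) : S.bin .E e x y ∈ S.normal C := by
  refine bin_mem_of_mem_normal .E e (fun l x k y hl hk => ?_) hx hy
  obtain ⟨m, hm⟩ := hl.bin_E e hk
  exact hm.mem_normal

/-- The Leibniz rule moves `Ω(x, -)` onto one tree of `y` at a time, where it makes a larger tree.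
-/
theorem IsT.bin_Om_mem {s : Tree I} {x : P.obj I} (hx : S.IsT s x) {l : List (Tree J)} {y : P.obj J}
    (hy : S.IsC l y) : ∀ {C : Type} [Finite C] (e : I ⊕ J ≃ C), S.bin .Om e x y ∈ S.normal C := by
  induction hy with
  | single hy => exact fun e => (IsC.single (.bin e hx hy)).mem_normal
  | @cons J K A _ _ _ f t l y z hy hz ih =>
    intro C _ e
    rw [bin_bin]
    generalize (Equiv.sumAssoc I J K).trans ((Equiv.sumCongr (Equiv.refl I) f).trans e) = E
    obtain ⟨c, d, h⟩ := S.bin_leibniz E hx.mem_deg hy.mem_deg z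
    rw [h]
    refine Submodule.add_mem _ (Submodule.smul_mem _ _ (bin_E_mem _ ?_ hz.mem_normal))
      (Submodule.smul_mem _ _ (bin_E_mem _ (IsC.single hy).mem_normal (ih _)))
    exact (IsC.single (.bin _ hx hy)).mem_normal

/-- The same distribution over the trees of `y`; when only one tree is left, symmetry turns the
question into the preceding lemma, which distributes over the trees of `x`. -/
theorem IsC.bin_Om_mem {l : List (Tree J)} {y : P.obj J} (hy : S.IsC l y) {k : List (Tree I)}
    {x : P.obj I} (hx : S.IsC k x) :
    ∀ {C : Type} [Finite C] (e : I ⊕ J ≃ C), S.bin .Om e x y ∈ S.normal C := by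
  induction hy with
  | single hy =>
    exact fun e => PM.mem (S.bin_symm .Om e hx.mem_deg hy.mem_deg) (hy.bin_Om_mem hx _)
  | @cons J K A _ _ _ f t l y z hy hz ih =>
    intro C _ e
    rw [bin_bin]
    generalize (Equiv.sumAssoc I J K).trans ((Equiv.sumCongr (Equiv.refl I) f).trans e) = E
    obtain ⟨c, d, h⟩ := S.bin_leibniz E hx.mem_deg hy.mem_deg z
    rw [h]
    refine Submodule.add_mem _ (Submodule.smul_mem _ _ (bin_E_mem _ ?_ hz.mem_normal))
      (Submodule.smul_mem _ _ (bin_E_mem _ (IsC.single hy).mem_normal (ih _)))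
    exact PM.mem (S.bin_symm .Om _ hx.mem_deg hy.mem_deg) (hy.bin_Om_mem hx _)

theorem bin_mem_normal (g : Gen) (e : I ⊕ J ≃ C) {x : P.obj I} {y : P.obj J} (hx : x ∈ S.normal I)
    (hy : y ∈ S.normal J) : S.bin g e x y ∈ S.normal C := by
  cases g with
  | E => exact bin_E_mem e hx hy
  | Om => exact bin_mem_of_mem_normal .Om e (fun l x k y hl hk => hk.bin_Om_mem hl e) hx hy

variable (S) in
/-- The compositions of `x` with normal forms are combinations of normal forms. -/
def Absorbs {I : Type} [Finite I] (x : P.obj I) : Prop :=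
  ∀ {J C : Type} [Finite J] [Finite C] (s : Ins I J C) (y : P.obj J), y ∈ S.normal J →
    pc s x y ∈ S.normal C

/-- When the insertion point lies in the second argument, associativity moves the insertion inside
it. The new labels of that argument are those of `J` without `j`, together with `K`. -/
theorem exists_pc_bin (g : Gen) (e : I ⊕ J ≃ C) (s : Ins C K D) {j : J} (hj : s.star = e (.inr j)) :
    ∃ (A : Type) (_ : Finite A) (s' : Ins J K A) (e' : I ⊕ A ≃ D), ∀ (x : P.obj I) (y : P.obj J)
      (z : P.obj K), pc s (S.bin g e x y) z = S.bin g e' x (pc s' y z) := by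
  classical
  let c : J ≃ Option {j' // j' ≠ j} := (Equiv.optionSubtypeNe j).symm
  have hc : c j = none := Equiv.optionSubtypeNe_symm_self j
  obtain ⟨e₁, hr⟩ := s.exists_rep (e.symm.trans ((Equiv.sumCongr (Equiv.refl I) c).trans
    (starRight _ _))) (by
      rw [hj, Equiv.trans_apply, Equiv.symm_apply_apply]
      change starRight _ _ (.inr (c j)) = none
      rw [hc]
      rfl)
  let s' : Ins J K ({j' // j' ≠ j} ⊕ K) :=
    { toEquiv := (Equiv.sumCongr c (Equiv.refl K)).trans (starLeft _ K)
      star := j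
      star_eq := by
        change starLeft _ K (.inl (c j)) = none
        rw [hc]
        rfl }
  refine ⟨_, inferInstance, s', (Equiv.sumAssoc _ _ _).symm.trans e₁, fun x y z =>
    S.pc_bin g e s s' _ (fun i => ?_) (fun j' => ?_) (fun k => ?_) x y z⟩
  · rw [hr.left, Equiv.trans_apply, Equiv.symm_apply_apply]
    rfl
  · rw [hr.left, Equiv.trans_apply, Equiv.symm_apply_apply]
    change (starRight _ _ (.inr (c j'))).map _ = (starLeft _ K (.inl (c j'))).map _
    cases c j' <;> rfl
  · rw [hr.right]
    rfl

/-- The insertion takes place in one of the two arguments; if it is the first one, the arguments are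
exchanged beforehand, at the cost of a sign. -/
theorem Absorbs.bin (g : Gen) (e : I ⊕ J ≃ C) {m n : ℤ} {x : P.obj I} {y : P.obj J}
    (hx : x ∈ P.deg I m) (hy : y ∈ P.deg J n) (hxN : x ∈ S.normal I) (hyN : y ∈ S.normal J)
    (hxA : S.Absorbs x) (hyA : S.Absorbs y) : S.Absorbs (S.bin g e x y) := by
  intro K D _ _ s z hz
  rcases h : e.symm s.star with i | j
  · obtain ⟨A, _, s', e', h⟩ := S.exists_pc_bin g ((Equiv.sumComm J I).trans e) s (j := i) (by
      rw [Equiv.symm_apply_eq] at h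
      exact h)
    refine PM.mem ((S.bin_symm g e hx hy).map₂ (pc s) (.refl z)) ?_
    rw [h]
    exact bin_mem_normal g e' hyN (hxA s' z hz)
  · obtain ⟨A, _, s', e', h⟩ := S.exists_pc_bin g e s (j := j) ((Equiv.symm_apply_eq _).1 h)
    rw [h]
    exact bin_mem_normal g e' hxN (hyA s' z hz)

theorem IsT.absorbs {t : Tree I} {x : P.obj I} (h : S.IsT t x) : S.Absorbs x := by
  induction h with
  | one =>
    intro J C _ _ s y hy
    obtain ⟨e, he⟩ := s.exists_rep (Equiv.ofUnique PUnit.{1} (Option Empty))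
      (Subsingleton.elim _ _)
    rw [one_pc S.lawful s ((Equiv.emptySum Empty J).symm.trans e) he.right]
    exact map_mem_normal _ hy
  | bin e hx hy ihx ihy =>
    exact Absorbs.bin .Om e hx.mem_deg hy.mem_deg (IsC.single hx).mem_normal (IsC.single hy).mem_normal
      ihx ihy
  | map e _ ih =>
    intro J C _ _ s y hy
    rw [pc_map_left S.lawful]
    exact ih _ y hy
  | neg _ ih =>
    intro J C _ _ s y hy
    rw [map_neg, LinearMap.neg_apply]
    exact Submodule.neg_mem _ (ih s y hy)

theorem IsC.absorbs {l : List (Tree I)} {x : P.obj I} (h : S.IsC l x) : S.Absorbs x := by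
  induction h with
  | single hx => exact hx.absorbs
  | cons e hx hy ih =>
    exact Absorbs.bin .E e hx.mem_deg hy.mem_deg (IsC.single hx).mem_normal hy.mem_normal hx.absorbs ih

theorem comp_mem_normal {x : P.obj (Option I)} {y : P.obj J} (hx : x ∈ S.normal (Option I))
    (hy : y ∈ S.normal J) : P.comp x y ∈ S.normal (I ⊕ J) := by
  have h : P.comp x y = pc (insOf (Equiv.refl (I ⊕ J))) x y := by
    rw [pc_eq S.lawful (c := Equiv.refl _) (e := Equiv.refl _) ⟨fun a => by cases a <;> rfl,
      fun _ => rfl⟩, S.lawful.map_refl, S.lawful.map_refl]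
  rw [h]
  exact LinearMap.BilinMap.apply_apply_mem_of_mem_span _ {x | ∃ l, S.IsC l x}
    {y | ∃ l, S.IsC l y} (pc _) (fun x ⟨l, hl⟩ y ⟨k, hk⟩ => hl.absorbs _ _ hk.mem_normal) x y hx hy

theorem one_mem_normal : P.one ∈ S.normal PUnit := (IsC.single .one).mem_normal

theorem gen_mem_normal (g : Gen) : S.gen g ∈ S.normal (Fin 2) := by
  rw [← S.bin_one_one]
  exact bin_mem_normal g _ one_mem_normal one_mem_normal

end Presentation

/-! ### The presented operad -/

/-- The projection of formal combinations onto the presented operad. -/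
def formalToPresented (I : Type) [Finite I] : formalData.obj I →ₗ[ℚ] presentedOperad.obj I :=
  (quotientMk freeOperad BessRel).app I ∘ₗ (quotientMk formalData FreeRel).app I

/-- The presentation of the presented operad. -/
def presentedPresentation : Presentation presentedOperad where
  gen := presentedGen
  lawful := presented_lawful
  graded := presented_isGraded
  gen_mem g := (quotientMk freeOperad BessRel).app_mem _ _ _
    ((quotientMk formalData FreeRel).app_mem _ _ _ (mono_mem (.gen g)))
  gen_symm g := by
    have h := quotientMk_eq_zero (IdealMem.of _ (FreeRel.symm g))
    have h' := congrArg ((quotientMk freeOperad BessRel).app _) h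
    have e : formalToPresented _ (formalData.map (Equiv.swap 0 1) (mono (.gen g)) - g.symm • mono (.gen g)) = 0 := by
      rw [formal_map_mono, ← single_eq_smul_mono]
      exact h'.trans (map_zero _)
    rw [map_sub, map_smul, sub_eq_zero] at e
    exact e
  rel₁ := by
    have h := quotientMk_eq_zero (IdealMem.of _ BessRel.rel₁)
    rw [map_sub, sub_eq_zero, Hom.app_graft3, Hom.app_graft3] at h
    exact h
  rel₂ := by
    have h := quotientMk_eq_zero (IdealMem.of _ BessRel.rel₂)
    rw [map_sub, map_add, sub_eq_zero, Hom.app_graft3, Hom.app_graft3, Hom.app_graft3] at h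
    exact h

theorem formalToPresented_mono_mem {I : Type} (t : Monom I) : ∀ [Finite I],
    formalToPresented I (mono t) ∈ presentedPresentation.normal I := by
  induction t with
  | one => intro _; exact Presentation.one_mem_normal
  | gen g => intro _; exact Presentation.gen_mem_normal g
  | @map I J e t ih =>
    intro _
    have := Finite.of_equiv _ e.symm
    rw [← formal_map_mono]
    exact Presentation.map_mem_normal e ih
  | @comp I J s t ihs iht =>
    intro _
    have : Finite I := Finite.sum_left J
    have : Finite J := Finite.sum_right I
    rw [← formal_comp_mono]
    exact Presentation.comp_mem_normal ihs iht

/-- The span contains the unit and the generators and is stable under relabelling and composition,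
so it contains the class of every monomial. -/
theorem presented_normal (I : Type) [Finite I] : presentedPresentation.normal I = ⊤ := by
  refine eq_top_iff.2 fun x _ => ?_
  obtain ⟨x, rfl⟩ := quotientMk_surjective (P := freeOperad) (R := BessRel) I x
  obtain ⟨x, rfl⟩ := quotientMk_surjective (P := formalData) (R := FreeRel) I x
  change formalToPresented I x ∈ _
  have h : (presentedPresentation.normal I).mkQ ∘ₗ formalToPresented I = 0 :=
    formal_hom_ext fun t => (Submodule.Quotient.mk_eq_zero _).2 (formalToPresented_mono_mem t)
  exact (Submodule.Quotient.mk_eq_zero _).1 (LinearMap.congr_fun h x)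

end Bessel
end

noncomputable section

namespace Bessel

universe u v

/-! ### The images of the normal forms in `Bess` -/

open Ins

theorem Hom.app_pc {P : OperadData.{u}} {Q : OperadData.{v}} (f : Hom P Q) {A B C : Type}
    [Finite A] [Finite B] [Finite C] (s : Ins A B C) (x : P.obj A) (y : P.obj B) :
    f.app C (pc s x y) = pc s (f.app A x) (f.app B y) := by
  change f.app C (P.map s.stdRight (P.comp (P.map s.stdLeft x) y)) = _
  rw [f.app_map, f.app_comp, f.app_map]
  rfl

section Exterior

variable {I J X Y A B C : Type}

theorem pm_one_pow_smul {M : Type*} [AddCommGroup M] [Module ℚ M] (n : ℕ) (x : M) :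
    PM ((-1 : ℚ) ^ n • x) x := by
  rcases neg_one_pow_eq_or ℚ n with h | h
  · exact .inl (by rw [h, one_smul])
  · exact .inr (by rw [h, neg_one_smul])

theorem pm_inv_wedgeTrees (l : List (Tree X)) : PM (inv (wedgeTrees l)) (wedgeTrees l) := by
  rw [inv_of_mem (wedgeTrees_mem l)]
  exact pm_one_pow_smul _ _

/-- The partial composition of exterior products of trees. -/
def substAlong (c : A ≃ Option I) (e : I ⊕ B ≃ C) :
    ExteriorAlgebra ℚ (TreeVec A) →ₗ[ℚ] ExteriorAlgebra ℚ (TreeVec B) →ₗ[ℚ]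
      ExteriorAlgebra ℚ (TreeVec C) :=
  ((expandBilin (forgetB I B) (insertB I B)).compr₂ (relabel e).toLinearMap) ∘ₗ
    (relabel c).toLinearMap

theorem substAlong_apply (c : A ≃ Option I) (e : I ⊕ B ≃ C) (x : ExteriorAlgebra ℚ (TreeVec A))
    (y : ExteriorAlgebra ℚ (TreeVec B)) :
    substAlong c e x y = relabel e (subst (relabel c x) y) := rfl

/-- The factorization of `slotA`. -/
def slotLeft : Fin 2 ≃ Option PUnit.{1} where
  toFun
    | 0 => none
    | 1 => some PUnit.unit
  invFun
    | none => 0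
    | some _ => 1
  left_inv a := by fin_cases a <;> rfl
  right_inv := by rintro (_ | _) <;> rfl

/-- The factorization of `slotA`. -/
def slotRight (I : Type) : PUnit.{1} ⊕ I ≃ Option I where
  toFun
    | .inl _ => none
    | .inr i => some i
  invFun
    | none => .inl PUnit.unit
    | some i => .inr i
  left_inv := by rintro (_ | _) <;> rfl
  right_inv := by rintro (_ | _) <;> rfl

theorem slotA_rep (I : Type) : (slotA I).Rep slotLeft (slotRight I) :=
  ⟨fun a => by fin_cases a <;> rfl, fun _ => rfl⟩

theorem insOf_rep (e : I ⊕ J ≃ C) : (insOf e).Rep (Equiv.refl _) e :=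
  ⟨fun a => by cases a <;> rfl, fun _ => rfl⟩

theorem substAlong_slot_E (l : List (Tree I)) :
    PM (substAlong slotLeft (slotRight I) (wedgeTrees [Tree.leaf 0, Tree.leaf 1]) (wedgeTrees l))
      (wedgeTrees (Tree.leaf none :: l.map (Tree.map some))) := by
  have h : relabel slotLeft (wedgeTrees [Tree.leaf 0, Tree.leaf 1])
      = wedgeTrees [Tree.leaf none, Tree.leaf (some PUnit.unit)] := relabel_wedgeTrees _ _
  rw [substAlong_apply, h, subst_pair_left, map_neg, map_mul, relabel_ι_treeVec, relabel_relabel,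
    relabel_wedgeTrees, wedgeTrees_cons]
  exact .inr rfl

theorem substAlong_bin_E (e : I ⊕ J ≃ C) (l : List (Tree I)) (l' : List (Tree J)) :
    PM (substAlong (Equiv.refl _) e (wedgeTrees (Tree.leaf none :: l.map (Tree.map some)))
        (wedgeTrees l'))
      (wedgeTrees (l.map (Tree.map fun i => e (.inl i)) ++ l'.map (Tree.map fun j => e (.inr j)))) := by
  have h : relabel (Equiv.refl (Option I)) (wedgeTrees (Tree.leaf none :: l.map (Tree.map some)))
      = ExteriorAlgebra.ι ℚ (leafVec none) * relabel some (wedgeTrees l) := by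
    rw [relabel_wedgeTrees some, ← wedgeTrees_cons]
    exact relabel_id _
  rw [substAlong_apply, h, subst_ι_none_mul, map_mul, relabel_wedgeTrees, relabel_wedgeTrees,
    relabel_wedgeTrees, wedgeTrees_append, List.map_map]
  have h' : relabel e (inv (wedgeTrees (l.map (Tree.map Sum.inl))))
      = inv (wedgeTrees (l.map (Tree.map fun i => e (.inl i)))) := by
    rw [inv_of_mem (wedgeTrees_mem _), inv_of_mem (wedgeTrees_mem _), map_smul, relabel_wedgeTrees,
      List.map_map, List.length_map, List.length_map]
    exact congrArg (fun f => _ • wedgeTrees (List.map f l)) (funext fun t => Tree.map_map _ _ t)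
  have h'' : Tree.map e ∘ Tree.map Sum.inr = Tree.map fun j => e (.inr j) :=
    funext fun t => Tree.map_map _ _ t
  rw [h', h'']
  exact PM.map₂ (LinearMap.mul ℚ _) (pm_inv_wedgeTrees _) (.refl _)

theorem subst_mul_leaf (s : Tree I) (t : Tree J) :
    subst (wedgeTrees [s.map some * Tree.leaf none]) (wedgeTrees [t])
      = wedgeTrees [s.map Sum.inl * t.map Sum.inr] := by
  rw [wedgeTrees_singleton, subst_ι_mul_leaf, relabel_wedgeTrees, List.map_cons, List.map_nil,
    wedgeTrees_singleton, derivation_ι, ← treeVec_mul, wedgeTrees_singleton]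

theorem substAlong_slot_Om (t : Tree I) :
    PM (substAlong slotLeft (slotRight I) (wedgeTrees [Tree.leaf 0 * Tree.leaf 1])
        (wedgeTrees [t]))
      (wedgeTrees [t.map some * Tree.leaf none]) := by
  have h : relabel slotLeft (wedgeTrees [Tree.leaf 0 * Tree.leaf 1])
      = wedgeTrees [(Tree.leaf PUnit.unit).map some * Tree.leaf none] := by
    rw [relabel_wedgeTrees, Tree.mul_comm' ((Tree.leaf PUnit.unit).map some)]
    rfl
  rw [substAlong_apply, h, subst_mul_leaf, relabel_wedgeTrees, List.map_cons, List.map_nil,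
    Tree.map_mul, Tree.map_map, Tree.map_map, Tree.mul_comm']
  exact .inl rfl

theorem substAlong_bin_Om (e : I ⊕ J ≃ C) (s : Tree I) (t : Tree J) :
    PM (substAlong (Equiv.refl _) e (wedgeTrees [s.map some * Tree.leaf none]) (wedgeTrees [t]))
      (wedgeTrees [s.map (fun i => e (.inl i)) * t.map fun j => e (.inr j)]) := by
  have h : relabel (Equiv.refl (Option I)) (wedgeTrees [s.map some * Tree.leaf none])
      = wedgeTrees [s.map some * Tree.leaf none] := relabel_id _
  rw [substAlong_apply, h, subst_mul_leaf, relabel_wedgeTrees, List.map_cons, List.map_nil,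
    Tree.map_mul, Tree.map_map, Tree.map_map]
  exact .inl rfl

end Exterior

/-! ### Pure tensors of oriented forests, up to sign -/

section Shape

variable {I J A B C : Type} [Finite I] [Finite J] [Finite A] [Finite B] [Finite C]

/-- `z` is, up to sign, the oriented forest given by the list `k` of points and the list `l` of
trees. -/
def Shape (k : List I) (l : List (Tree I)) (z : BessSpace I) : Prop :=
  ∃ (o : DetSpace I) (x : BSpace I), z = o ⊗ₜ[ℚ] x ∧
    PM (leafLift I o.1) (wedgeTrees (k.map Tree.leaf)) ∧ PM x.1 (wedgeTrees l)

theorem Shape.neg {k : List I} {l : List (Tree I)} {z : BessSpace I} (h : Shape k l z) :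
    Shape k l (-z) := by
  obtain ⟨o, x, rfl, ho, hx⟩ := h
  exact ⟨-o, x, (TensorProduct.neg_tmul _ _).symm,
    PM.trans (.inr (by rw [Submodule.coe_neg, map_neg])) ho, hx⟩

theorem Shape.pm {k : List I} {l : List (Tree I)} {z z' : BessSpace I} (h : Shape k l z)
    (hz : PM z' z) : Shape k l z' := by
  rcases hz with rfl | rfl
  · exact h
  · exact h.neg

theorem Shape.bessMap (e : I ≃ J) {k : List I} {l : List (Tree I)} {z : BessSpace I}
    (h : Shape k l z) : Shape (k.map e) (l.map (Tree.map e)) (bessMap e z) := by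
  obtain ⟨o, x, rfl, ho, hx⟩ := h
  refine ⟨detMap e o, bMap e x, bessMap_tmul e o x, ?_, ?_⟩
  · rw [leafLift_detMap]
    refine (ho.map (relabel e).toLinearMap).trans (.inl ?_)
    rw [AlgHom.toLinearMap_apply, relabel_wedgeTrees, List.map_map, List.map_map]
    rfl
  · rw [coe_bMap]
    exact (hx.map (relabel e).toLinearMap).trans (.inl (relabel_wedgeTrees _ _))

theorem PM.mem_exteriorPower {X : Type} {x : ExteriorAlgebra ℚ (TreeVec X)} {l : List (Tree X)}
    (h : PM x (wedgeTrees l)) :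
    x ∈ (⋀[ℚ]^l.length (TreeVec X) : Submodule ℚ (ExteriorAlgebra ℚ (TreeVec X))) := by
  rcases h with rfl | rfl
  · exact wedgeTrees_mem l
  · exact Submodule.neg_mem _ (wedgeTrees_mem l)

/-- Through `leafLift`, the factors in `Det` and in `B` undergo the same substitution of exterior
products of trees. The sign operator contributes only a sign, since the factor in `B` is
homogeneous. -/
theorem Shape.pc {s : Ins A B C} {c : A ≃ Option I} {e : I ⊕ B ≃ C} (h : s.Rep c e) {k : List A}
    {l : List (Tree A)} {z : BessSpace A} (hz : Shape k l z) {k' : List B} {l' : List (Tree B)}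
    {z' : BessSpace B} (hz' : Shape k' l' z') {k'' : List C} {l'' : List (Tree C)}
    (hk : PM (substAlong c e (wedgeTrees (k.map Tree.leaf)) (wedgeTrees (k'.map Tree.leaf)))
      (wedgeTrees (k''.map Tree.leaf)))
    (hl : PM (substAlong c e (wedgeTrees l) (wedgeTrees l')) (wedgeTrees l'')) :
    Shape k'' l'' (Bessel.pc (P := Bess) s z z') := by
  have e₁ : Bessel.pc (P := Bess) s z z' = Bessel.bessMap e (bessComp I B (Bessel.bessMap c z) z') :=
    pc_eq bess_isOperad.laws h z z'
  obtain ⟨o, x, rfl, ho, hx⟩ := hz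
  obtain ⟨o', x', rfl, ho', hx'⟩ := hz'
  refine ⟨detMap e (detComp I B (detMap c o) o'),
    bMap e (bComp I B ((bSign (Option I) ^ (Nat.card B + 1)) (bMap c x)) x'), e₁, ?_, ?_⟩
  · rw [leafLift_detMap, leafLift_detComp, leafLift_detMap]
    exact (ho.map₂ (substAlong c e) ho').trans hk
  · rw [bSign_pow_bMap, bSign_pow_of_mem _ x hx.mem_exteriorPower, coe_bMap, coe_bComp, coe_bMap]
    have hs : PM ((-1 : ℚ) ^ ((l.length + 1) * (Nat.card B + 1)) • x).1 (wedgeTrees l) :=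
      ((pm_one_pow_smul _ x).map (BSpace A).subtype).trans hx
    exact (hs.map₂ (substAlong c e) hx').trans hl

/-- The trees in the generators of `B`. -/
def genTrees : Gen → List (Tree (Fin 2))
  | .E => [Tree.leaf 0, Tree.leaf 1]
  | .Om => [Tree.leaf 0 * Tree.leaf 1]

theorem shape_gen (g : Gen) : Shape [0, 1] (genTrees g) (bessGenT g) := by
  have h : Shape [0, 1] (genTrees g) (orient01 ⊗ₜ[ℚ] bGen g) :=
    ⟨_, _, rfl, .inl (leafLift_orient [0, 1] (by simp)), .inl (by cases g <;> rfl)⟩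
  have key : ∀ w : BessSpace (Fin 2), PM ((-g.symm) • w) w := fun w => by
    cases g with
    | E => exact .inr (neg_one_smul ℚ w)
    | Om => exact .inl (by rw [Gen.symm, neg_neg, one_smul])
  exact h.pm (key _)

theorem shape_one : Shape [PUnit.unit.{1}] [Tree.leaf PUnit.unit.{1}] (detOne ⊗ₜ[ℚ] bOne) :=
  ⟨_, _, rfl, .inl (by rw [leafLift_detOne]; exact (wedgeTrees_singleton _).symm),
    .inl (by rw [coe_bOne]; exact (wedgeTrees_singleton _).symm)⟩

omit [Finite I] [Finite J] [Finite C] in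
theorem substAlong_bin_leaves (e : I ⊕ J ≃ C) (k : List I) (k' : List J) :
    PM (substAlong (Equiv.refl _) e (wedgeTrees ((none :: k.map some).map Tree.leaf))
        (wedgeTrees (k'.map Tree.leaf)))
      (wedgeTrees ((k.map (fun i => e (.inl i)) ++ k'.map fun j => e (.inr j)).map Tree.leaf)) := by
  have h := substAlong_bin_E e (k.map Tree.leaf) (k'.map Tree.leaf)
  simp only [List.map_map] at h
  rw [List.map_cons, List.map_map, List.map_append, List.map_map, List.map_map]
  exact h

omit [Finite I] in
theorem substAlong_slot_leaves (k : List I) :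
    PM (substAlong slotLeft (slotRight I) (wedgeTrees ([0, 1].map Tree.leaf))
        (wedgeTrees (k.map Tree.leaf)))
      (wedgeTrees ((none :: k.map some).map Tree.leaf)) := by
  have h := substAlong_slot_E (k.map Tree.leaf)
  rw [List.map_map] at h
  rw [List.map_cons (f := Tree.leaf) (a := none), List.map_map]
  exact h

theorem Shape.bin_E (e : I ⊕ J ≃ C) {k : List I} {l : List (Tree I)} {z : BessSpace I}
    (hz : Shape k l z) {k' : List J} {l' : List (Tree J)} {z' : BessSpace J}
    (hz' : Shape k' l' z') :
    Shape (k.map (fun i => e (.inl i)) ++ k'.map fun j => e (.inr j))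
      (l.map (Tree.map fun i => e (.inl i)) ++ l'.map (Tree.map fun j => e (.inr j)))
      (Bessel.pc (P := Bess) (insOf e) (Bessel.pc (P := Bess) (slotA I) (bessGenT .E) z) z') :=
  Shape.pc (insOf_rep e) (Shape.pc (slotA_rep I) (shape_gen .E) hz (substAlong_slot_leaves k)
    (substAlong_slot_E l)) hz' (substAlong_bin_leaves e k k') (substAlong_bin_E e l l')

theorem Shape.bin_Om (e : I ⊕ J ≃ C) {k : List I} {s : Tree I} {z : BessSpace I}
    (hz : Shape k [s] z) {k' : List J} {t : Tree J} {z' : BessSpace J}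
    (hz' : Shape k' [t] z') :
    Shape (k.map (fun i => e (.inl i)) ++ k'.map fun j => e (.inr j))
      [s.map (fun i => e (.inl i)) * t.map fun j => e (.inr j)]
      (Bessel.pc (P := Bess) (insOf e) (Bessel.pc (P := Bess) (slotA I) (bessGenT .Om) z) z') :=
  Shape.pc (insOf_rep e) (Shape.pc (slotA_rep I) (shape_gen .Om) hz (substAlong_slot_leaves k)
    (substAlong_slot_Om s)) hz' (substAlong_bin_leaves e k k') (substAlong_bin_Om e s t)

/-- `k` enumerates `I`. -/
def Enumerates {I : Type} (k : List I) : Prop := k.Nodup ∧ ∀ i, i ∈ k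

omit [Finite I] [Finite J] [Finite C] in
theorem Enumerates.append (e : I ⊕ J ≃ C) {k : List I} {k' : List J} (h : Enumerates k)
    (h' : Enumerates k') :
    Enumerates (k.map (fun i => e (.inl i)) ++ k'.map fun j => e (.inr j)) := by
  refine ⟨List.nodup_append'.2 ⟨h.1.map (e.injective.comp Sum.inl_injective),
    h'.1.map (e.injective.comp Sum.inr_injective), fun c hc hc' => ?_⟩, fun c => ?_⟩
  · obtain ⟨i, -, rfl⟩ := List.mem_map.1 hc
    obtain ⟨j, -, hj⟩ := List.mem_map.1 hc'
    cases e.injective hj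
  · obtain ⟨i | j, rfl⟩ := e.surjective c
    · exact List.mem_append_left _ (List.mem_map.2 ⟨i, h.2 i, rfl⟩)
    · exact List.mem_append_right _ (List.mem_map.2 ⟨j, h'.2 j, rfl⟩)

omit [Finite I] [Finite J] in
theorem Enumerates.map (e : I ≃ J) {k : List I} (h : Enumerates k) : Enumerates (k.map e) :=
  ⟨h.1.map e.injective, fun j => List.mem_map.2 ⟨e.symm j, h.2 _, e.apply_symm_apply j⟩⟩

/-- The morphism to `Bess`. -/
def toBessSpace (I : Type) [Finite I] : presentedOperad.obj I →ₗ[ℚ] BessSpace I := toBess.app I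

theorem toBessSpace_bin (g : Gen) (e : I ⊕ J ≃ C) (x : presentedOperad.obj I)
    (y : presentedOperad.obj J) : toBessSpace C (presentedPresentation.bin g e x y)
      = pc (P := Bess) (insOf e) (pc (P := Bess) (slotA I) (bessGenT g) (toBessSpace I x))
        (toBessSpace J y) := by
  have h : toBess.app (Option I) (presentedPresentation.lin g x)
      = pc (P := Bess) (slotA I) (bessGenT g) (toBess.app I x) := by
    rw [← bessGen_eq, ← toBess_gen]
    exact toBess.app_pc _ _ _
  refine (toBess.app_pc (insOf e) (presentedPresentation.lin g x) y).trans ?_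
  rw [h]
  rfl

theorem toBess_isT {t : Tree I} {x : presentedOperad.obj I}
    (h : presentedPresentation.IsT t x) :
    ∃ k, Enumerates k ∧ Shape k [t] (toBessSpace I x) := by
  induction h with
  | one =>
    refine ⟨[PUnit.unit], ⟨List.nodup_singleton _, fun _ => List.mem_singleton.2 rfl⟩, ?_⟩
    have e : toBessSpace PUnit.{1} presentedOperad.one = detOne ⊗ₜ[ℚ] bOne := toBess.app_one
    rw [e]
    exact shape_one
  | bin e _ _ ihx ihy =>
    obtain ⟨k, hk, h⟩ := ihx
    obtain ⟨k', hk', h'⟩ := ihy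
    refine ⟨_, hk.append e hk', ?_⟩
    rw [toBessSpace_bin]
    exact h.bin_Om e h'
  | map e _ ih =>
    obtain ⟨k, hk, h⟩ := ih
    exact ⟨_, hk.map e, (toBess.app_map e _).symm ▸ h.bessMap e⟩
  | neg _ ih =>
    obtain ⟨k, hk, h⟩ := ih
    exact ⟨k, hk, by rw [map_neg]; exact h.neg⟩

theorem toBess_isC {l : List (Tree I)} {x : presentedOperad.obj I}
    (h : presentedPresentation.IsC l x) :
    ∃ k, Enumerates k ∧ Shape k l (toBessSpace I x) := by
  induction h with
  | single hx => exact toBess_isT hx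
  | cons e hx _ ih =>
    obtain ⟨k, hk, h⟩ := toBess_isT hx
    obtain ⟨k', hk', h'⟩ := ih
    refine ⟨_, hk.append e hk', ?_⟩
    rw [toBessSpace_bin]
    exact h.bin_E e h'

/-- The factor in `Det` is, up to sign, an enumeration of `I`, hence nonzero. The sign of the forest
is moved into it. -/
theorem exists_toBess_eq {l : List (Tree I)} {x : presentedOperad.obj I}
    (h : presentedPresentation.IsC l x) : ∃ o : DetSpace I, o ≠ 0 ∧
      toBessSpace I x = o ⊗ₜ[ℚ] orientedForest l h.isForest := by
  obtain ⟨k, hk, o, y, he, ho, hy⟩ := toBess_isC h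
  have ho' : o ≠ 0 := by
    rintro rfl
    have hl := leafLift_orient k (length_of_enumeration hk.1 hk.2)
    refine orient_ne_zero k (length_of_enumeration hk.1 hk.2) hk.1 (det_ext ?_)
    rw [hl]
    rcases ho with ho | ho
    · exact ho.symm
    · rw [← neg_neg (wedgeTrees _), ← ho, Submodule.coe_zero, map_zero, neg_zero]
  rcases hy with hy | hy
  · have : y = orientedForest l h.isForest := Subtype.ext hy
    exact ⟨o, ho', by rw [he, this]⟩
  · have : y = -orientedForest l h.isForest := Subtype.ext hy
    exact ⟨-o, neg_ne_zero.2 ho', by rw [he, this, TensorProduct.tmul_neg, TensorProduct.neg_tmul]⟩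

end Shape

end Bessel
end

noncomputable section

namespace Bessel

universe u v

/-! ### The isomorphism -/

section Main

variable {I J : Type} [Finite I] [Finite J]

omit [Finite I] in
theorem Forest.isForest_toList (F : Forest I) : IsForest (F.1.toList : Multiset (Tree I)) := by
  rw [Finset.coe_toList]
  exact F.2

/-- An element of the presented operad attached to a forest. -/
def forestElement (F : Forest I) : presentedOperad.obj I :=
  (presentedPresentation.exists_isC_of_isForest F.isForest_toList).choose

theorem forestElement_isC (F : Forest I) :
    presentedPresentation.IsC F.1.toList (forestElement F) :=
  (presentedPresentation.exists_isC_of_isForest F.isForest_toList).choose_spec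

/-- A normal form may be reordered to follow the chosen enumeration of its forest; by uniqueness it
is then the chosen element up to sign. -/
theorem span_forestElement :
    Submodule.span ℚ (Set.range (forestElement (I := I))) = ⊤ := by
  rw [← presented_normal I, Presentation.normal]
  refine le_antisymm (Submodule.span_mono ?_) (Submodule.span_le.2 ?_)
  · rintro _ ⟨F, rfl⟩
    exact ⟨_, forestElement_isC F⟩
  · rintro x ⟨l, hl⟩
    have p : l.Perm hl.isForest.forest.1.toList := by
      rw [← Multiset.coe_eq_coe, Finset.coe_toList]
      rfl
    have hid : (hl.isForest.forest.1.toList).map (Tree.map (Equiv.refl I))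
        = hl.isForest.forest.1.toList :=
      (List.map_congr_left fun t _ => Tree.map_id t).trans (List.map_id _)
    have h := (forestElement_isC hl.isForest.forest).unique (Equiv.refl I)
      (x' := x) (by rw [hid]; exact hl.perm p)
    rw [presented_lawful.map_refl] at h
    exact PM.mem h (Submodule.subset_span ⟨_, rfl⟩)

/-- The map sends a spanning family to a basis indexed by the same set, so the linear map sending
the basis back to the family is inverse to it. -/
theorem toBessSpace_bijective (I : Type) [Finite I] : Function.Bijective (toBessSpace I) := by
  obtain ⟨b, hb⟩ := exists_basis_bess I (fun F => toBessSpace I (forestElement F)) fun F => by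
    obtain ⟨o, ho, h⟩ := exists_toBess_eq (forestElement_isC F)
    exact ⟨o, _, _, ho, Finset.coe_toList _, h⟩
  let ψ : BessSpace I →ₗ[ℚ] presentedOperad.obj I := b.constr ℚ forestElement
  have h₁ : toBessSpace I ∘ₗ ψ = LinearMap.id := b.ext fun F => by
    rw [LinearMap.comp_apply, b.constr_basis, hb]
    rfl
  have h₂ : ψ ∘ₗ toBessSpace I = LinearMap.id := by
    refine LinearMap.ext_on span_forestElement ?_
    rintro _ ⟨F, rfl⟩
    rw [LinearMap.comp_apply, ← hb, b.constr_basis]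
    rfl
  exact ⟨fun x y h => (LinearMap.congr_fun h₂ x).symm.trans
    ((congrArg ψ h).trans (LinearMap.congr_fun h₂ y)), fun z => ⟨ψ z, LinearMap.congr_fun h₁ z⟩⟩

/-- Each oriented forest is the image of a multiple of a normal form, which is homogeneous of the
same degree. With injectivity this shows that the isomorphism also reflects degrees. -/
theorem bessDeg_le_map (I : Type) [Finite I] (n : ℤ) :
    bessDeg I n ≤ (presentedOperad.deg I n).map (toBessSpace I) := by
  refine Submodule.span_le.2 ?_
  rintro _ ⟨o, l, hl, rfl, rfl⟩
  obtain ⟨x, hx⟩ := presentedPresentation.exists_isC_of_isForest hl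
  obtain ⟨o', ho', h⟩ := exists_toBess_eq hx
  obtain ⟨c, rfl⟩ := det_eq_smul ho' o
  exact ⟨c • x, Submodule.smul_mem _ c hx.mem_deg, by rw [map_smul, h]; rfl⟩

/-- The isomorphism from the presented operad onto `Bess`. -/
def presentedIso : OperadIso presentedOperad Bess where
  equiv I _ := LinearEquiv.ofBijective (toBess.app I) (toBessSpace_bijective I)
  mem_deg_iff I _ n x := by
    refine ⟨fun h => ?_, fun h => toBess.app_mem I n x h⟩
    obtain ⟨y, hy, hxy⟩ := bessDeg_le_map I n h
    exact (toBessSpace_bijective I).1 hxy ▸ hy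
  map_map e x := toBess.app_map e x
  map_comp x y := toBess.app_comp x y
  map_one := toBess.app_one

theorem exists_isOuterOriented (F : Forest I) : ∃ x : Bess.obj I, IsOuterOriented F x := by
  obtain ⟨k, hk, hk'⟩ := exists_enumeration I
  exact ⟨_, k, length_of_enumeration hk hk', F.1.toList, F.isForest_toList, hk,
    Finset.coe_toList _, rfl⟩

theorem exists_basis_of_isOuterOriented (v : Forest I → Bess.obj I)
    (hv : ∀ F, IsOuterOriented F (v F)) :
    ∃ b : Module.Basis (Forest I) ℚ (Bess.obj I), ∀ F, b F = v F :=
  exists_basis_bess I v fun F => by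
    obtain ⟨k, hk, l, hl, hn, e, h⟩ := hv F
    exact ⟨_, l, hl, orient_ne_zero k hk hn, e, h⟩

end Main

end Bessel
end

theorem mainTheorem4 :
    Bessel.IsOperad Bessel.Bess ∧
    (∃ Φ : Bessel.OperadIso Bessel.presentedOperad Bessel.Bess,
      ∀ g : Bessel.Gen, Φ.equiv (Fin 2) (Bessel.presentedGen g) = Bessel.bessGen g) ∧
    (∀ (I : Type) [Finite I],
      (∀ F : Bessel.Forest I, ∃ x : Bessel.Bess.obj I, Bessel.IsOuterOriented F x) ∧
      ∀ v : Bessel.Forest I → Bessel.Bess.obj I, (∀ F, Bessel.IsOuterOriented F (v F)) →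
        ∃ b : Module.Basis (Bessel.Forest I) ℚ (Bessel.Bess.obj I), ∀ F, b F = v F) :=
  ⟨Bessel.bess_isOperad, ⟨Bessel.presentedIso, Bessel.toBess_gen⟩, fun _ _ =>
    ⟨Bessel.exists_isOuterOriented, Bessel.exists_basis_of_isOuterOriented⟩⟩
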